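/- Fix an integer $q>2$. The mean-field Potts measure on $\{1,\dots,q\}^n$ at inverse temperature $\beta$ is $\pi(\sigma)\propto\exp\big(-\frac{\beta}{n}\,\#\{\{i,j\}:\sigma_i\neq\sigma_j\}\big)$ (unordered pairs of vertices). Its Glauber dynamics $(\sigma_t)_{t\ge 0}$ at each step picks a uniformly random vertex $v$ and gives it a new spin, drawn from the conditional law given all other spins, i.e. spin $k$ with probability proportional to $\exp\big(\frac{\beta}{n}\#\{j\ne v:\sigma_j=k\}\big)$. Let $S(\sigma)\in[0,1]^q$ be the vector of the proportions of vertices of each spin, and put $$D_\beta(x)=\Big(1+(q-1)e^{\beta\frac{1-qx}{q-1}}\Big)^{-1}-x,\qquad \beta_{\mathsf u}=\sup\{\beta\ge 0: D_\beta(x)\ne 0\ \ \forall x\in(1/q,1)\},\qquad \beta_{\mathsf s}=q .$$ For $\beta\in(\beta_{\mathsf u},\beta_{\mathsf s})$ let $m_*<m_{\mathsf r}$ be the two zeros of $D_\beta$ in $(1/q,1)$. For $k\in\{1,\dots,q\}$ and $m\in[0,1]$ let $v_k(m)\in\mathbb R^q$ have $k$-th entry $m$ and all other entries $\frac{1-m}{q-1}$.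 For a sequence $\delta_n\to 0$ let $$\Omega^{\mathsf{dis}}=\{\sigma:\|S(\sigma)-(\tfrac1q,\dots,\tfrac1q)\|_1\le\delta_n\},\qquad \Omega^{\mathsf{ord},k}=\{\sigma:\|S(\sigma)-v_k(m_{\mathsf r})\|_1\le\delta_n\},$$ and, when these sets are non-empty, $\pi^{\mathsf{dis}}=\pi(\cdot\mid\Omega^{\mathsf{dis}})$ and $\pi^{\mathsf{ord},k}=\pi(\cdot\mid\Omega^{\mathsf{ord},k})$. **Theorem.** Let $q>2$ and $\beta\in(\beta_{\mathsf u},\beta_{\mathsf s})$. There are constants $c,C,\gamma_0>0$, depending only on $q$ and $\beta$, such that for every $\gamma\ge\gamma_0$, every $K$ and every sequence $\delta_n\to0$ the following holds for all sufficiently large $n$ (depending on $q,\beta,\gamma,K,(\delta_n)$). Let $k\in\{1,\dots,q\}$ (for instance $k=1$), and let $\sigma_0$ be a configuration such that, with $m=S_k(\sigma_0)$, $$\|S(\sigma_0)-v_k(m)\|_1\le K n^{-1/2}\log n .$$ 1. If $\frac1q<m\le m_*-\gamma n^{-1/2}$ and $\Omega^{\mathsf{dis}}\neq\emptyset$, then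 there is an integer $0\le T\le C n\log n$ such that, for the Glauber dynamics $(\sigma_t)$ started from $\sigma_0$ and $(\sigma'_t)$ started from $\sigma_0'\sim\pi^{\mathsf{dis}}$, $$\big\|\mathbb P_{\sigma_0}(S(\sigma_T)\in\cdot)-\mathbb P_{\sigma_0'}(S(\sigma_T')\in\cdot)\big\|_{\mathrm{TV}}\le e^{-c\gamma^2}.$$ 2. If $m\ge m_*+\gamma n^{-1/2}$ and $\Omega^{\mathsf{ord},k}\neq\emptyset$, then the same conclusion holds with $\sigma_0'\sim\pi^{\mathsf{ord},k}$. -/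

import Mathlib

namespace MeanFieldPotts

noncomputable section

/-- Spin configurations of the `q`-state Potts model on `n` vertices. -/
abbrev Config (n q : ℕ) : Type := Fin n → Fin q

/-- The number of edges of the complete graph on `n` vertices whose endpoints have different
spins (every unordered pair is counted once). -/
def disagreements {n q : ℕ} (σ : Config n q) : ℕ :=
  ((Finset.univ : Finset (Fin n × Fin n)).filter
    (fun e => e.1 < e.2 ∧ σ e.1 ≠ σ e.2)).card

/-- The unnormalized Potts weight `exp (-(β / n) * #{disagreeing edges})`. -/
def pottsWeight (n q : ℕ) (β : ℝ) (σ : Config n q) : ℝ :=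
  Real.exp (-(β / n) * disagreements σ)

/-- The mean-field Potts measure `π`, as a probability mass function on configurations. -/
def pottsMeasure (n q : ℕ) (β : ℝ) (σ : Config n q) : ℝ :=
  pottsWeight n q β σ / ∑ τ : Config n q, pottsWeight n q β τ

/-- The number of vertices other than `v` that have spin `k`. -/
def othersWithSpin {n q : ℕ} (σ : Config n q) (v : Fin n) (k : Fin q) : ℕ :=
  ((Finset.univ : Finset (Fin n)).filter (fun j => j ≠ v ∧ σ j = k)).card

/-- The probability that the resampled spin at `v` is `k`: the Potts conditional law of the spin
at `v` given all other spins. -/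
def resampleProb (n q : ℕ) (β : ℝ) (σ : Config n q) (v : Fin n) (k : Fin q) : ℝ :=
  Real.exp (β / n * othersWithSpin σ v k) /
    ∑ l : Fin q, Real.exp (β / n * othersWithSpin σ v l)

/-- The transition matrix of the Glauber dynamics: a uniformly random vertex has its spin
resampled. -/
def glauber (n q : ℕ) (β : ℝ) : Matrix (Config n q) (Config n q) ℝ :=
  Matrix.of fun σ τ =>
    (1 / (n : ℝ)) * ∑ v : Fin n, ∑ k : Fin q,
      if τ = Function.update σ v k then resampleProb n q β σ v k else 0

/-- The law of the Glauber dynamics after `t` steps, when the starting law is `μ`. -/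
def glauberLaw (n q : ℕ) (β : ℝ) (μ : Config n q → ℝ) (t : ℕ) : Config n q → ℝ :=
  Matrix.vecMul μ (glauber n q β ^ t)

/-- The proportions vector `S(σ)`: entry `k` is the fraction of vertices of spin `k`. -/
def proportions {n q : ℕ} (σ : Config n q) : Fin q → ℝ :=
  fun k => (((Finset.univ : Finset (Fin n)).filter (fun v => σ v = k)).card : ℝ) / n

/-- The `ℓ¹` distance of two vectors. -/
def l1Dist {q : ℕ} (x y : Fin q → ℝ) : ℝ := ∑ i, |x i - y i|

/-- The vector with entry `m` at position `k`, all other entries being `(1 - m) / (q - 1)`. -/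
def dominated {q : ℕ} (k : Fin q) (m : ℝ) : Fin q → ℝ :=
  fun i => if i = k then m else (1 - m) / ((q : ℝ) - 1)

/-- The drift function `D_β` of a dominant proportion `x`. -/
def drift (q : ℕ) (β x : ℝ) : ℝ :=
  (1 + ((q : ℝ) - 1) * Real.exp (β * ((1 - q * x) / ((q : ℝ) - 1))))⁻¹ - x

/-- The threshold `β_u`. -/
def betaU (q : ℕ) : ℝ :=
  sSup {β : ℝ | 0 ≤ β ∧ ∀ x ∈ Set.Ioo (1 / (q : ℝ)) 1, drift q β x ≠ 0}

/-- The threshold `β_s`. -/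
def betaS (q : ℕ) : ℝ := q

/-- The zeros of the drift function in `(1/q, 1)`; there are exactly two of them when
`2 < q` and `β_u < β < β_s`. -/
def driftZeros (q : ℕ) (β : ℝ) : Set ℝ :=
  {x | x ∈ Set.Ioo (1 / (q : ℝ)) 1 ∧ drift q β x = 0}

/-- The smaller zero `m_*` of the drift function in `(1/q, 1)`. -/
def mStar (q : ℕ) (β : ℝ) : ℝ := sInf (driftZeros q β)

/-- The larger zero `m_r` of the drift function in `(1/q, 1)`. -/
def mR (q : ℕ) (β : ℝ) : ℝ := sSup (driftZeros q β)

/-- The disordered phase with `ℓ¹` tolerance `δ`. -/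
def disPhase (n q : ℕ) (δ : ℝ) : Set (Config n q) :=
  {σ | l1Dist (proportions σ) (fun _ => 1 / (q : ℝ)) ≤ δ}

/-- The ordered phase dominated by spin `k`, with `ℓ¹` tolerance `δ`. -/
def ordPhase (n q : ℕ) (β : ℝ) (k : Fin q) (δ : ℝ) : Set (Config n q) :=
  {σ | l1Dist (proportions σ) (dominated k (mR q β)) ≤ δ}

/-- The probability of the event `E` under the mass function `μ` on a finite type. -/
def prob {Ω : Type*} [Fintype Ω] (μ : Ω → ℝ) (E : Set Ω) : ℝ := ∑ ω, E.indicator μ ω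

/-- The mass function of `μ (· ∣ E)`. -/
def condOn {Ω : Type*} [Fintype Ω] (μ : Ω → ℝ) (E : Set Ω) : Ω → ℝ :=
  fun ω => E.indicator μ ω / prob μ E

/-- The total-variation distance of the laws of the random variable `f` under `μ` and `ν`:
the supremum of `|μ (f ∈ A) - ν (f ∈ A)|` over all `A`. -/
def tvOf {Ω X : Type*} [Fintype Ω] (f : Ω → X) (μ ν : Ω → ℝ) : ℝ :=
  ⨆ A : Set X, |prob μ (f ⁻¹' A) - prob ν (f ⁻¹' A)|

/-- `π^dis = π (· ∣ Ω^dis)`. -/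
def piDis (n q : ℕ) (β δ : ℝ) : Config n q → ℝ :=
  condOn (pottsMeasure n q β) (disPhase n q δ)

/-- `π^{ord,k} = π (· ∣ Ω^{ord,k})`. -/
def piOrd (n q : ℕ) (β : ℝ) (k : Fin q) (δ : ℝ) : Config n q → ℝ :=
  condOn (pottsMeasure n q β) (ordPhase n q β k δ)

/-- The total-variation distance, at time `t`, of the proportions vectors of two Glauber dynamics
with starting laws `μ` and `ν`. -/
def proportionsTV (n q : ℕ) (β : ℝ) (μ ν : Config n q → ℝ) (t : ℕ) : ℝ :=
  tvOf (proportions (n := n) (q := q)) (glauberLaw n q β μ t) (glauberLaw n q β ν t)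

end

end MeanFieldPotts

/-! Let `m` be the proportion of the distinguished spin `k`. Up to an error of order (squared
deviation of the proportions from the axis `dominated k`) + 1/n, the mean one-step increment of `m`
is `drift q β m / n` (`abs_meanInc_sub_drift_le`). For β between the thresholds, the drift has the
simple zeros 1/q < m_* < m_r and no others. The outer two attract and the middle one repels
(`drift_structure`). Fluctuations near m_* live on the scale n^{-1/2}, so a start at distance γ
n^{-1/2} fails to reach the attracting point on its own side with probability at most e^{-cγ²}. Both
halves of the theorem are instances of `exists_mixing_time`, for an abstract attracting point `p` on
the side `s = ±1` of a repelling point `c` (`IsTarget`).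

No path space is used. All arguments concern the backward operator `stepE`, and probabilities of bad
events are bounded by functions that satisfy a one-step inequality. The time is 2T with T of order n
log n, in two halves.

Burn-in. `escapeBound` dominates the probability of not being near the target. It adds a Gaussian
barrier at `c`, an exponential barrier to the left of 1/q, the squared transverse deviation, and the
square of (L - x)/x, where x and L are the signed distances of `m` and of `p` from `c`. For a
logistic drift λx(L - x) this ratio decays exactly exponentially, so one function covers the whole
way from n^{-1/2} to order one. The deviation from the axis contracts because β < q
(`stepE_trans_le`).

Coupling. Near `dominated k p` the softmax map is an ℓ¹ contraction on vectors of equal total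
(`exists_softmax_contraction`), because its derivative there has norm at most 1 + D'(p) < 1.
Resampling the same vertex in both chains with maximally coupled spins therefore shrinks the
expected Hamming distance by a factor 1 - (1 - κ)/n per step (`iterate_stepE_sub_le`), until a chain
leaves the neighbourhood. That event is controlled by `exitBound`, since the squared distance to the
target grows in mean by only O(1/n²) per step (`stepE_targetDist_le`). -/

namespace MeanFieldPotts

noncomputable section

/-! ### The transition operator of the Glauber dynamics -/

/-- The expectation of `F` after one step of the Glauber dynamics. -/
def stepE (n q : ℕ) (β : ℝ) (F : Config n q → ℝ) (σ : Config n q) : ℝ :=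
  (1 / (n : ℝ)) * ∑ v : Fin n, ∑ l : Fin q,
    resampleProb n q β σ v l * F (Function.update σ v l)

variable {n q : ℕ} {β : ℝ}

lemma glauber_mulVec (F : Config n q → ℝ) :
    (glauber n q β).mulVec F = stepE n q β F := by
  funext σ
  simp only [Matrix.mulVec, dotProduct, glauber, Matrix.of_apply, stepE]
  simp_rw [mul_assoc, ← Finset.mul_sum, Finset.sum_mul]
  congr 1
  rw [Finset.sum_comm]
  refine Finset.sum_congr rfl fun v _ => ?_
  rw [Finset.sum_comm]
  refine Finset.sum_congr rfl fun l _ => ?_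
  simp

lemma glauber_pow_mulVec (F : Config n q → ℝ) (t : ℕ) :
    (glauber n q β ^ t).mulVec F = (stepE n q β)^[t] F := by
  induction t with
  | zero => simp
  | succ t ih =>
    rw [pow_succ', ← Matrix.mulVec_mulVec, ih, glauber_mulVec, Function.iterate_succ_apply']

/-- Moving the transition matrix from the law to the observable reduces every probability at time
`t` to a backward iterate of an indicator. -/
lemma prob_glauberLaw (μ : Config n q → ℝ) (t : ℕ) (E : Set (Config n q)) :
    prob (glauberLaw n q β μ t) E = ∑ σ, μ σ * (stepE n q β)^[t] (E.indicator 1) σ := by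
  have h : prob (glauberLaw n q β μ t) E = glauberLaw n q β μ t ⬝ᵥ E.indicator 1 := by
    simp only [prob, dotProduct]
    refine Finset.sum_congr rfl fun σ _ => ?_
    by_cases hσ : σ ∈ E <;> simp [hσ]
  rw [h, glauberLaw, ← Matrix.dotProduct_mulVec, glauber_pow_mulVec, dotProduct]

lemma resampleProb_nonneg (σ : Config n q) (v : Fin n) (l : Fin q) :
    0 ≤ resampleProb n q β σ v l := by
  unfold resampleProb; positivity

lemma sum_resampleProb [NeZero q] (σ : Config n q) (v : Fin n) :
    ∑ l, resampleProb n q β σ v l = 1 := by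
  unfold resampleProb
  rw [← Finset.sum_div, div_self]
  exact (Finset.sum_pos (fun _ _ => Real.exp_pos _) Finset.univ_nonempty).ne'

lemma stepE_mono_at {F G : Config n q → ℝ} {σ : Config n q}
    (h : ∀ v l, F (Function.update σ v l) ≤ G (Function.update σ v l)) :
    stepE n q β F σ ≤ stepE n q β G σ := by
  unfold stepE
  gcongr with v _ l _
  · exact resampleProb_nonneg σ v l
  · exact h v l

lemma stepE_mono {F G : Config n q → ℝ} (h : F ≤ G) : stepE n q β F ≤ stepE n q β G :=
  fun _ => stepE_mono_at fun _ _ => h _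

lemma stepE_add (F G : Config n q → ℝ) (σ : Config n q) :
    stepE n q β (fun τ => F τ + G τ) σ = stepE n q β F σ + stepE n q β G σ := by
  simp only [stepE, mul_add, Finset.sum_add_distrib]

lemma stepE_const_mul (c : ℝ) (F : Config n q → ℝ) (σ : Config n q) :
    stepE n q β (fun τ => c * F τ) σ = c * stepE n q β F σ := by
  simp only [stepE, Finset.mul_sum]
  refine Finset.sum_congr rfl fun v _ => Finset.sum_congr rfl fun l _ => by ring

lemma stepE_const [NeZero n] [NeZero q] (c : ℝ) (σ : Config n q) :
    stepE n q β (fun _ => c) σ = c := by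
  have hn : (n : ℝ) ≠ 0 := by exact_mod_cast NeZero.ne n
  simp only [stepE, ← Finset.sum_mul, sum_resampleProb]
  simp [hn]

lemma stepE_sum {ι : Type*} (s : Finset ι) (F : ι → Config n q → ℝ) (σ : Config n q) :
    stepE n q β (fun τ => ∑ i ∈ s, F i τ) σ = ∑ i ∈ s, stepE n q β (F i) σ := by
  classical
  induction s using Finset.induction_on with
  | empty => simp [stepE]
  | insert a s ha ih => simp only [Finset.sum_insert ha, stepE_add, ih]

lemma iterate_stepE_mono (t : ℕ) {F G : Config n q → ℝ} (h : F ≤ G) :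
    (stepE n q β)^[t] F ≤ (stepE n q β)^[t] G :=
  Monotone.iterate (f := stepE n q β) (fun _ _ h => stepE_mono h) t h

lemma iterate_stepE_add (t : ℕ) (F G : Config n q → ℝ) (σ : Config n q) :
    (stepE n q β)^[t] (fun τ => F τ + G τ) σ =
      (stepE n q β)^[t] F σ + (stepE n q β)^[t] G σ := by
  induction t generalizing F G with
  | zero => rfl
  | succ t ih =>
    simp only [Function.iterate_succ_apply]
    rw [← ih]
    exact congrFun (congrArg _ (funext fun τ => stepE_add F G τ)) σ

lemma iterate_stepE_const [NeZero n] [NeZero q] (t : ℕ) (c : ℝ) (σ : Config n q) :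
    (stepE n q β)^[t] (fun _ => c) σ = c := by
  induction t with
  | zero => rfl
  | succ t ih =>
    rw [Function.iterate_succ_apply]
    have : stepE n q β (fun _ => c) = fun _ => c := funext fun τ => stepE_const c τ
    rw [this, ih]

lemma iterate_stepE_mem_Icc [NeZero n] [NeZero q] {f : Config n q → ℝ}
    (hf : ∀ τ, f τ ∈ Set.Icc (0 : ℝ) 1) (t : ℕ) (σ : Config n q) :
    (stepE n q β)^[t] f σ ∈ Set.Icc (0 : ℝ) 1 := by
  constructor
  · have := iterate_stepE_mono (n := n) (q := q) (β := β) t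
      (F := fun _ => 0) (G := f) (fun τ => (hf τ).1) σ
    rwa [iterate_stepE_const] at this
  · have := iterate_stepE_mono (n := n) (q := q) (β := β) t
      (F := f) (G := fun _ => 1) (fun τ => (hf τ).2) σ
    rwa [iterate_stepE_const] at this

/-- Comparison with a supersolution `Ψ` of the dynamics on `R` that dominates outside `R`. -/
lemma iterate_stepE_le_of_supersolution [NeZero n] [NeZero q] {g : Config n q → ℝ}
    {R : Set (Config n q)} {Ψ : ℕ → Config n q → ℝ} (hg : ∀ τ, g τ ∈ Set.Icc (0 : ℝ) 1)
    (h0 : ∀ σ ∈ R, g σ ≤ Ψ 0 σ) (hout : ∀ t, ∀ σ ∉ R, 1 ≤ Ψ t σ)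
    (hstep : ∀ t, ∀ σ ∈ R, stepE n q β (Ψ t) σ ≤ Ψ (t + 1) σ) (t : ℕ) (σ : Config n q) :
    (stepE n q β)^[t] g σ ≤ Ψ t σ := by
  induction t generalizing σ with
  | zero =>
    by_cases hσ : σ ∈ R
    · exact h0 σ hσ
    · exact (hg σ).2.trans (hout 0 σ hσ)
  | succ t ih =>
    by_cases hσ : σ ∈ R
    · rw [Function.iterate_succ_apply']
      exact (stepE_mono (fun τ => ih τ) σ).trans (hstep t σ hσ)
    · exact (iterate_stepE_mem_Icc hg _ σ).2.trans (hout _ σ hσ)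

/-- Used with `exitBound`: a chain started near the target is still near it after the burn-in, at
the price of the exit bound for the combined time. -/
lemma iterate_stepE_le_shift {G : ℕ → Config n q → ℝ}
    (hG : ∀ t σ, stepE n q β (G t) σ ≤ G (t + 1) σ) (s t : ℕ) (σ : Config n q) :
    (stepE n q β)^[s] (G t) σ ≤ G (t + s) σ := by
  induction s generalizing σ with
  | zero => exact le_rfl
  | succ s ih =>
    rw [Function.iterate_succ_apply']
    exact (stepE_mono (fun τ => ih τ) σ).trans (hG (t + s) σ)

/-! ### Couplings -/

/-- The maximal coupling of two probability vectors. -/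
lemma exists_maximal_coupling {α : Type*} [Fintype α] [DecidableEq α] (a b : α → ℝ)
    (ha : ∀ i, 0 ≤ a i) (hb : ∀ i, 0 ≤ b i) (hab : ∑ i, a i = ∑ i, b i) :
    ∃ c : α → α → ℝ, (∀ i j, 0 ≤ c i j) ∧ (∀ i, ∑ j, c i j = a i) ∧ (∀ j, ∑ i, c i j = b j) ∧
      ∑ i, ∑ j, c i j * (if i = j then 0 else 1) ≤ (∑ i, |a i - b i|) / 2 := by
  set d : ℝ := ∑ i, (a i - min (a i) (b i)) with hd
  have hd' : d = ∑ i, (b i - min (a i) (b i)) := by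
    rw [hd, Finset.sum_sub_distrib, Finset.sum_sub_distrib, hab]
  have hd2 : d = (∑ i, |a i - b i|) / 2 := by
    have : d + d = ∑ i, |a i - b i| := by
      nth_rewrite 2 [hd']
      rw [hd, ← Finset.sum_add_distrib]
      refine Finset.sum_congr rfl fun i _ => ?_
      rcases le_total (a i) (b i) with h | h
      · rw [min_eq_left h, abs_of_nonpos (by linarith)]; ring
      · rw [min_eq_right h, abs_of_nonneg (by linarith)]; ring
    linarith
  have hA : ∀ i, 0 ≤ a i - min (a i) (b i) := fun i => sub_nonneg.2 (min_le_left _ _)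
  have hB : ∀ i, 0 ≤ b i - min (a i) (b i) := fun i => sub_nonneg.2 (min_le_right _ _)
  have hd0 : 0 ≤ d := Finset.sum_nonneg fun i _ => hA i
  -- The common mass goes on the diagonal and the excesses are coupled independently. If `d = 0`,
  -- the second term is 0 by the convention for division by zero, which is right because all
  -- excesses vanish then.
  refine ⟨fun i j => (if i = j then min (a i) (b i) else 0) +
      (a i - min (a i) (b i)) * (b j - min (a j) (b j)) / d, ?_, ?_, ?_, ?_⟩
  · intro i j
    have h1 := hA i
    have h2 := hB j
    have h3 : 0 ≤ min (a i) (b i) := le_min (ha i) (hb i)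
    dsimp only
    split_ifs <;> positivity
  · intro i
    rw [Finset.sum_add_distrib, ← Finset.sum_div, ← Finset.mul_sum, ← hd']
    rcases eq_or_lt_of_le hd0 with h | h
    · have := (Finset.sum_eq_zero_iff_of_nonneg (fun i _ => hA i)).1 (hd.symm.trans h.symm) i
        (Finset.mem_univ i)
      simp only [← h, div_zero, add_zero, Finset.sum_ite_eq, Finset.mem_univ, if_true]; linarith
    · rw [mul_div_assoc, div_self h.ne']; simp
  · intro j
    rw [Finset.sum_add_distrib, ← Finset.sum_div, ← Finset.sum_mul, ← hd]
    rcases eq_or_lt_of_le hd0 with h | h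
    · have := (Finset.sum_eq_zero_iff_of_nonneg (fun i _ => hB i)).1 (hd'.symm.trans h.symm) j
        (Finset.mem_univ j)
      simp only [← h, div_zero, add_zero, Finset.sum_ite_eq', Finset.mem_univ, if_true]; linarith
    · rw [mul_comm, mul_div_assoc, div_self h.ne']; simp
  · rw [← hd2]
    calc _ ≤ ∑ i, ∑ j, (a i - min (a i) (b i)) * (b j - min (a j) (b j)) / d := by
          refine Finset.sum_le_sum fun i _ => Finset.sum_le_sum fun j _ => ?_
          have h1 := hA i
          have h2 := hB j
          by_cases hij : i = j
          · simp only [hij, if_true, mul_zero]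
            rw [hij] at h1
            positivity
          · simp [hij]
      _ = d * d / d := by
          simp_rw [← Finset.sum_div, ← Finset.mul_sum, ← Finset.sum_mul]
          rw [← hd, ← hd']
      _ ≤ d := by
          rcases eq_or_lt_of_le hd0 with h | h
          · rw [← h]; simp
          · rw [mul_div_assoc, div_self h.ne', mul_one]

lemma hammingDist_update_le (σ τ : Config n q) (v : Fin n) (i j : Fin q) :
    (hammingDist (Function.update σ v i) (Function.update τ v j) : ℝ) ≤
      hammingDist σ τ - (if σ v = τ v then 0 else 1) + (if i = j then 0 else 1) := by
  have key : ∀ f g : Config n q, (hammingDist f g : ℝ) = ∑ w, if f w = g w then (0 : ℝ) else 1 := by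
    intro f g
    rw [hammingDist, Finset.card_filter]
    push_cast
    exact Finset.sum_congr rfl fun w _ => by by_cases h : f w = g w <;> simp [h]
  rw [key, key, ← Finset.add_sum_erase _ _ (Finset.mem_univ v),
    ← Finset.add_sum_erase (a := v) _ (fun w => if σ w = τ w then (0 : ℝ) else 1)
      (Finset.mem_univ v)]
  have : ∑ w ∈ Finset.univ.erase v, (if Function.update σ v i w = Function.update τ v j w
      then (0 : ℝ) else 1) = ∑ w ∈ Finset.univ.erase v, if σ w = τ w then (0 : ℝ) else 1 := by
    refine Finset.sum_congr rfl fun w hw => ?_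
    have hw' : w ≠ v := Finset.ne_of_mem_erase hw
    simp [hw']
  rw [this]
  simp only [Function.update_self]
  linarith

/-- One step of the Hamming coupling: if the resampling laws at every vertex are within total
variation distance `κ * hammingDist σ τ / n`, the expected distance contracts. -/
lemma stepE_sub_le_of_coupling [NeZero n] [NeZero q] {σ τ : Config n q} {u : Config n q → ℝ}
    {e : Config n q → ℝ} {A κ : ℝ} (hA : 0 ≤ A)
    (hu : ∀ σ' τ', u σ' - u τ' ≤ A * hammingDist σ' τ' + e σ' + e τ')
    (hκ : ∀ v, (∑ l, |resampleProb n q β σ v l - resampleProb n q β τ v l|) / 2 ≤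
      κ * hammingDist σ τ / n) :
    stepE n q β u σ - stepE n q β u τ ≤
      A * (1 - (1 - κ) / n) * hammingDist σ τ + stepE n q β e σ + stepE n q β e τ := by
  have hn : (0 : ℝ) < n := by exact_mod_cast Nat.pos_of_ne_zero (NeZero.ne n)
  set H : ℝ := (hammingDist σ τ : ℝ)
  have hsumdis : ∑ v, (if σ v = τ v then (0 : ℝ) else 1) = H := by
    simp only [H, hammingDist, Finset.card_filter]
    push_cast
    exact Finset.sum_congr rfl fun w _ => by by_cases h : σ w = τ w <;> simp [h]
  have hv : ∀ v, ∑ l, resampleProb n q β σ v l * u (Function.update σ v l) -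
      ∑ l, resampleProb n q β τ v l * u (Function.update τ v l) ≤
      A * (H - (if σ v = τ v then 0 else 1) + κ * H / n) +
        ∑ l, resampleProb n q β σ v l * e (Function.update σ v l) +
        ∑ l, resampleProb n q β τ v l * e (Function.update τ v l) := by
    intro v
    obtain ⟨c, hc0, hc1, hc2, hc3⟩ := exists_maximal_coupling
      (fun l => resampleProb n q β σ v l) (fun l => resampleProb n q β τ v l)
      (fun l => resampleProb_nonneg σ v l) (fun l => resampleProb_nonneg τ v l)
      ((sum_resampleProb σ v).trans (sum_resampleProb τ v).symm)
    have row : ∀ F : Config n q → ℝ, ∑ l, resampleProb n q β σ v l * F (Function.update σ v l) =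
        ∑ i, ∑ j, c i j * F (Function.update σ v i) := fun F =>
      Finset.sum_congr rfl fun i _ => by rw [← Finset.sum_mul, hc1]
    have col : ∀ F : Config n q → ℝ, ∑ l, resampleProb n q β τ v l * F (Function.update τ v l) =
        ∑ i, ∑ j, c i j * F (Function.update τ v j) := fun F => by
      rw [Finset.sum_comm]
      exact Finset.sum_congr rfl fun i _ => by rw [← Finset.sum_mul, hc2]
    have tot : ∑ i, ∑ j, c i j = 1 := by
      simp_rw [hc1]; exact sum_resampleProb σ v
    rw [row u, col u, row e, col e]
    set D : ℝ := H - (if σ v = τ v then 0 else 1) with hD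
    have h1 : ∑ i, ∑ j, c i j * u (Function.update σ v i) -
        ∑ i, ∑ j, c i j * u (Function.update τ v j) ≤
        ∑ i, ∑ j, (A * D * c i j + A * (c i j * (if i = j then 0 else 1)) +
          c i j * e (Function.update σ v i) + c i j * e (Function.update τ v j)) := by
      rw [← Finset.sum_sub_distrib]
      refine Finset.sum_le_sum fun i _ => ?_
      rw [← Finset.sum_sub_distrib]
      refine Finset.sum_le_sum fun j _ => ?_
      have h2 := hu (Function.update σ v i) (Function.update τ v j)
      have h3 := hammingDist_update_le σ τ v i j
      have h4 := mul_le_mul_of_nonneg_left h3 hA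
      have h5 := mul_le_mul_of_nonneg_left (h2.trans (by linarith [h4] :
        _ ≤ A * (D + (if i = j then 0 else 1)) + e (Function.update σ v i) +
          e (Function.update τ v j))) (hc0 i j)
      linarith
    refine h1.trans ?_
    simp_rw [Finset.sum_add_distrib, ← Finset.mul_sum]
    rw [tot]
    have := mul_le_mul_of_nonneg_left (hc3.trans (hκ v)) hA
    linarith
  have := Finset.sum_le_sum fun v (_ : v ∈ Finset.univ) => hv v
  rw [Finset.sum_sub_distrib, Finset.sum_add_distrib, Finset.sum_add_distrib, ← Finset.mul_sum,
    Finset.sum_add_distrib, Finset.sum_sub_distrib, hsumdis] at this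
  simp only [Finset.sum_const, Finset.card_univ, Fintype.card_fin, nsmul_eq_mul] at this
  have h2 := mul_le_mul_of_nonneg_left this (by positivity : (0 : ℝ) ≤ 1 / n)
  simp only [stepE]
  calc _ = _ := (mul_sub _ _ _).symm
    _ ≤ _ := h2
    _ = _ := by field_simp; ring

/-- Contraction of the Hamming coupling while both chains stay in `U`; `G` bounds the probability
of leaving `U`. -/
lemma iterate_stepE_sub_le [NeZero n] [NeZero q] {U : Set (Config n q)}
    {G : ℕ → Config n q → ℝ} {κ : ℝ} (hκ0 : 0 ≤ κ)
    (hU : ∀ σ ∈ U, ∀ τ ∈ U, ∀ v,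
      (∑ l, |resampleProb n q β σ v l - resampleProb n q β τ v l|) / 2 ≤
        κ * hammingDist σ τ / n)
    (hG0 : ∀ t σ, 0 ≤ G t σ) (hG1 : ∀ t, ∀ σ ∉ U, 1 ≤ G t σ)
    (hG : ∀ t σ, stepE n q β (G t) σ ≤ G (t + 1) σ)
    {f : Config n q → ℝ} (hf : ∀ τ, f τ ∈ Set.Icc (0 : ℝ) 1) (t : ℕ) (σ τ : Config n q) :
    (stepE n q β)^[t] f σ - (stepE n q β)^[t] f τ ≤
      (1 - (1 - κ) / n) ^ t * hammingDist σ τ + G t σ + G t τ := by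
  have hn : (1 : ℝ) ≤ n := by exact_mod_cast Nat.pos_of_ne_zero (NeZero.ne n)
  have hρ : 0 ≤ 1 - (1 - κ) / (n : ℝ) := by
    rw [sub_nonneg, div_le_one (by linarith)]; linarith
  have triv : ∀ t σ τ, (stepE n q β)^[t] f σ - (stepE n q β)^[t] f τ ≤ 1 := fun t σ τ => by
    have h1 := iterate_stepE_mem_Icc (β := β) hf t σ
    have h2 := iterate_stepE_mem_Icc (β := β) hf t τ
    linarith [h1.2, h2.1]
  induction t generalizing σ τ with
  | zero =>
    have h1 := hG0 0 σ
    have h2 := hG0 0 τ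
    -- Values in [0, 1] differ by at most 1, and distinct configurations have Hamming distance at
    -- least 1.
    rcases eq_or_ne σ τ with h | h
    · subst h; simp; linarith
    · have h3 : (1 : ℝ) ≤ hammingDist σ τ := by exact_mod_cast hammingDist_pos.2 h
      have := triv 0 σ τ
      simp only [pow_zero, one_mul]
      linarith
  | succ t ih =>
    have hH : 0 ≤ (1 - (1 - κ) / (n : ℝ)) ^ (t + 1) * hammingDist σ τ := by positivity
    have h1 := hG0 (t + 1) σ
    have h2 := hG0 (t + 1) τ
    by_cases hσ : σ ∈ U
    · by_cases hτ : τ ∈ U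
      · rw [Function.iterate_succ_apply', pow_succ]
        have := stepE_sub_le_of_coupling (β := β) (e := G t) (by positivity) ih (hU σ hσ τ hτ)
        linarith [hG t σ, hG t τ]
      · linarith [triv (t + 1) σ τ, hG1 (t + 1) τ hτ]
    · linarith [triv (t + 1) σ τ, hG1 (t + 1) σ hσ]

/-- Averaging a two-point bound over a burn-in period. -/
lemma iterate_stepE_sub_le_of_burnIn [NeZero n] [NeZero q] {h e : Config n q → ℝ} {N : ℝ}
    (hh : ∀ σ τ, h σ - h τ ≤ N + e σ + e τ) (s : ℕ) (σ τ : Config n q) :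
    (stepE n q β)^[s] h σ - (stepE n q β)^[s] h τ ≤
      N + (stepE n q β)^[s] e σ + (stepE n q β)^[s] e τ := by
  -- Independent evolution of the two chains: average over the first argument with the second
  -- frozen, then over the second.
  have h1 : ∀ τ', (stepE n q β)^[s] h σ ≤ (N + e τ' + h τ') + (stepE n q β)^[s] e σ := by
    intro τ'
    have := iterate_stepE_mono (n := n) (q := q) (β := β) s (F := h)
      (G := fun σ' => (N + e τ' + h τ') + e σ') (fun σ' => by linarith [hh σ' τ']) σ
    rwa [iterate_stepE_add s (fun _ => _) e, iterate_stepE_const] at this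
  have h2 := iterate_stepE_mono (n := n) (q := q) (β := β) s
    (F := fun _ => (stepE n q β)^[s] h σ - N - (stepE n q β)^[s] e σ)
    (G := fun τ' => e τ' + h τ') (fun τ' => by linarith [h1 τ']) τ
  rw [iterate_stepE_add s e h, iterate_stepE_const] at h2
  linarith

/-! ### Proportions and their mean increments -/

lemma proportions_eq_sum (σ : Config n q) (k : Fin q) :
    proportions σ k = (∑ v, if σ v = k then (1 : ℝ) else 0) / n := by
  simp [proportions]

lemma proportions_nonneg (σ : Config n q) (k : Fin q) : 0 ≤ proportions σ k := by
  unfold proportions; positivity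

lemma sum_proportions [NeZero n] (σ : Config n q) : ∑ k, proportions σ k = 1 := by
  have hn : (n : ℝ) ≠ 0 := by exact_mod_cast NeZero.ne n
  simp_rw [proportions_eq_sum]
  rw [← Finset.sum_div, Finset.sum_comm]
  simp [hn]

lemma proportions_le_one [NeZero n] (σ : Config n q) (k : Fin q) : proportions σ k ≤ 1 := by
  rw [← sum_proportions σ]
  exact Finset.single_le_sum (fun i _ => proportions_nonneg σ i) (Finset.mem_univ k)

lemma proportions_update (σ : Config n q) (v : Fin n) (l k : Fin q) :
    proportions (Function.update σ v l) k = proportions σ k +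
      ((if l = k then 1 else 0) - (if σ v = k then 1 else 0)) / n := by
  rw [proportions_eq_sum, proportions_eq_sum, ← add_div]
  congr 1
  rw [← Finset.add_sum_erase _ _ (Finset.mem_univ v),
    ← Finset.add_sum_erase (a := v) _ (fun w => if σ w = k then (1 : ℝ) else 0)
      (Finset.mem_univ v)]
  have : ∑ w ∈ Finset.univ.erase v, (if Function.update σ v l w = k then (1 : ℝ) else 0) =
      ∑ w ∈ Finset.univ.erase v, if σ w = k then (1 : ℝ) else 0 := by
    refine Finset.sum_congr rfl fun w hw => ?_
    simp [Finset.ne_of_mem_erase hw]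
  rw [this]
  simp only [Function.update_self]
  ring

lemma abs_proportions_update_sub_le (σ : Config n q) (v : Fin n) (l k : Fin q) :
    |proportions (Function.update σ v l) k - proportions σ k| ≤ 1 / n := by
  rw [proportions_update, add_sub_cancel_left, abs_div, Nat.abs_cast]
  gcongr
  split_ifs <;> simp

/-- The proportions of the spins of all vertices but `v`. -/
def othersProp (σ : Config n q) (v : Fin n) : Fin q → ℝ := fun k => othersWithSpin σ v k / n

lemma othersProp_eq (σ : Config n q) (v : Fin n) (k : Fin q) :
    othersProp σ v k = proportions σ k - (if σ v = k then 1 else 0) / n := by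
  rw [othersProp, proportions_eq_sum, ← sub_div]
  congr 1
  rw [othersWithSpin, Finset.card_filter, ← Finset.add_sum_erase (a := v) _
    (fun w => if σ w = k then (1 : ℝ) else 0) (Finset.mem_univ v), add_sub_cancel_left]
  push_cast
  rw [← Finset.add_sum_erase _ _ (Finset.mem_univ v)]
  simp only [ne_eq, not_true_eq_false, false_and, if_false, zero_add]
  refine Finset.sum_congr rfl fun w hw => ?_
  simp [Finset.ne_of_mem_erase hw]

/-- The Gibbs weights `exp (β s_k) / ∑ exp (β s_l)`. -/
def softmax (β : ℝ) (s : Fin q → ℝ) (k : Fin q) : ℝ :=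
  Real.exp (β * s k) / ∑ l, Real.exp (β * s l)

lemma resampleProb_eq_softmax (σ : Config n q) (v : Fin n) (k : Fin q) :
    resampleProb n q β σ v k = softmax β (othersProp σ v) k := by
  have h : ∀ l, β / n * (othersWithSpin σ v l : ℝ) = β * othersProp σ v l := fun l => by
    rw [othersProp]; ring
  simp only [resampleProb, softmax, h]

lemma sum_exp_pos (β : ℝ) (s : Fin q → ℝ) (k : Fin q) : 0 < ∑ l, Real.exp (β * s l) :=
  Finset.sum_pos (fun _ _ => Real.exp_pos _) ⟨k, Finset.mem_univ k⟩

lemma softmax_nonneg (β : ℝ) (s : Fin q → ℝ) (k : Fin q) : 0 ≤ softmax β s k := by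
  unfold softmax; positivity

lemma softmax_le_one (β : ℝ) (s : Fin q → ℝ) (k : Fin q) : softmax β s k ≤ 1 := by
  unfold softmax
  rw [div_le_one (sum_exp_pos β s k)]
  exact Finset.single_le_sum (f := fun l => Real.exp (β * s l))
    (fun i _ => (Real.exp_pos _).le) (Finset.mem_univ k)

lemma exp_sub_one_le_mul_exp (u : ℝ) : Real.exp u - 1 ≤ u * Real.exp u := by
  have h1 := Real.add_one_le_exp (-u)
  have h2 : Real.exp (-u) * Real.exp u = 1 := by rw [← Real.exp_add]; simp
  nlinarith [Real.exp_pos u]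

/-- The numerator and the denominator each change by a factor of at most `exp (β * ε)`. -/
lemma softmax_sub_le (hβ : 0 ≤ β) {s s' : Fin q → ℝ} {ε : ℝ} (hε : ∀ l, |s l - s' l| ≤ ε)
    (k : Fin q) : softmax β s k - softmax β s' k ≤ 2 * β * ε * Real.exp (2 * β * ε) := by
  have h1 : Real.exp (β * s k) ≤ Real.exp (β * ε) * Real.exp (β * s' k) := by
    rw [← Real.exp_add, Real.exp_le_exp, ← mul_add]
    exact mul_le_mul_of_nonneg_left (by linarith [(abs_le.1 (hε k)).2]) hβ
  have h2 : ∑ l, Real.exp (β * s' l) ≤ Real.exp (β * ε) * ∑ l, Real.exp (β * s l) := by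
    rw [Finset.mul_sum]
    refine Finset.sum_le_sum fun l _ => ?_
    rw [← Real.exp_add, Real.exp_le_exp, ← mul_add]
    exact mul_le_mul_of_nonneg_left (by linarith [(abs_le.1 (hε l)).1]) hβ
  have hle : softmax β s k ≤ Real.exp (2 * β * ε) * softmax β s' k := by
    have e2 : Real.exp (2 * β * ε) = Real.exp (β * ε) * Real.exp (β * ε) := by
      rw [← Real.exp_add]; ring_nf
    have p1 := sum_exp_pos β s k
    have p2 := sum_exp_pos β s' k
    unfold softmax
    rw [← mul_div_assoc, div_le_div_iff₀ p1 p2, e2]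
    calc Real.exp (β * s k) * ∑ l, Real.exp (β * s' l) ≤
        (Real.exp (β * ε) * Real.exp (β * s' k)) *
          (Real.exp (β * ε) * ∑ l, Real.exp (β * s l)) := by gcongr
      _ = _ := by ring
  have h3 := exp_sub_one_le_mul_exp (2 * β * ε)
  have hε0 : 0 ≤ ε := (abs_nonneg _).trans (hε k)
  have h4 := Real.one_le_exp (by positivity : 0 ≤ 2 * β * ε)
  nlinarith [softmax_le_one β s' k, softmax_nonneg β s' k]

lemma abs_softmax_sub_le (hβ : 0 ≤ β) {s s' : Fin q → ℝ} {ε : ℝ} (hε : ∀ l, |s l - s' l| ≤ ε)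
    (k : Fin q) : |softmax β s k - softmax β s' k| ≤ 2 * β * ε * Real.exp (2 * β * ε) := by
  rw [abs_le]
  have h := softmax_sub_le hβ (fun l => (abs_sub_comm (s' l) (s l)).trans_le (hε l)) k
  exact ⟨by linarith, softmax_sub_le hβ hε k⟩

/-- The mean increment of the proportion of spin `k` in one step. -/
def meanInc (n q : ℕ) (β : ℝ) (σ : Config n q) (k : Fin q) : ℝ :=
  stepE n q β (fun τ => proportions τ k - proportions σ k) σ

lemma meanInc_eq [NeZero n] [NeZero q] (σ : Config n q) (k : Fin q) :
    n * meanInc n q β σ k =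
      (1 / (n : ℝ)) * ∑ v, resampleProb n q β σ v k - proportions σ k := by
  have hn : (n : ℝ) ≠ 0 := by exact_mod_cast NeZero.ne n
  have h : ∀ v, ∑ l, resampleProb n q β σ v l *
      (proportions (Function.update σ v l) k - proportions σ k) =
      (resampleProb n q β σ v k - (if σ v = k then 1 else 0)) / n := by
    intro v
    simp_rw [proportions_update, add_sub_cancel_left, mul_div_assoc', ← Finset.sum_div, mul_sub,
      Finset.sum_sub_distrib, ← Finset.sum_mul, sum_resampleProb]
    simp
  rw [meanInc, stepE]
  simp_rw [h]
  rw [← Finset.sum_div, Finset.sum_sub_distrib, proportions_eq_sum]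
  field_simp

/-- The 1/n error comes from the resampled vertex being left out of its own conditional law, which
shifts each proportion by at most 1/n. -/
lemma abs_meanInc_sub_le [NeZero n] [NeZero q] (hβ : 0 ≤ β) (σ : Config n q) (k : Fin q) :
    |n * meanInc n q β σ k - (softmax β (proportions σ) k - proportions σ k)| ≤
      2 * β * Real.exp (2 * β) / n := by
  have hn : (1 : ℝ) ≤ n := by exact_mod_cast Nat.pos_of_ne_zero (NeZero.ne n)
  have hn0 : (n : ℝ) ≠ 0 := by linarith
  rw [meanInc_eq]
  have h1 : ∀ v, |resampleProb n q β σ v k - softmax β (proportions σ) k| ≤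
      2 * β * Real.exp (2 * β) / n := by
    intro v
    rw [resampleProb_eq_softmax]
    refine (abs_softmax_sub_le hβ (ε := 1 / n) (fun l => ?_) k).trans ?_
    · rw [othersProp_eq, sub_sub_cancel_left, abs_neg, abs_div, Nat.abs_cast]
      gcongr
      split_ifs <;> simp
    · have : 2 * β * (1 / (n : ℝ)) ≤ 2 * β :=
        mul_le_of_le_one_right (by positivity) (by rw [div_le_one (by linarith)]; exact hn)
      calc _ ≤ 2 * β * (1 / (n : ℝ)) * Real.exp (2 * β) := by gcongr
        _ = _ := by ring
  have h2 : (1 / (n : ℝ)) * ∑ v, resampleProb n q β σ v k - proportions σ k -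
      (softmax β (proportions σ) k - proportions σ k) =
      (1 / (n : ℝ)) * ∑ v, (resampleProb n q β σ v k - softmax β (proportions σ) k) := by
    rw [Finset.sum_sub_distrib]
    simp [mul_sub, hn0]
  rw [h2, abs_mul, abs_of_nonneg (by positivity : (0 : ℝ) ≤ 1 / n)]
  calc _ ≤ (1 / (n : ℝ)) * ∑ v : Fin n, 2 * β * Real.exp (2 * β) / n := by
        gcongr
        exact (Finset.abs_sum_le_sum_abs _ _).trans (Finset.sum_le_sum fun v _ => h1 v)
    _ = _ := by simp; field_simp

/-! ### Deviation from the axis of a dominant spin -/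

/-- The squared Euclidean distance of `s` from `dominated k (s k)`. -/
def trans (k : Fin q) (s : Fin q → ℝ) : ℝ := ∑ i, (s i - dominated k (s k) i) ^ 2

lemma trans_nonneg (k : Fin q) (s : Fin q → ℝ) : 0 ≤ trans k s :=
  Finset.sum_nonneg fun _ _ => sq_nonneg _

lemma sq_le_trans (k : Fin q) (s : Fin q → ℝ) (i : Fin q) :
    (s i - dominated k (s k) i) ^ 2 ≤ trans k s :=
  Finset.single_le_sum (f := fun i => (s i - dominated k (s k) i) ^ 2)
    (fun _ _ => sq_nonneg _) (Finset.mem_univ i)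

lemma sum_ne_dominated (hq : 1 < q) (k : Fin q) (m : ℝ) :
    ∑ i ∈ Finset.univ.erase k, dominated k m i = 1 - m := by
  have hq' : (1 : ℝ) < q := by exact_mod_cast hq
  rw [Finset.sum_congr rfl (g := fun _ => (1 - m) / ((q : ℝ) - 1))
    (fun i hi => by simp [dominated, Finset.ne_of_mem_erase hi])]
  rw [Finset.sum_const, Finset.card_erase_of_mem (Finset.mem_univ k), Finset.card_univ,
    Fintype.card_fin, nsmul_eq_mul, Nat.cast_sub hq.le, Nat.cast_one]
  have : (q : ℝ) - 1 ≠ 0 := by linarith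
  field_simp

lemma sum_dominated (hq : 1 < q) (k : Fin q) (m : ℝ) : ∑ i, dominated k m i = 1 := by
  rw [← Finset.add_sum_erase _ _ (Finset.mem_univ k), sum_ne_dominated hq]
  simp [dominated]

lemma sum_deviation (hq : 1 < q) (k : Fin q) {s : Fin q → ℝ} (hs : ∑ i, s i = 1) :
    ∑ i, (s i - dominated k (s k) i) = 0 := by
  rw [Finset.sum_sub_distrib, hs, sum_dominated hq, sub_self]

lemma deviation_self (k : Fin q) (s : Fin q → ℝ) : s k - dominated k (s k) k = 0 := by
  simp [dominated]

lemma abs_deviation_le_one (hq : 1 < q) (k : Fin q) {s : Fin q → ℝ} (hs0 : ∀ i, 0 ≤ s i)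
    (hs : ∑ i, s i = 1) (i : Fin q) : |s i - dominated k (s k) i| ≤ 1 := by
  have hq' : (2 : ℝ) ≤ q := by exact_mod_cast hq
  have h1 : ∀ j, s j ≤ 1 := fun j => by
    rw [← hs]; exact Finset.single_le_sum (fun i _ => hs0 i) (Finset.mem_univ j)
  by_cases hi : i = k
  · subst hi; rw [deviation_self]; simp
  · rw [dominated, if_neg hi, abs_le]
    have h2 : (1 - s k) / ((q : ℝ) - 1) ≤ 1 := by
      rw [div_le_one (by linarith)]; linarith [hs0 k]
    have h3 : 0 ≤ (1 - s k) / ((q : ℝ) - 1) := div_nonneg (by linarith [h1 k]) (by linarith)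
    exact ⟨by linarith [hs0 i], by linarith [h1 i]⟩

lemma exp_sub_one_sub_le (u : ℝ) : Real.exp u - 1 - u ≤ u * (Real.exp u - 1) := by
  linarith [exp_sub_one_le_mul_exp u]

lemma mul_exp_sub_one_le (u : ℝ) : u * (Real.exp u - 1) ≤ u ^ 2 * Real.exp |u| := by
  rcases le_total 0 u with h | h
  · rw [abs_of_nonneg h]
    nlinarith [exp_sub_one_le_mul_exp u]
  · have h1 := Real.add_one_le_exp u
    have h2 := Real.one_le_exp (abs_nonneg u)
    nlinarith [sq_nonneg u]

/-- The softmax of a near-dominated vector, compared with the softmax on the axis. -/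
lemma abs_softmax_sub_drift_le (hq : 1 < q) (hβ : 0 ≤ β) (k : Fin q) {s : Fin q → ℝ}
    (hs0 : ∀ i, 0 ≤ s i) (hs : ∑ i, s i = 1) :
    |softmax β s k - s k - drift q β (s k)| ≤ β ^ 2 * Real.exp (2 * β) * trans k s := by
  have hq' : (2 : ℝ) ≤ q := by exact_mod_cast hq
  have hq1 : (q : ℝ) - 1 ≠ 0 := by linarith
  set m := s k
  set a := (1 - m) / ((q : ℝ) - 1) with ha
  set w : Fin q → ℝ := fun i => s i - dominated k m i with hw
  have ham : (1 - q * m) / ((q : ℝ) - 1) = a - m := by rw [ha]; field_simp; ring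
  set E := Real.exp (β * (a - m)) with hE
  have hS : softmax β s k = (1 + E * ∑ i ∈ Finset.univ.erase k, Real.exp (β * w i))⁻¹ := by
    unfold softmax
    rw [← Finset.add_sum_erase _ _ (Finset.mem_univ k), Finset.mul_sum]
    have : ∀ i ∈ Finset.univ.erase k, Real.exp (β * s i) =
        Real.exp (β * m) * (E * Real.exp (β * w i)) := by
      intro i hi
      rw [hE, ← Real.exp_add, ← Real.exp_add]
      congr 1
      simp only [hw, dominated, if_neg (Finset.ne_of_mem_erase hi)]
      rw [← ha]; ring
    rw [Finset.sum_congr rfl this, ← Finset.mul_sum, ← mul_one_add,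
      div_mul_cancel_left₀ (Real.exp_pos _).ne']
  have hD : drift q β m = (1 + E * ((q : ℝ) - 1))⁻¹ - m := by
    rw [drift, ham, mul_comm ((q : ℝ) - 1)]
  have hsum0 : ∑ i ∈ Finset.univ.erase k, w i = 0 := by
    have := sum_deviation hq k hs
    rw [← Finset.add_sum_erase _ _ (Finset.mem_univ k), deviation_self, zero_add] at this
    exact this
  have hcard : ∑ i ∈ Finset.univ.erase k, (1 : ℝ) = (q : ℝ) - 1 := by
    rw [Finset.sum_const, Finset.card_erase_of_mem (Finset.mem_univ k), Finset.card_univ,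
      Fintype.card_fin, nsmul_eq_mul, Nat.cast_sub hq.le, Nat.cast_one, mul_one]
  -- The deviations sum to zero, so their linear terms can be subtracted for free. What remains is
  -- of second order, hence bounded by `trans`.
  have hdiff : ∑ i ∈ Finset.univ.erase k, Real.exp (β * w i) - ((q : ℝ) - 1) =
      ∑ i ∈ Finset.univ.erase k, (Real.exp (β * w i) - 1 - β * w i) := by
    rw [Finset.sum_sub_distrib, Finset.sum_sub_distrib, ← Finset.mul_sum, hsum0, hcard]; ring
  have hnn : 0 ≤ ∑ i ∈ Finset.univ.erase k, (Real.exp (β * w i) - 1 - β * w i) :=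
    Finset.sum_nonneg fun i _ => by linarith [Real.add_one_le_exp (β * w i)]
  have hub : ∑ i ∈ Finset.univ.erase k, (Real.exp (β * w i) - 1 - β * w i) ≤
      β ^ 2 * Real.exp β * trans k s := by
    calc _ ≤ ∑ i ∈ Finset.univ.erase k, β ^ 2 * Real.exp β * (w i) ^ 2 := by
          refine Finset.sum_le_sum fun i _ => ?_
          refine (exp_sub_one_sub_le _).trans ((mul_exp_sub_one_le _).trans ?_)
          have : |β * w i| ≤ β := by
            rw [abs_mul, abs_of_nonneg hβ]
            exact mul_le_of_le_one_right hβ (abs_deviation_le_one hq k hs0 hs i)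
          calc (β * w i) ^ 2 * Real.exp |β * w i| ≤ (β * w i) ^ 2 * Real.exp β := by gcongr
            _ = _ := by ring
      _ ≤ ∑ i, β ^ 2 * Real.exp β * (w i) ^ 2 :=
          Finset.sum_le_sum_of_subset_of_nonneg (Finset.subset_univ _)
            fun _ _ _ => by positivity
      _ = _ := by rw [← Finset.mul_sum]; rfl
  have hEle : E ≤ Real.exp β := by
    rw [hE, Real.exp_le_exp]
    refine mul_le_of_le_one_right hβ ?_
    have : a ≤ 1 := by rw [ha, div_le_one (by linarith)]; linarith [hs0 k]
    linarith [hs0 k]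
  have hE0 : 0 < E := Real.exp_pos _
  rw [hS, hD]
  set A := E * ∑ i ∈ Finset.univ.erase k, Real.exp (β * w i) with hA
  set B := E * ((q : ℝ) - 1) with hB
  have hA0 : 0 ≤ A := mul_nonneg hE0.le (Finset.sum_nonneg fun _ _ => (Real.exp_pos _).le)
  have hB0 : 0 ≤ B := mul_nonneg hE0.le (by linarith)
  have hAB : A - B = E * ∑ i ∈ Finset.univ.erase k, (Real.exp (β * w i) - 1 - β * w i) := by
    rw [hA, hB, ← mul_sub, hdiff]
  have hAB0 : 0 ≤ A - B := by rw [hAB]; positivity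
  have e1 : (1 + A)⁻¹ - m - ((1 + B)⁻¹ - m) = -((A - B) / ((1 + A) * (1 + B))) := by
    have : 1 + A ≠ 0 := by linarith
    have : 1 + B ≠ 0 := by linarith
    field_simp; ring
  rw [e1, abs_neg, abs_of_nonneg (by positivity)]
  calc (A - B) / ((1 + A) * (1 + B)) ≤ A - B := div_le_self hAB0 (by nlinarith)
    _ ≤ Real.exp β * (β ^ 2 * Real.exp β * trans k s) := by rw [hAB]; gcongr
    _ = _ := by rw [two_mul, Real.exp_add]; ring

lemma abs_meanInc_sub_drift_le [NeZero n] [NeZero q] (hq : 1 < q) (hβ : 0 ≤ β)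
    (σ : Config n q) (k : Fin q) :
    |n * meanInc n q β σ k - drift q β (proportions σ k)| ≤
      (β ^ 2 + 2 * β) * Real.exp (2 * β) * (trans k (proportions σ) + 1 / n) := by
  have h1 := abs_meanInc_sub_le hβ σ k
  have h2 := abs_softmax_sub_drift_le hq hβ k (proportions_nonneg σ) (sum_proportions σ)
  have h3 := abs_add_le (n * meanInc n q β σ k -
    (softmax β (proportions σ) k - proportions σ k))
    (softmax β (proportions σ) k - proportions σ k - drift q β (proportions σ k))
  rw [sub_add_sub_cancel] at h3
  refine (h3.trans (add_le_add h1 h2)).trans ?_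
  have := trans_nonneg k (proportions σ)
  have e : (β ^ 2 + 2 * β) * Real.exp (2 * β) * (trans k (proportions σ) + 1 / n) =
    2 * β * Real.exp (2 * β) / n + β ^ 2 * Real.exp (2 * β) * trans k (proportions σ) +
    (2 * β * Real.exp (2 * β) * trans k (proportions σ) + β ^ 2 * Real.exp (2 * β) / n) := by ring
  rw [e]
  have : 0 ≤ 2 * β * Real.exp (2 * β) * trans k (proportions σ) + β ^ 2 * Real.exp (2 * β) / n := by
    positivity
  linarith

/-! ### Contraction of the deviation from the axis -/

lemma stepE_affine [NeZero n] [NeZero q] (A : ℝ) (c : Fin q → ℝ) (σ : Config n q) :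
    stepE n q β (fun τ => A + ∑ i, c i * (proportions τ i - proportions σ i)) σ =
      A + ∑ i, c i * meanInc n q β σ i := by
  rw [stepE_add (fun _ => A), stepE_const, stepE_sum]
  simp_rw [stepE_const_mul]
  rfl

lemma deviation_mul_dominated (k : Fin q) (s : Fin q → ℝ) (m : ℝ) (i : Fin q) :
    (s i - dominated k (s k) i) * dominated k m i =
      (s i - dominated k (s k) i) * ((1 - m) / ((q : ℝ) - 1)) := by
  by_cases hi : i = k
  · subst hi; rw [deviation_self]; ring
  · simp [dominated, hi]

/-- The deviation is orthogonal to the whole axis. A displacement of the foot point `dominated k (s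
k)` therefore has no first-order effect on `trans`, which is what `trans_le_of_increment` needs. -/
lemma sum_deviation_mul_dominated (hq : 1 < q) (k : Fin q) {s : Fin q → ℝ} (hs : ∑ i, s i = 1)
    (m : ℝ) : ∑ i, (s i - dominated k (s k) i) * dominated k m i = 0 := by
  simp_rw [deviation_mul_dominated]
  rw [← Finset.sum_mul, sum_deviation hq k hs, zero_mul]

lemma sum_deviation_mul_self (hq : 1 < q) (k : Fin q) {s : Fin q → ℝ} (hs : ∑ i, s i = 1) :
    ∑ i, (s i - dominated k (s k) i) * s i = trans k s := by
  have h := sum_deviation_mul_dominated hq k hs (s k)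
  rw [trans, ← sub_zero (∑ i, _ * _), ← h, ← Finset.sum_sub_distrib]
  exact Finset.sum_congr rfl fun i _ => by ring

lemma trans_le_of_increment (hq : 1 < q) (k : Fin q) {s s' : Fin q → ℝ} (hs : ∑ i, s i = 1)
    {ε : ℝ} (hε : ∀ i, |s' i - s i| ≤ ε) :
    trans k s' ≤ trans k s + 2 * ∑ i, (s i - dominated k (s k) i) * (s' i - s i) +
      4 * q * ε ^ 2 := by
  have hq' : (2 : ℝ) ≤ q := by exact_mod_cast hq
  have hε0 : 0 ≤ ε := (abs_nonneg _).trans (hε k)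
  set d : Fin q → ℝ := fun i => (s' i - s i) - (dominated k (s' k) i - dominated k (s k) i) with hd
  have h1 : trans k s' = trans k s + 2 * ∑ i, (s i - dominated k (s k) i) * d i +
      ∑ i, d i ^ 2 := by
    rw [trans, trans, Finset.mul_sum, ← Finset.sum_add_distrib, ← Finset.sum_add_distrib]
    exact Finset.sum_congr rfl fun i _ => by simp only [hd]; ring
  have h2 : ∑ i, (s i - dominated k (s k) i) * d i =
      ∑ i, (s i - dominated k (s k) i) * (s' i - s i) := by
    simp only [hd, mul_sub, Finset.sum_sub_distrib, sum_deviation_mul_dominated hq k hs]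
    ring
  have h3 : ∀ i, d i ^ 2 ≤ 4 * ε ^ 2 := by
    intro i
    have hdi : |d i| ≤ 2 * ε := by
      have hb : |dominated k (s' k) i - dominated k (s k) i| ≤ ε := by
        by_cases hi : i = k
        · simpa [dominated, hi] using hε k
        · simp only [dominated, if_neg hi, ← sub_div]
          rw [abs_div, abs_of_pos (by linarith : (0 : ℝ) < q - 1), div_le_iff₀ (by linarith),
            show (1 - s' k - (1 - s k)) = -(s' k - s k) by ring, abs_neg]
          nlinarith [hε k]
      calc |d i| ≤ |s' i - s i| + |dominated k (s' k) i - dominated k (s k) i| := abs_sub _ _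
        _ ≤ 2 * ε := by linarith [hε i]
    rw [← sq_abs]
    nlinarith [abs_nonneg (d i)]
  have h4 : ∑ i, d i ^ 2 ≤ 4 * q * ε ^ 2 := by
    calc _ ≤ ∑ _i : Fin q, 4 * ε ^ 2 := Finset.sum_le_sum fun i _ => h3 i
      _ = _ := by simp; ring
  rw [h1, h2]
  linarith

/-- All spins but `k` share the base weight `exp (β * a) / Z`. As the deviations sum to zero, only
the factors `exp (β * w i) - 1` contribute, each about β times the deviation. The resulting rate
tends to β/q as `r` tends to 0. -/
lemma sum_deviation_mul_softmax_le (hq : 1 < q) (hβ : 0 ≤ β) (k : Fin q) {s : Fin q → ℝ}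
    (hs : ∑ i, s i = 1) {r : ℝ} (hr : 0 ≤ r) (hrq : 2 * β * r < q) (hm : 1 / (q : ℝ) - r ≤ s k)
    (ht : trans k s ≤ r ^ 2) :
    ∑ i, (s i - dominated k (s k) i) * softmax β s i ≤
      β * Real.exp (β * r) / (q - 2 * β * r) * trans k s := by
  have hq' : (2 : ℝ) ≤ q := by exact_mod_cast hq
  have hq1 : (0 : ℝ) < q - 1 := by linarith
  set m := s k
  set a := (1 - m) / ((q : ℝ) - 1) with ha
  set w : Fin q → ℝ := fun i => s i - dominated k m i with hw
  set Z := ∑ l, Real.exp (β * s l) with hZ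
  have hZ0 : 0 < Z := sum_exp_pos β s k
  have hws : ∀ i ≠ k, s i = a + w i := fun i hi => by
    simp only [hw, dominated, if_neg hi, ← ha]; ring
  have hwk : w k = 0 := deviation_self k s
  have hw0 : ∑ i, w i = 0 := sum_deviation hq k hs
  have h1 : ∑ i, w i * softmax β s i =
      Real.exp (β * a) / Z * ∑ i, w i * (Real.exp (β * w i) - 1) := by
    simp_rw [mul_sub, mul_one]
    rw [Finset.sum_sub_distrib, hw0, sub_zero, Finset.mul_sum]
    refine Finset.sum_congr rfl fun i _ => ?_
    by_cases hi : i = k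
    · rw [hi, hwk]; ring
    · rw [softmax, hws i hi, mul_add, Real.exp_add]; ring
  have hwr : ∀ i, |w i| ≤ r := fun i =>
    abs_le_of_sq_le_sq ((sq_le_trans k s i).trans ht) hr
  have h2 : ∑ i, w i * (Real.exp (β * w i) - 1) ≤ β * Real.exp (β * r) * trans k s := by
    rw [trans, Finset.mul_sum]
    refine Finset.sum_le_sum fun i _ => ?_
    rcases eq_or_lt_of_le hβ with hb | hb
    · simp [← hb]
    · have e1 := mul_exp_sub_one_le (β * w i)
      have e2 : Real.exp |β * w i| ≤ Real.exp (β * r) := by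
        rw [Real.exp_le_exp, abs_mul, abs_of_nonneg hβ]
        exact mul_le_mul_of_nonneg_left (hwr i) hβ
      have e3 : (β * w i) ^ 2 * Real.exp |β * w i| ≤ (β * w i) ^ 2 * Real.exp (β * r) := by gcongr
      have e4 : β * (w i * (Real.exp (β * w i) - 1)) ≤ β * (β * Real.exp (β * r) * w i ^ 2) := by
        linarith
      exact le_of_mul_le_mul_left e4 hb
  have h2' : 0 ≤ ∑ i, w i * (Real.exp (β * w i) - 1) :=
    Finset.sum_nonneg fun i _ => by
      rcases le_total 0 (w i) with h | h
      · exact mul_nonneg h (sub_nonneg.2 (Real.one_le_exp (by positivity)))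
      · refine mul_nonneg_of_nonpos_of_nonpos h (sub_nonpos.2 (Real.exp_le_one_iff.2 ?_))
        exact mul_nonpos_of_nonneg_of_nonpos hβ h
  -- By convexity, the spins other than `k` contribute at least `q - 1` times `exp (β * a)`. Spin
  -- `k` contributes at least `1 - 2 * β * r` times it, because `m ≥ 1/q - r` forces `m - a ≥ -2 *
  -- r`.
  have h3 : (q - 2 * β * r) * Real.exp (β * a) ≤ Z := by
    rw [hZ, ← Finset.add_sum_erase _ _ (Finset.mem_univ k)]
    have e1 : ∑ i ∈ Finset.univ.erase k, Real.exp (β * a) * (1 + β * w i) ≤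
        ∑ i ∈ Finset.univ.erase k, Real.exp (β * s i) := by
      refine Finset.sum_le_sum fun i hi => ?_
      rw [hws i (Finset.ne_of_mem_erase hi), mul_add β, Real.exp_add]
      have := Real.add_one_le_exp (β * w i)
      gcongr
      linarith
    have e2 : ∑ i ∈ Finset.univ.erase k, Real.exp (β * a) * (1 + β * w i) =
        Real.exp (β * a) * (q - 1) := by
      have hw0' := hw0
      rw [← Finset.add_sum_erase _ _ (Finset.mem_univ k), hwk, zero_add] at hw0'
      rw [← Finset.mul_sum, Finset.sum_add_distrib, ← Finset.mul_sum, hw0', Finset.sum_const,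
        Finset.card_erase_of_mem (Finset.mem_univ k), Finset.card_univ,
        Fintype.card_fin, nsmul_eq_mul, Nat.cast_sub hq.le, Nat.cast_one]
      ring
    have e3 : Real.exp (β * a) * (1 - 2 * β * r) ≤ Real.exp (β * m) := by
      have hma : -(2 * r) ≤ m - a := by
        have : m - a = (q * m - 1) / (q - 1) := by rw [ha]; field_simp; ring
        rw [this, le_div_iff₀ hq1]
        have hq0 : (0 : ℝ) < q := by linarith
        have : 1 - q * r ≤ q * m := by
          have := mul_le_mul_of_nonneg_left hm hq0.le
          rw [mul_sub, mul_one_div_cancel hq0.ne'] at this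
          linarith
        nlinarith
      have e : Real.exp (β * m) = Real.exp (β * a) * Real.exp (β * (m - a)) := by
        rw [← Real.exp_add]; ring_nf
      rw [e]
      gcongr
      have := Real.add_one_le_exp (β * (m - a))
      nlinarith
    change _ ≤ Real.exp (β * m) + _
    nlinarith
  change ∑ i, w i * softmax β s i ≤ _
  rw [h1]
  have h4 : Real.exp (β * a) / Z ≤ 1 / (q - 2 * β * r) := by
    rw [div_le_div_iff₀ hZ0 (by linarith)]; linarith
  have h5 : 0 < (q : ℝ) - 2 * β * r := by linarith
  calc _ ≤ 1 / (q - 2 * β * r) * (β * Real.exp (β * r) * trans k s) := by gcongr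
    _ = _ := by ring

/-- The self-term pulls the deviation back at rate 1 and the softmax pushes it outwards at rate at
most θ. The remainder of order 1/n² collects the squared increments and the 1/n correction of the
mean increments. -/
lemma stepE_trans_le [NeZero n] [NeZero q] (hq : 1 < q) (hβ : 0 ≤ β) (k : Fin q)
    (σ : Config n q) {r : ℝ} (hr : 0 ≤ r) (hrq : 2 * β * r < q)
    (hm : 1 / (q : ℝ) - r ≤ proportions σ k) (ht : trans k (proportions σ) ≤ r ^ 2) :
    stepE n q β (fun τ => trans k (proportions τ)) σ ≤
      trans k (proportions σ) -
        2 * (1 - β * Real.exp (β * r) / (q - 2 * β * r)) / n * trans k (proportions σ) +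
      (4 * q + 4 * q * β * Real.exp (2 * β)) / n ^ 2 := by
  have hn : (0 : ℝ) < n := by exact_mod_cast Nat.pos_of_ne_zero (NeZero.ne n)
  set s := proportions σ with hsdef
  have hs : ∑ i, s i = 1 := sum_proportions σ
  set w : Fin q → ℝ := fun i => s i - dominated k (s k) i with hw
  set θ := β * Real.exp (β * r) / (q - 2 * β * r)
  have h1 : stepE n q β (fun τ => trans k (proportions τ)) σ ≤
      (trans k s + 4 * q * (1 / n) ^ 2) + ∑ i, (2 * w i) * meanInc n q β σ i := by
    rw [← stepE_affine]
    refine stepE_mono_at fun v l => ?_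
    have := trans_le_of_increment hq k hs (fun i => abs_proportions_update_sub_le σ v l i)
    simp_rw [mul_assoc, ← Finset.mul_sum]
    simp_rw [mul_assoc] at this
    linarith
  have h2 : n * ∑ i, w i * meanInc n q β σ i ≤
      ∑ i, w i * (softmax β s i - s i) + q * (2 * β * Real.exp (2 * β) / n) := by
    have : n * ∑ i, w i * meanInc n q β σ i - ∑ i, w i * (softmax β s i - s i) =
        ∑ i, w i * (n * meanInc n q β σ i - (softmax β s i - s i)) := by
      rw [Finset.mul_sum, ← Finset.sum_sub_distrib]
      exact Finset.sum_congr rfl fun i _ => by ring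
    have h3 : ∑ i, w i * (n * meanInc n q β σ i - (softmax β s i - s i)) ≤
        ∑ _i : Fin q, (2 * β * Real.exp (2 * β) / n) := by
      refine Finset.sum_le_sum fun i _ => (le_abs_self _).trans ?_
      rw [abs_mul]
      have e1 := abs_deviation_le_one hq k (proportions_nonneg σ) hs i
      have e2 := abs_meanInc_sub_le hβ σ i
      calc _ ≤ 1 * _ := mul_le_mul_of_nonneg_right e1 (abs_nonneg _)
        _ ≤ _ := by rw [one_mul]; exact e2
    simp only [Finset.sum_const, Finset.card_univ, Fintype.card_fin, nsmul_eq_mul] at h3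
    linarith
  have h3 : ∑ i, w i * (softmax β s i - s i) ≤ -(1 - θ) * trans k s := by
    simp_rw [mul_sub]
    rw [Finset.sum_sub_distrib, sum_deviation_mul_self hq k hs]
    have := sum_deviation_mul_softmax_le hq hβ k hs hr hrq hm ht
    linarith
  have h4 : ∑ i, (2 * w i) * meanInc n q β σ i =
      2 / n * (n * ∑ i, w i * meanInc n q β σ i) := by
    simp_rw [mul_assoc, ← Finset.mul_sum]; field_simp
  rw [h4] at h1
  refine h1.trans ?_
  have h5 : 2 / n * (n * ∑ i, w i * meanInc n q β σ i) ≤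
      2 / n * (-(1 - θ) * trans k s + q * (2 * β * Real.exp (2 * β) / n)) := by
    gcongr; linarith
  refine (add_le_add_right h5 _).trans (le_of_eq ?_)
  field_simp
  ring

/-- At `r = 0` the quotient equals β/q < 1, so continuity suffices. -/
lemma exists_radius_trans (hβ0 : 0 ≤ β) (hβ : β < q) :
    ∃ r > 0, 2 * β * r < q ∧ β * Real.exp (β * r) / (q - 2 * β * r) < 1 := by
  have hq : (0 : ℝ) < q := by linarith
  have h1 : ∀ᶠ r in nhds (0 : ℝ), 2 * β * r < q := by
    have : Continuous fun r : ℝ => 2 * β * r := by fun_prop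
    exact (this.tendsto 0).eventually_lt_const (by simpa using hq)
  have h2 : ∀ᶠ r in nhds (0 : ℝ), β * Real.exp (β * r) / (q - 2 * β * r) < 1 := by
    have : ContinuousAt (fun r : ℝ => β * Real.exp (β * r) / (q - 2 * β * r)) 0 := by
      refine ContinuousAt.div (by fun_prop) (by fun_prop) (by simpa using hq.ne')
    refine this.tendsto.eventually_lt_const ?_
    simp only [mul_zero, Real.exp_zero, mul_one, sub_zero]
    rwa [div_lt_one hq]
  obtain ⟨ε, hε, h⟩ := Metric.eventually_nhds_iff.1 (h1.and h2)
  refine ⟨ε / 2, by positivity, h ?_⟩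
  rw [Real.dist_eq, sub_zero, abs_of_pos (by positivity)]
  linarith

/-! ### Local contraction of the softmax map -/

lemma sum_softmax (β : ℝ) (s : Fin q → ℝ) (k : Fin q) : ∑ l, softmax β s l = 1 := by
  unfold softmax
  rw [← Finset.sum_div, div_self (sum_exp_pos β s k).ne']

lemma contDiff_softmax (β : ℝ) (k : Fin q) :
    ContDiff ℝ 1 (fun s : Fin q → ℝ => softmax β s k) := by
  unfold softmax
  refine ContDiff.div (by fun_prop) (by fun_prop) fun s => (sum_exp_pos β s k).ne'

lemma fderiv_softmax (β : ℝ) (k : Fin q) (s z : Fin q → ℝ) :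
    fderiv ℝ (fun s : Fin q → ℝ => softmax β s k) s z =
      β * softmax β s k * (z k - ∑ l, softmax β s l * z l) := by
  have h1 : HasDerivAt (fun t : ℝ => softmax β (s + t • z) k)
      (fderiv ℝ (fun s : Fin q → ℝ => softmax β s k) s z) 0 := by
    have hf : HasFDerivAt (fun s : Fin q → ℝ => softmax β s k)
        (fderiv ℝ (fun s : Fin q → ℝ => softmax β s k) s) (s + (0 : ℝ) • z) := by
      rw [zero_smul, add_zero]
      exact ((contDiff_softmax β k).differentiable one_ne_zero s).hasFDerivAt
    have hg : HasDerivAt (fun t : ℝ => s + t • z) z 0 := by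
      simpa using ((hasDerivAt_id (0 : ℝ)).smul_const z).const_add s
    exact hf.comp_hasDerivAt 0 hg
  have he : ∀ l, HasDerivAt (fun t : ℝ => Real.exp (β * (s + t • z) l))
      (Real.exp (β * s l) * (β * z l)) 0 := by
    intro l
    have : HasDerivAt (fun t : ℝ => β * (s l + t * z l)) (β * z l) 0 := by
      simpa using (((hasDerivAt_id (0 : ℝ)).mul_const (z l)).const_add (s l)).const_mul β
    simpa using this.exp
  have h2 : HasDerivAt (fun t : ℝ => softmax β (s + t • z) k)
      ((Real.exp (β * s k) * (β * z k) * (∑ l, Real.exp (β * s l)) -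
        Real.exp (β * s k) * ∑ l, Real.exp (β * s l) * (β * z l)) /
          (∑ l, Real.exp (β * s l)) ^ 2) 0 := by
    have hsum : HasDerivAt (fun t : ℝ => ∑ l, Real.exp (β * (s + t • z) l))
        (∑ l, Real.exp (β * s l) * (β * z l)) 0 := HasDerivAt.fun_sum fun l _ => he l
    have := (he k).fun_div hsum (by simpa using (sum_exp_pos β s k).ne')
    simp only [zero_smul, add_zero] at this
    exact this
  rw [h1.unique h2]
  have hZ := sum_exp_pos β s k
  -- The case β = 0 is separated because the identity divides by β; there both sides of the goal
  -- vanish.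
  have : ∑ l, softmax β s l * z l =
      (∑ l, Real.exp (β * s l) * (β * z l)) * (∑ l, Real.exp (β * s l))⁻¹ * β⁻¹ ∨ β = 0 := by
    rcases eq_or_ne β 0 with h | h
    · exact Or.inr h
    · left
      rw [Finset.sum_mul, Finset.sum_mul]
      refine Finset.sum_congr rfl fun l _ => ?_
      rw [softmax]; field_simp
  rcases this with h | h
  · rcases eq_or_ne β 0 with hb | hb
    · simp [hb]
    · rw [h, softmax]; field_simp
  · simp [h]

/-- On the axis `trans` vanishes, so the comparison with the drift is exact in coordinate `k`. The
other coordinates agree by symmetry and are fixed by the total mass. -/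
lemma softmax_dominated (hq : 1 < q) (hβ : 0 ≤ β) (k : Fin q) {p : ℝ} (hp0 : 0 ≤ p) (hp1 : p ≤ 1)
    (hp : drift q β p = 0) : softmax β (dominated k p) = dominated k p := by
  have hq' : (2 : ℝ) ≤ q := by exact_mod_cast hq
  have hq1 : (q : ℝ) - 1 ≠ 0 := by linarith
  have hkk : dominated k p k = p := by simp [dominated]
  have h0 : ∀ i, 0 ≤ dominated k p i := fun i => by
    unfold dominated
    split_ifs
    · exact hp0
    · exact div_nonneg (by linarith) (by linarith)
  have ht : trans k (dominated k p) = 0 := by simp [trans, hkk]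
  have h1 := abs_softmax_sub_drift_le hq hβ k h0 (sum_dominated hq k p)
  rw [ht, mul_zero, hkk, hp, sub_zero] at h1
  have h2 : softmax β (dominated k p) k = p := by
    linarith [abs_eq_zero.1 (le_antisymm h1 (abs_nonneg _))]
  funext i
  by_cases hi : i = k
  · rw [hi, h2, hkk]
  · have h3 := sum_softmax β (dominated k p) k
    rw [← Finset.add_sum_erase _ _ (Finset.mem_univ k), h2,
      Finset.sum_congr rfl (g := fun _ => softmax β (dominated k p) i) (fun j hj => by
        simp only [softmax, dominated, if_neg (Finset.ne_of_mem_erase hj), if_neg hi]),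
      Finset.sum_const, Finset.card_erase_of_mem (Finset.mem_univ k), Finset.card_univ,
      Fintype.card_fin, nsmul_eq_mul, Nat.cast_sub hq.le, Nat.cast_one] at h3
    rw [dominated, if_neg hi, eq_div_iff hq1]
    linarith

/-- The constant is the derivative of `drift q β x + x` at `p`. With `a` the common value of the
other coordinates, coordinate `k` contributes exactly `β * a * (q * p) * |z k|`. The others are
bounded by the triangle inequality, and `|z k| ≤ A`, which holds since `z` sums to zero, closes the
gap when `q * p ≥ 1`. -/
lemma sum_abs_fderiv_softmax_le (hq : 1 < q) (hβ : 0 ≤ β) (k : Fin q) {p : ℝ}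
    (hp0 : 1 / (q : ℝ) ≤ p) (hp1 : p ≤ 1) (hp : drift q β p = 0) {z : Fin q → ℝ}
    (hz : ∑ i, z i = 0) :
    ∑ l, |fderiv ℝ (fun s : Fin q → ℝ => softmax β s l) (dominated k p) z| ≤
      β * q * p * (1 - p) / (q - 1) * ∑ l, |z l| := by
  have hq' : (2 : ℝ) ≤ q := by exact_mod_cast hq
  have hq1 : (0 : ℝ) < (q : ℝ) - 1 := by linarith
  have hq0 : (0 : ℝ) < q := by linarith
  have hp0' : 0 ≤ p := le_trans (by positivity) hp0
  have hqp : 1 ≤ q * p := by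
    rw [div_le_iff₀ hq0] at hp0; linarith
  simp_rw [fderiv_softmax, softmax_dominated hq hβ k hp0' hp1 hp]
  set a := (1 - p) / ((q : ℝ) - 1) with ha
  have ha' : (q - 1) * a = 1 - p := by rw [ha]; field_simp
  have ha0 : 0 ≤ a := div_nonneg (by linarith) hq1.le
  have hz' : ∑ i ∈ Finset.univ.erase k, z i = -z k := by
    rw [← Finset.add_sum_erase _ _ (Finset.mem_univ k)] at hz; linarith
  have hdom : ∀ i ∈ Finset.univ.erase k, dominated k p i = a := fun i hi => by
    simp [dominated, Finset.ne_of_mem_erase hi, ha]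
  have hkk : dominated k p k = p := by simp [dominated]
  have hmean : ∑ l, dominated k p l * z l = (p - a) * z k := by
    rw [← Finset.add_sum_erase _ _ (Finset.mem_univ k), hkk,
      Finset.sum_congr rfl (fun i hi => by rw [hdom i hi]), ← Finset.mul_sum, hz']
    ring
  rw [hmean]
  set A := ∑ i ∈ Finset.univ.erase k, |z i| with hA
  have hbA : |z k| ≤ A := by
    rw [← abs_neg, ← hz']; exact Finset.abs_sum_le_sum_abs _ _
  have hpa : 0 ≤ p - a := by
    have : (q - 1) * (p - a) = q * p - 1 := by rw [mul_sub, ha']; ring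
    nlinarith
  have hβa : 0 ≤ β * a := by positivity
  have hrest : ∑ i ∈ Finset.univ.erase k, |β * dominated k p i * (z i - (p - a) * z k)| ≤
      β * a * (A + (q * p - 1) * |z k|) := by
    calc _ ≤ ∑ i ∈ Finset.univ.erase k, β * a * (|z i| + (p - a) * |z k|) := by
          refine Finset.sum_le_sum fun i hi => ?_
          rw [hdom i hi, abs_mul, abs_of_nonneg hβa]
          gcongr
          refine (abs_sub _ _).trans ?_
          rw [abs_mul, abs_of_nonneg hpa]
      _ = _ := by
          rw [← Finset.mul_sum, Finset.sum_add_distrib, Finset.sum_const,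
            Finset.card_erase_of_mem (Finset.mem_univ k), Finset.card_univ,
            Fintype.card_fin, nsmul_eq_mul, Nat.cast_sub hq.le, Nat.cast_one, ← hA]
          linear_combination (-(β * a) * |z k|) * ha'
  rw [← Finset.add_sum_erase _ _ (Finset.mem_univ k),
    ← Finset.add_sum_erase _ (fun l => |z l|) (Finset.mem_univ k), hkk, ← hA]
  have hk1 : |β * p * (z k - (p - a) * z k)| = β * a * (q * p) * |z k| := by
    have : β * p * (z k - (p - a) * z k) = β * a * (q * p) * z k := by
      linear_combination (-β * p * z k) * ha'
    rw [this, abs_mul, abs_of_nonneg (by positivity)]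
  rw [hk1]
  have hκ : β * q * p * (1 - p) / (q - 1) = β * a * (q * p) := by rw [ha]; ring
  rw [hκ]
  have : 0 ≤ β * a * ((q * p - 1) * (A - |z k|)) :=
    mul_nonneg hβa (mul_nonneg (by linarith) (by linarith))
  nlinarith

/-- Near the fixed point `dominated k p` the softmax map contracts the `ℓ¹` distance of vectors
with the same total. -/
lemma exists_softmax_contraction (hq : 1 < q) (hβ : 0 ≤ β) {p κ : ℝ}
    (hp0 : 1 / (q : ℝ) ≤ p) (hp1 : p ≤ 1) (hp : drift q β p = 0)
    (hκ : β * q * p * (1 - p) / (q - 1) < κ) :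
    ∃ ε > 0, ∀ (k : Fin q) (s s' : Fin q → ℝ), (∀ i, |s i - dominated k p i| < ε) →
      (∀ i, |s' i - dominated k p i| < ε) → ∑ i, s i = ∑ i, s' i →
      ∑ l, |softmax β s l - softmax β s' l| ≤ κ * ∑ l, |s l - s' l| := by
  have hq0 : (0 : ℝ) < q := by exact_mod_cast (zero_lt_one.trans hq)
  set θ := β * q * p * (1 - p) / (q - 1) with hθ
  have key : ∀ k l : Fin q, ∃ ε > 0, ∀ s s' : Fin q → ℝ, (∀ i, |s i - dominated k p i| < ε) →
      (∀ i, |s' i - dominated k p i| < ε) →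
      |softmax β s l - softmax β s' l -
        fderiv ℝ (fun s : Fin q → ℝ => softmax β s l) (dominated k p) (s - s')| ≤
        (κ - θ) / q * ∑ i, |s i - s' i| := by
    intro k l
    -- Strict differentiability gives a bound for two moving points. The slack `κ - θ` is divided
    -- evenly among the `q` coordinates.
    have h1 : HasStrictFDerivAt (fun s : Fin q → ℝ => softmax β s l)
        (fderiv ℝ (fun s : Fin q → ℝ => softmax β s l) (dominated k p)) (dominated k p) :=
      (contDiff_softmax β l).contDiffAt.hasStrictFDerivAt one_ne_zero
    have h2 := (hasStrictFDerivAt_iff_isLittleO.1 h1).def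
      (div_pos (sub_pos.2 hκ) hq0 : 0 < (κ - θ) / q)
    obtain ⟨ε, hε, h3⟩ := Metric.eventually_nhds_iff.1 h2
    refine ⟨ε, hε, fun s s' hs hs' => ?_⟩
    have hd : ∀ s : Fin q → ℝ, (∀ i, |s i - dominated k p i| < ε) →
        dist s (dominated k p) < ε := fun s hs =>
      (dist_pi_lt_iff hε).2 fun i => by rw [Real.dist_eq]; exact hs i
    have h4 := @h3 (s, s') (by rw [Prod.dist_eq]; exact max_lt (hd s hs) (hd s' hs'))
    rw [Real.norm_eq_abs] at h4
    refine h4.trans ?_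
    gcongr
    refine (pi_norm_le_iff_of_nonneg (Finset.sum_nonneg fun _ _ => abs_nonneg _)).2 fun i => ?_
    exact Finset.single_le_sum (f := fun i => |s i - s' i|) (fun _ _ => abs_nonneg _)
      (Finset.mem_univ i)
  choose ε hε hε' using key
  have : Nonempty (Fin q × Fin q) := ⟨⟨⟨0, zero_lt_one.trans hq⟩, ⟨0, zero_lt_one.trans hq⟩⟩⟩
  obtain ⟨⟨k₀, l₀⟩, hmin⟩ := Finite.exists_min (fun x : Fin q × Fin q => ε x.1 x.2)
  refine ⟨ε k₀ l₀, hε _ _, fun k s s' hs hs' hsum => ?_⟩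
  have hz : ∑ i, (s - s') i = 0 := by
    simp only [Pi.sub_apply, Finset.sum_sub_distrib, hsum, sub_self]
  have h1 := sum_abs_fderiv_softmax_le hq hβ k hp0 hp1 hp hz
  calc ∑ l, |softmax β s l - softmax β s' l| ≤
      ∑ l, (|fderiv ℝ (fun s : Fin q → ℝ => softmax β s l) (dominated k p) (s - s')| +
        (κ - θ) / q * ∑ i, |s i - s' i|) := by
        refine Finset.sum_le_sum fun l _ => ?_
        have h2 := hε' k l s s' (fun i => (hs i).trans_le (hmin (k, l)))
          (fun i => (hs' i).trans_le (hmin (k, l)))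
        have h3 := abs_sub_abs_le_abs_sub (softmax β s l - softmax β s' l)
          (fderiv ℝ (fun s : Fin q → ℝ => softmax β s l) (dominated k p) (s - s'))
        linarith
    _ ≤ θ * ∑ l, |s l - s' l| + q * ((κ - θ) / q * ∑ i, |s i - s' i|) := by
        rw [Finset.sum_add_distrib]
        simp only [Finset.sum_const, Finset.card_univ, Fintype.card_fin, nsmul_eq_mul]
        simp only [Pi.sub_apply] at h1
        linarith
    _ = _ := by field_simp; ring

lemma sum_abs_othersProp_sub_le (σ τ : Config n q) (v : Fin n) :
    ∑ l, |othersProp σ v l - othersProp τ v l| ≤ 2 * (hammingDist σ τ : ℝ) / n := by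
  have h : ∀ (ρ : Config n q) l, othersProp ρ v l =
      (∑ w, if w ≠ v ∧ ρ w = l then (1 : ℝ) else 0) / n := by
    intro ρ l
    simp [othersProp, othersWithSpin]
  simp_rw [h, ← sub_div, abs_div, Nat.abs_cast, ← Finset.sum_div]
  gcongr
  calc _ ≤ ∑ l, ∑ w, |(if w ≠ v ∧ σ w = l then (1 : ℝ) else 0) -
        (if w ≠ v ∧ τ w = l then (1 : ℝ) else 0)| := by
        refine Finset.sum_le_sum fun l _ => ?_
        rw [← Finset.sum_sub_distrib]
        exact Finset.abs_sum_le_sum_abs _ _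
    _ ≤ ∑ w, if σ w = τ w then (0 : ℝ) else 2 := by
        rw [Finset.sum_comm]
        refine Finset.sum_le_sum fun w _ => ?_
        by_cases hw : σ w = τ w
        · simp [hw]
        · rw [if_neg hw]
          calc _ ≤ ∑ l, ((if σ w = l then (1 : ℝ) else 0) + (if τ w = l then (1 : ℝ) else 0)) := by
                refine Finset.sum_le_sum fun l _ => ?_
                by_cases h1 : w = v <;> by_cases h2 : σ w = l <;> by_cases h3 : τ w = l <;>
                  simp [h1, h2, h3] <;> positivity
            _ = 2 := by rw [Finset.sum_add_distrib]; simp; norm_num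
    _ = _ := by
        rw [hammingDist, Finset.card_filter]
        push_cast
        rw [Finset.mul_sum]
        exact Finset.sum_congr rfl fun w _ => by by_cases h : σ w = τ w <;> simp [h]

/-! ### Zeros of the drift -/

/-- The function g = D + id is logistic, so D' is a quadratic polynomial in g minus 1. In this form
critical points can be counted through the monotonicity of g. -/
lemma hasDerivAt_drift (hq : 2 < q) (β x : ℝ) :
    HasDerivAt (drift q β)
      (β * q * (drift q β x + x) * (1 - (drift q β x + x)) / (q - 1) - 1) x := by
  have hq' : (2 : ℝ) < q := by exact_mod_cast hq
  have hq1 : (q : ℝ) - 1 ≠ 0 := by linarith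
  have hE := Real.exp_pos (β * ((1 - q * x) / ((q : ℝ) - 1)))
  have h0 : HasDerivAt (fun x : ℝ => β * ((1 - q * x) / ((q : ℝ) - 1)))
      (β * (-(q * 1) / ((q : ℝ) - 1))) x :=
    ((((hasDerivAt_id x).const_mul (q : ℝ)).const_sub 1).div_const _).const_mul β
  have h1 := (((h0.exp.const_mul ((q : ℝ) - 1)).const_add 1).fun_inv (by
    have := mul_pos (by linarith : (0 : ℝ) < q - 1) hE
    linarith)).sub (hasDerivAt_id x)
  refine h1.congr_deriv ?_
  have hne : 1 + ((q : ℝ) - 1) * Real.exp (β * ((1 - q * x) / ((q : ℝ) - 1))) ≠ 0 := by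
    have := mul_pos (by linarith : (0 : ℝ) < q - 1) hE
    linarith
  rw [drift, sub_add_cancel]
  generalize Real.exp (β * ((1 - q * x) / ((q : ℝ) - 1))) = E at *
  field_simp
  ring

lemma continuous_drift (hq : 2 < q) (β : ℝ) : Continuous (drift q β) :=
  continuous_iff_continuousAt.2 fun x => (hasDerivAt_drift hq β x).continuousAt

lemma drift_lt_drift_of_beta_lt (hq : 2 < q) {β β' x : ℝ} (h : β < β') (hx : 1 / (q : ℝ) < x) :
    drift q β x < drift q β' x := by
  have hq' : (2 : ℝ) < q := by exact_mod_cast hq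
  have hneg : (1 - q * x) / ((q : ℝ) - 1) < 0 := by
    rw [div_lt_iff₀ (by linarith)] at hx
    exact div_neg_of_neg_of_pos (by linarith) (by linarith)
  unfold drift
  have h1 : Real.exp (β' * ((1 - q * x) / ((q : ℝ) - 1))) <
      Real.exp (β * ((1 - q * x) / ((q : ℝ) - 1))) :=
    Real.exp_lt_exp.2 (mul_lt_mul_of_neg_right h hneg)
  have h2 := Real.exp_pos (β' * ((1 - q * x) / ((q : ℝ) - 1)))
  have hq1 : (0 : ℝ) < q - 1 := by linarith
  gcongr

lemma strictMono_drift_add_self (hq : 2 < q) (hβ : 0 < β) :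
    StrictMono fun x => drift q β x + x := by
  have hq' : (2 : ℝ) < q := by exact_mod_cast hq
  have hq1 : (0 : ℝ) < q - 1 := by linarith
  intro x y hxy
  simp only [drift, sub_add_cancel]
  have h1 : Real.exp (β * ((1 - q * y) / ((q : ℝ) - 1))) <
      Real.exp (β * ((1 - q * x) / ((q : ℝ) - 1))) := by
    rw [Real.exp_lt_exp]
    gcongr
  have h2 := Real.exp_pos (β * ((1 - q * y) / ((q : ℝ) - 1)))
  gcongr

lemma drift_one_div (hq : 2 < q) (β : ℝ) : drift q β (1 / q) = 0 := by
  have hq' : (2 : ℝ) < q := by exact_mod_cast hq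
  have hq0 : (q : ℝ) ≠ 0 := by linarith
  rw [drift, mul_one_div_cancel hq0, sub_self, zero_div, mul_zero, Real.exp_zero]
  simp

lemma drift_one_neg (hq : 2 < q) (β : ℝ) : drift q β 1 < 0 := by
  have hq' : (2 : ℝ) < q := by exact_mod_cast hq
  rw [drift, sub_neg]
  apply inv_lt_one_of_one_lt₀
  have := mul_pos (by linarith : (0 : ℝ) < q - 1) (Real.exp_pos (β * ((1 - q * 1) / (q - 1))))
  linarith

lemma exists_pos_right {f : ℝ → ℝ} {f' a b : ℝ} (h : HasDerivAt f f' a) (ha : f a = 0)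
    (hf : 0 < f') (hab : a < b) : ∃ x ∈ Set.Ioo a b, 0 < f x := by
  have h1 := ((hasDerivAt_iff_tendsto_slope.1 h).mono_left (nhdsGT_le_nhdsNE a)).eventually_const_lt
    hf
  obtain ⟨x, hx, hx'⟩ := (h1.and (Ioo_mem_nhdsGT hab)).exists
  refine ⟨x, hx', ?_⟩
  rw [slope_def_field, ha, sub_zero] at hx
  have : 0 < x - a := by linarith [hx'.1]
  exact (div_pos_iff_of_pos_right this).1 hx

lemma exists_neg_left {f : ℝ → ℝ} {f' a b : ℝ} (h : HasDerivAt f f' a) (ha : f a = 0)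
    (hf : 0 < f') (hab : b < a) : ∃ x ∈ Set.Ioo b a, f x < 0 := by
  have h1 := ((hasDerivAt_iff_tendsto_slope.1 h).mono_left (nhdsLT_le_nhdsNE a)).eventually_const_lt
    hf
  obtain ⟨x, hx, hx'⟩ := (h1.and (Ioo_mem_nhdsLT hab)).exists
  refine ⟨x, hx', ?_⟩
  rw [slope_def_field, ha, sub_zero] at hx
  have h2 : x - a < 0 := by linarith [hx'.2]
  by_contra h3
  exact absurd hx (not_lt.2 (div_nonpos_of_nonneg_of_nonpos (not_lt.1 h3) h2.le))

lemma exists_zero_of_pos {x : ℝ} (hq : 2 < q) (hx1 : x < 1) (hx : 0 < drift q β x) :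
    ∃ z ∈ Set.Ioo x 1, drift q β z = 0 :=
  intermediate_value_Ioo' hx1.le (continuous_drift hq β).continuousOn ⟨drift_one_neg hq β, hx⟩

/-- For β > q the drift has slope β/q - 1 > 0 at its zero 1/q, so it becomes positive to the right
and must vanish again before 1. Boundedness makes the supremum in `betaU` a genuine one. -/
lemma bddAbove_no_zero (hq : 2 < q) :
    BddAbove {β : ℝ | 0 ≤ β ∧ ∀ x ∈ Set.Ioo (1 / (q : ℝ)) 1, drift q β x ≠ 0} := by
  have hq' : (2 : ℝ) < q := by exact_mod_cast hq
  refine ⟨q, fun β hβ => ?_⟩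
  by_contra hlt
  rw [not_le] at hlt
  have hd := hasDerivAt_drift hq β (1 / q)
  have hpos : 0 < β * q * (drift q β (1 / q) + 1 / q) * (1 - (drift q β (1 / q) + 1 / q)) /
      (q - 1) - 1 := by
    rw [drift_one_div hq]
    have : β * q * (0 + 1 / q) * (1 - (0 + 1 / (q : ℝ))) / (q - 1) = β / q := by
      have : (q : ℝ) - 1 ≠ 0 := by linarith
      field_simp; ring
    rw [this, sub_pos, one_lt_div (by linarith)]
    exact hlt
  have h1q : 1 / (q : ℝ) < 1 := by rw [div_lt_one (by linarith)]; linarith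
  obtain ⟨x, hx, hx'⟩ := exists_pos_right hd (drift_one_div hq β) hpos h1q
  obtain ⟨z, hz, hz'⟩ := exists_zero_of_pos hq hx.2 hx'
  exact hβ.2 z ⟨hx.1.trans hz.1, hz.2⟩ hz'

lemma betaU_nonneg (hq : 2 < q) : 0 ≤ betaU q := by
  have hq' : (2 : ℝ) < q := by exact_mod_cast hq
  refine le_csSup (bddAbove_no_zero hq) ⟨le_rfl, fun x hx h => ?_⟩
  have h1 : drift q 0 x = 1 / q - x := by simp [drift]
  rw [h1] at h
  linarith [hx.1]

/-- Some intermediate β' above the supremum has a zero in (1/q, 1), and the drift increases strictly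
in β to the right of 1/q. -/
lemma exists_drift_pos (hq : 2 < q) (hβ : betaU q < β) :
    ∃ x ∈ Set.Ioo (1 / (q : ℝ)) 1, 0 < drift q β x := by
  obtain ⟨β', h1, h2⟩ := exists_between hβ
  have h3 : ¬ ∀ x ∈ Set.Ioo (1 / (q : ℝ)) 1, drift q β' x ≠ 0 := fun h =>
    absurd (le_csSup (bddAbove_no_zero hq) ⟨(betaU_nonneg hq).trans h1.le, h⟩) (not_le.2 h1)
  push Not at h3
  obtain ⟨x, hx, hx'⟩ := h3
  exact ⟨x, hx, hx' ▸ drift_lt_drift_of_beta_lt hq h2 hx.1⟩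

lemma exists_critical (hq : 2 < q) {a b : ℝ} (hab : a < b) (ha : drift q β a = 0)
    (hb : drift q β b = 0) :
    ∃ c ∈ Set.Ioo a b, deriv (drift q β) c = 0 :=
  exists_deriv_eq_zero hab (continuous_drift hq β).continuousOn (ha.trans hb.symm)

/-- Critical points are solutions of a quadratic equation in the strictly increasing quantity D(x) +
x. Two of its roots sum to 1, so a third cannot exist. -/
lemma not_three_critical (hq : 2 < q) (hβ : 0 < β) {a b c : ℝ} (hab : a < b) (hbc : b < c)
    (ha : deriv (drift q β) a = 0) (hb : deriv (drift q β) b = 0)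
    (hc : deriv (drift q β) c = 0) : False := by
  have hq' : (2 : ℝ) < q := by exact_mod_cast hq
  have hq1 : (0 : ℝ) < q - 1 := by linarith
  rw [(hasDerivAt_drift hq β _).deriv] at ha hb hc
  have m1 := strictMono_drift_add_self hq hβ hab
  have m2 := strictMono_drift_add_self hq hβ hbc
  simp only at m1 m2
  generalize drift q β a + a = x at *
  generalize drift q β b + b = y at *
  generalize drift q β c + c = z at *
  have hk : 0 < β * q / (q - 1) := by positivity
  have e1 : β * q / (q - 1) * ((y - x) * (1 - x - y)) = 0 := by
    have : β * q / (q - 1) * ((y - x) * (1 - x - y)) =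
      (β * q * y * (1 - y) / (q - 1) - 1) - (β * q * x * (1 - x) / (q - 1) - 1) := by ring
    rw [this, ha, hb, sub_zero]
  have e2 : β * q / (q - 1) * ((z - y) * (1 - y - z)) = 0 := by
    have : β * q / (q - 1) * ((z - y) * (1 - y - z)) =
      (β * q * z * (1 - z) / (q - 1) - 1) - (β * q * y * (1 - y) / (q - 1) - 1) := by ring
    rw [this, hb, hc, sub_zero]
  have f1 : 1 - x - y = 0 := by
    rcases mul_eq_zero.1 ((mul_eq_zero.1 e1).resolve_left hk.ne') with h | h <;> linarith
  have f2 : 1 - y - z = 0 := by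
    rcases mul_eq_zero.1 ((mul_eq_zero.1 e2).resolve_left hk.ne') with h | h <;> linarith
  linarith

/-- A function vanishing at `p` and `c`, and nowhere else on an interval, is comparable to
`(x - p) * (x - c)` there if both zeros are simple. -/
lemma exists_mul_sq_le_of_simple_zeros {f : ℝ → ℝ} (hf : Differentiable ℝ f) {p c lo hi : ℝ}
    (hpc : p ≠ c) (hp : f p = 0) (hc : f c = 0) (hp' : deriv f p < 0) (hc' : deriv f c ≠ 0)
    (hpI : p ∈ Set.Icc lo hi) (hne : ∀ x ∈ Set.Icc lo hi, f x = 0 → x = p ∨ x = c) :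
    ∃ lam > 0, ∀ x ∈ Set.Icc lo hi,
      lam * (p - x) ^ 2 ≤ f x * (p - x) * ((x - c) * (p - c))⁻¹ ∨ x = c := by
  -- Both zeros are divided out: f(x) = (x - p)(x - c) h(x) with `h` continuous. Simplicity of the
  -- zeros gives `h ≠ 0` at `p` and at `c`.
  set g := dslope f p
  set h := dslope g c with hh
  have hg : Continuous g := by
    rw [← continuousOn_univ]
    exact (continuousOn_dslope Filter.univ_mem).2 ⟨hf.continuous.continuousOn, hf p⟩
  have hgd : DifferentiableAt ℝ g c := (differentiableAt_dslope_of_ne hpc.symm).2 (hf c)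
  have hcont : Continuous h := by
    rw [← continuousOn_univ]
    exact (continuousOn_dslope Filter.univ_mem).2 ⟨hg.continuousOn, hgd⟩
  have hfg : ∀ x, f x = (x - p) * g x := fun x => by
    have := sub_smul_dslope f p x
    rw [smul_eq_mul, hp, sub_zero] at this
    exact this.symm
  have hgc : g c = 0 := by
    have := hfg c
    rw [hc] at this
    exact (mul_eq_zero.1 this.symm).resolve_left (sub_ne_zero.2 hpc.symm)
  have hgh : ∀ x, g x = (x - c) * h x := fun x => by
    have := sub_smul_dslope g c x
    rw [smul_eq_mul, hgc, sub_zero] at this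
    exact this.symm
  have hgp : g p = deriv f p := dslope_same f p
  have hhp : (p - c) * h p < 0 := by rw [← hgh, hgp]; exact hp'
  have hhc : h c ≠ 0 := by
    have h1 : HasDerivAt f (1 * g c + (c - p) * deriv g c) c := by
      have := ((hasDerivAt_id c).sub_const p).fun_mul hgd.hasDerivAt
      exact this.congr_of_eventuallyEq (Filter.Eventually.of_forall hfg)
    have h2 : h c = deriv g c := dslope_same g c
    intro h3
    rw [h2] at h3
    rw [h1.deriv, hgc, h3] at hc'
    simp at hc'
  have hpc' : p - c ≠ 0 := sub_ne_zero.2 hpc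
  set F : ℝ → ℝ := fun x => -h x * (p - c)⁻¹ with hF
  have hFp : 0 < F p := by
    have : F p = -((p - c) * h p) * ((p - c)⁻¹) ^ 2 := by simp only [hF]; field_simp
    rw [this]
    have := sq_pos_of_ne_zero (inv_ne_zero hpc')
    nlinarith
  have hFne : ∀ x ∈ Set.Icc lo hi, F x ≠ 0 := by
    intro x hx h0
    have hx0 : h x = 0 := by
      rcases mul_eq_zero.1 h0 with h1 | h1
      · linarith
      · exact absurd h1 (inv_ne_zero hpc')
    rcases hne x hx (by rw [hfg, hgh, hx0]; ring) with h1 | h1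
    · rw [h1] at hx0; rw [hx0] at hhp; simp at hhp
    · rw [h1] at hx0; exact hhc hx0
  have hFc : Continuous F := by simp only [hF]; fun_prop
  obtain ⟨x₀, hx₀, hmin⟩ := isCompact_Icc.exists_isMinOn ⟨p, hpI⟩ hFc.continuousOn
  -- `F` has no zero on the interval and is positive at `p`, so its minimum is positive and serves
  -- as the constant.
  have hFx₀ : 0 < F x₀ := by
    by_contra hneg
    obtain ⟨y, hy, hy'⟩ := isPreconnected_Icc.intermediate_value hx₀ hpI hFc.continuousOn
      ⟨not_lt.1 hneg, hFp.le⟩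
    exact hFne y hy hy'
  refine ⟨F x₀, hFx₀, fun x hx => ?_⟩
  rcases eq_or_ne x c with hxc | hxc
  · exact Or.inr hxc
  · left
    have hxc' : x - c ≠ 0 := sub_ne_zero.2 hxc
    have h1 : f x * (p - x) * ((x - c) * (p - c))⁻¹ = F x * (p - x) ^ 2 := by
      rw [hfg, hgh, hF]; field_simp; ring
    rw [h1]
    exact mul_le_mul_of_nonneg_right (hmin hx) (sq_nonneg _)

/-- The phase diagram of the drift for `β_u < β < β_s`. -/
lemma drift_structure (hq : 2 < q) (hβ : β ∈ Set.Ioo (betaU q) (betaS q)) :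
    1 / (q : ℝ) < mStar q β ∧ mStar q β < mR q β ∧ mR q β < 1 ∧
    drift q β (mR q β) = 0 ∧
    β * q * mR q β * (1 - mR q β) / (q - 1) < 1 ∧
    (∃ lam > 0, ∀ m ∈ Set.Icc (0 : ℝ) 1, 0 ≤ -1 * (m - mStar q β) →
      lam * (-1 * (m - mStar q β)) * (1 / (q : ℝ) - m) ^ 2 ≤ drift q β m * (1 / (q : ℝ) - m)) ∧
    (∃ lam > 0, ∀ m ∈ Set.Icc (0 : ℝ) 1, 0 ≤ 1 * (m - mStar q β) →
      lam * (1 * (m - mStar q β)) * (mR q β - m) ^ 2 ≤ drift q β m * (mR q β - m)) := by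
  have hq' : (2 : ℝ) < q := by exact_mod_cast hq
  have hβ0 : 0 < β := (betaU_nonneg hq).trans_lt hβ.1
  have hβq : β < q := hβ.2
  obtain ⟨x₀, hx₀, hx₀'⟩ := exists_drift_pos hq hβ.1
  have hcont := (continuous_drift hq β)
  have hd0 : deriv (drift q β) (1 / q) < 0 := by
    rw [(hasDerivAt_drift hq β _).deriv, drift_one_div hq]
    have : β * q * (0 + 1 / q) * (1 - (0 + 1 / (q : ℝ))) / (q - 1) = β / q := by
      have : (q : ℝ) - 1 ≠ 0 := by linarith
      field_simp; ring
    rw [this, sub_neg, div_lt_one (by linarith)]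
    exact hβq
  have hdiff : Differentiable ℝ (drift q β) := fun x => (hasDerivAt_drift hq β x).differentiableAt
  obtain ⟨x₁, hx₁, hx₁'⟩ := exists_pos_right (f := fun x => -drift q β x)
    (hdiff (1 / q)).hasDerivAt.fun_neg (by simp only [drift_one_div hq, neg_zero]) (neg_pos.2 hd0) hx₀.1
  obtain ⟨a, ha, ha0⟩ : ∃ z ∈ Set.Ioo x₁ x₀, drift q β z = 0 :=
    intermediate_value_Ioo hx₁.2.le hcont.continuousOn ⟨by linarith, hx₀'⟩
  obtain ⟨b, hb, hb0⟩ := exists_zero_of_pos hq hx₀.2 hx₀'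
  have h0 := drift_one_div hq β
  have hqa : 1 / (q : ℝ) < a := hx₁.1.trans ha.1
  have hab : a < b := ha.2.trans hb.1
  obtain ⟨y₁, hy₁, hy₁'⟩ := exists_critical hq hqa h0 ha0
  obtain ⟨y₂, hy₂, hy₂'⟩ := exists_critical hq hab ha0 hb0
  -- By Rolle, a fourth zero would produce a third critical point, wherever it lies.
  have hzeros : ∀ z, drift q β z = 0 → z = 1 / q ∨ z = a ∨ z = b := by
    intro z hz
    by_contra! hcon
    obtain ⟨c1, c2, c3⟩ := hcon
    rcases lt_or_gt_of_ne c1 with h | h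
    · obtain ⟨y, hy, hy'⟩ := exists_critical hq h hz h0
      exact not_three_critical hq hβ0 (hy.2.trans hy₁.1) (hy₁.2.trans hy₂.1) hy' hy₁' hy₂'
    · rcases lt_or_gt_of_ne c2 with h2 | h2
      · obtain ⟨u, hu, hu'⟩ := exists_critical hq h h0 hz
        obtain ⟨v, hv, hv'⟩ := exists_critical hq h2 hz ha0
        exact not_three_critical hq hβ0 (hu.2.trans hv.1) (hv.2.trans hy₂.1) hu' hv' hy₂'
      · rcases lt_or_gt_of_ne c3 with h3 | h3
        · obtain ⟨u, hu, hu'⟩ := exists_critical hq h2 ha0 hz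
          obtain ⟨v, hv, hv'⟩ := exists_critical hq h3 hz hb0
          exact not_three_critical hq hβ0 (hy₁.2.trans hu.1) (hu.2.trans hv.1) hy₁' hu' hv'
        · obtain ⟨y, hy, hy'⟩ := exists_critical hq h3 hb0 hz
          exact not_three_critical hq hβ0 (hy₁.2.trans hy₂.1) (hy₂.2.trans hy.1) hy₁' hy₂' hy'
  have hda : deriv (drift q β) a ≠ 0 := fun h =>
    not_three_critical hq hβ0 hy₁.2 hy₂.1 hy₁' h hy₂'
  -- The slope at `b` is nonzero, since `b` would otherwise be a third critical point. A positive
  -- slope would make the drift negative just left of `b`, and it would vanish once more between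
  -- `x₀` and `b`.
  have hdb : deriv (drift q β) b < 0 := by
    have hne : deriv (drift q β) b ≠ 0 := fun h =>
      not_three_critical hq hβ0 (hy₁.2.trans hy₂.1) hy₂.2 hy₁' hy₂' h
    by_contra hge
    have hpos : 0 < deriv (drift q β) b := lt_of_le_of_ne (not_lt.1 hge) hne.symm
    obtain ⟨x, hx, hx'⟩ := exists_neg_left (hdiff b).hasDerivAt hb0 hpos hb.1
    obtain ⟨z, hz, hz'⟩ : ∃ y ∈ Set.Ioo x₀ x, drift q β y = 0 :=
      intermediate_value_Ioo' hx.1.le hcont.continuousOn ⟨hx', hx₀'⟩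
    rcases hzeros z hz' with h | h | h
    · linarith [hz.1, hx₀.1]
    · linarith [hz.1, ha.2]
    · linarith [hz.2, hx.2]
  have hset : driftZeros q β = {a, b} := by
    ext z
    simp only [driftZeros, Set.mem_ofPred_eq, Set.mem_insert_iff, Set.mem_singleton_iff]
    constructor
    · rintro ⟨hz, hz'⟩
      rcases hzeros z hz' with h | h | h
      · exact absurd hz.1 (by rw [h]; exact lt_irrefl _)
      · exact Or.inl h
      · exact Or.inr h
    · rintro (h | h)
      · rw [h]; exact ⟨⟨hqa, hab.trans hb.2⟩, ha0⟩
      · rw [h]; exact ⟨⟨hqa.trans hab, hb.2⟩, hb0⟩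
  have hS : mStar q β = a := by rw [mStar, hset, csInf_pair, min_eq_left hab.le]
  have hR : mR q β = b := by rw [mR, hset, csSup_pair, max_eq_right hab.le]
  rw [hS, hR]
  refine ⟨hqa, hab, hb.2, hb0, ?_, ?_, ?_⟩
  · have h := hdb
    rw [(hasDerivAt_drift hq β _).deriv, hb0, zero_add] at h
    linarith
  · obtain ⟨lam, hlam, h⟩ := exists_mul_sq_le_of_simple_zeros hdiff (lo := 0) (hi := a) hqa.ne h0 ha0
      hd0 hda ⟨by positivity, hqa.le⟩ (fun x hx hx0 => by
        rcases hzeros x hx0 with h | h | h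
        · exact Or.inl h
        · exact Or.inr h
        · linarith [hx.2])
    -- The factor `a - 1/q` clears the `p - c` in the denominator of the factorized bound.
    refine ⟨lam * (a - 1 / q), mul_pos hlam (by linarith), fun m hm hma => ?_⟩
    rcases h m ⟨hm.1, by linarith⟩ with h1 | h1
    · rcases eq_or_ne m a with h2 | h2
      · rw [h2, ha0]; simp
      · have hpos : 0 < (m - a) * (1 / q - a) :=
          mul_pos_of_neg_of_neg (lt_of_le_of_ne (by linarith) (sub_ne_zero.2 h2)) (by linarith)
        rw [← div_eq_mul_inv, le_div_iff₀ hpos] at h1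
        calc _ = _ := by ring
          _ ≤ _ := h1
    · rw [h1, ha0]; simp
  · obtain ⟨lam, hlam, h⟩ := exists_mul_sq_le_of_simple_zeros hdiff (lo := a) (hi := 1) hab.ne' hb0 ha0
      hdb hda ⟨hab.le, hb.2.le⟩ (fun x hx hx0 => by
        rcases hzeros x hx0 with h | h | h
        · linarith [hx.1]
        · exact Or.inr h
        · exact Or.inl h)
    refine ⟨lam * (b - a), mul_pos hlam (by linarith), fun m hm hma => ?_⟩
    rcases h m ⟨by linarith, hm.2⟩ with h1 | h1
    · rcases eq_or_ne m a with h2 | h2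
      · rw [h2, ha0]; simp
      · have hpos : 0 < (m - a) * (b - a) :=
          mul_pos (lt_of_le_of_ne (by linarith) (sub_ne_zero.2 h2).symm) (by linarith)
        rw [← div_eq_mul_inv, le_div_iff₀ hpos] at h1
        calc _ = _ := by ring
          _ ≤ _ := h1
    · rw [h1, ha0]; simp

/-! ### One-step estimates -/

/-- The point `p` is attracting for the drift, on the side `s * (m - c) ≥ 0` of the repelling
point `c`; the number `s` is a sign. -/
structure IsTarget (q : ℕ) (β s c p lam : ℝ) : Prop where
  sign : s = 1 ∨ s = -1
  lam_pos : 0 < lam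
  dist_pos : 0 < s * (p - c)
  one_div_lt : 1 / (q : ℝ) < c
  lt_one : c < 1
  one_div_le : 1 / (q : ℝ) ≤ p
  le_one : p ≤ 1
  fixed : drift q β p = 0
  slope_lt : β * q * p * (1 - p) / (q - 1) < 1
  drift_le : ∀ m ∈ Set.Icc (0 : ℝ) 1, 0 ≤ s * (m - c) →
    lam * (s * (m - c)) * (p - m) ^ 2 ≤ drift q β m * (p - m)

/-- The common form of the one-step estimates: bound the function along every update by an affine
function of the increment, so that only the mean increment enters. -/
lemma stepE_le_of_affine [NeZero n] [NeZero q] {F : Config n q → ℝ} {σ : Config n q} {k : Fin q}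
    {A B : ℝ} (h : ∀ v l, F (Function.update σ v l) ≤
      A + B * (proportions (Function.update σ v l) k - proportions σ k)) :
    stepE n q β F σ ≤ A + B * meanInc n q β σ k := by
  have : stepE n q β (fun τ => A + B * (proportions τ k - proportions σ k)) σ =
      A + B * meanInc n q β σ k := by
    rw [stepE_add (fun _ => A), stepE_const, stepE_const_mul]; rfl
  rw [← this]
  exact stepE_mono_at h

lemma stepE_le_of_le [NeZero n] [NeZero q] {F : Config n q → ℝ} {σ : Config n q}
    {A : ℝ} (h : ∀ v l, F (Function.update σ v l) ≤ A) : stepE n q β F σ ≤ A := by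
  have := stepE_mono_at (β := β) (G := fun _ => A) h
  rwa [stepE_const] at this

lemma exp_le_one_add_add_sq {u : ℝ} (hu : |u| ≤ 1) : Real.exp u ≤ 1 + u + u ^ 2 := by
  have := (abs_le.1 (Real.abs_exp_sub_one_sub_id_le hu)).2
  linarith

/-- The Gaussian barrier at the repelling point. -/
lemma stepE_exp_neg_sq_le [NeZero n] [NeZero q] {s c p lam : ℝ} (ht : IsTarget q β s c p lam)
    {a ε : ℝ} (ha : 0 < a) (ha1 : 2 * a ≤ 1) (ha2 : a ≤ lam * (s * (p - c)) / 8)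
    (k : Fin q) (σ : Config n q)
    (hε : |n * meanInc n q β σ k - drift q β (proportions σ k)| ≤ ε)
    (hx : 0 ≤ s * (proportions σ k - c))
    (hεx : ε ≤ lam * (s * (p - c)) / 4 * (s * (proportions σ k - c))) :
    stepE n q β (fun τ => Real.exp (-(a * n * (s * (proportions τ k - c)) ^ 2))) σ ≤
      Real.exp (-(a * n * (s * (proportions σ k - c)) ^ 2)) +
        Real.exp 1 * Real.exp (-(a * n * (s * (p - c)) ^ 2 / 4)) := by
  have hn : (0 : ℝ) < n := by exact_mod_cast Nat.pos_of_ne_zero (NeZero.ne n)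
  have hss : s * s = 1 := by rcases ht.sign with h | h <;> rw [h] <;> norm_num
  have habs : |s| = 1 := by rcases ht.sign with h | h <;> rw [h] <;> simp
  set m := proportions σ k with hm
  set x := s * (m - c) with hxdef
  set L := s * (p - c) with hL
  have hm01 : m ∈ Set.Icc (0 : ℝ) 1 := ⟨proportions_nonneg σ k, proportions_le_one σ k⟩
  have hc0 : 0 ≤ c := le_trans (by positivity) ht.one_div_lt.le
  have hx1 : x ≤ 1 := by
    have : |x| ≤ 1 := by
      rw [hxdef, abs_mul, habs, one_mul, abs_le]
      constructor <;> linarith [hm01.1, hm01.2, ht.lt_one]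
    exact (abs_le.1 this).2
  have hL0 : 0 < L := ht.dist_pos
  have hincr : ∀ v l, s * (proportions (Function.update σ v l) k - c) =
      x + s * (proportions (Function.update σ v l) k - m) := fun v l => by rw [hxdef]; ring
  have hD : ∀ v l, |2 * a * n * x * (s * (proportions (Function.update σ v l) k - m))| ≤
      2 * a * x := by
    intro v l
    rw [abs_mul, abs_mul s, habs, one_mul, abs_of_nonneg (by positivity)]
    calc _ ≤ 2 * a * n * x * (1 / n) := by
          gcongr; exact abs_proportions_update_sub_le σ v l k
      _ = _ := by field_simp
  -- The squared increment in the exponent has a favourable sign and is dropped.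
  have hpt : ∀ v l, Real.exp (-(a * n * (s * (proportions (Function.update σ v l) k - c)) ^ 2)) ≤
      Real.exp (-(a * n * x ^ 2)) *
        Real.exp (-(2 * a * n * x * (s * (proportions (Function.update σ v l) k - m)))) := by
    intro v l
    rw [← Real.exp_add, Real.exp_le_exp, hincr]
    have := mul_nonneg (mul_nonneg ha.le hn.le)
      (sq_nonneg (s * (proportions (Function.update σ v l) k - m)))
    nlinarith
  -- Up to half way to the target, the outward drift is at least `lam * L * x / 2`, and half of that
  -- survives the error `ε`. Beyond, the barrier after one step is itself exponentially small in
  -- `n`.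
  rcases le_or_gt x (L / 2) with hxL | hxL
  · have hb : lam * L * x / 4 ≤ s * (n * meanInc n q β σ k) := by
      have h1 := ht.drift_le m hm01 hx
      have hpm : p - m = s * (L - x) := by
        rw [hL, hxdef]; linear_combination (m - p) * hss
      have h3 : lam * L * x / 2 ≤ s * drift q β m := by
        have hLx : 0 < L - x := by linarith
        have h2 : lam * x * (L - x) ^ 2 ≤ s * drift q β m * (L - x) := by
          rw [hpm] at h1
          have e : (s * (L - x)) ^ 2 = (L - x) ^ 2 := by
            linear_combination (L - x) ^ 2 * hss
          rw [e] at h1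
          linarith
        have h4 : lam * x * (L - x) ≤ s * drift q β m := by
          refine le_of_mul_le_mul_right ?_ hLx
          linarith
        have : lam * x * (L / 2) ≤ lam * x * (L - x) := by
          have := ht.lam_pos
          gcongr; linarith
        linarith
      have h5 : |s * (n * meanInc n q β σ k - drift q β m)| ≤ ε := by
        rw [abs_mul, habs, one_mul]; exact hε
      have h6 := (abs_le.1 h5).1
      nlinarith
    have h7 : stepE n q β (fun τ => Real.exp (-(a * n * (s * (proportions τ k - c)) ^ 2))) σ ≤
        Real.exp (-(a * n * x ^ 2)) * (1 + 4 * a ^ 2 * x ^ 2) +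
        (Real.exp (-(a * n * x ^ 2)) * (-(2 * a * n * x * s))) * meanInc n q β σ k := by
      refine stepE_le_of_affine fun v l => (hpt v l).trans ?_
      have h8 := exp_le_one_add_add_sq
        (u := -(2 * a * n * x * (s * (proportions (Function.update σ v l) k - m)))) (by
          rw [abs_neg]
          exact (hD v l).trans (by nlinarith))
      have h9 : (-(2 * a * n * x * (s * (proportions (Function.update σ v l) k - m)))) ^ 2 ≤
          4 * a ^ 2 * x ^ 2 := by
        rw [← sq_abs, abs_neg]
        have := hD v l
        calc _ ≤ (2 * a * x) ^ 2 := by gcongr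
          _ = _ := by ring
      have := mul_le_mul_of_nonneg_left (h8.trans (add_le_add_right h9 _))
        (Real.exp_pos (-(a * n * x ^ 2))).le
      linarith
    refine h7.trans ?_
    have hE := Real.exp_pos (-(a * n * x ^ 2))
    -- The condition `a ≤ lam * L / 8` makes the first-order gain outweigh the second-order term.
    have h10 : 4 * a ^ 2 * x ^ 2 - 2 * a * x * (s * (n * meanInc n q β σ k)) ≤ 0 := by
      have h11 : 2 * a * x * (lam * L * x / 4) ≤ 2 * a * x * (s * (n * meanInc n q β σ k)) := by
        gcongr
      have h12 : 4 * a ^ 2 * x ^ 2 ≤ 4 * a * (lam * L / 8) * x ^ 2 := by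
        rw [pow_two a, ← mul_assoc]; gcongr
      nlinarith
    have h13 := mul_nonpos_of_nonneg_of_nonpos hE.le h10
    have h14 : 0 ≤ Real.exp 1 * Real.exp (-(a * n * L ^ 2 / 4)) := by positivity
    linarith
  · refine (stepE_le_of_le (A := Real.exp 1 * Real.exp (-(a * n * L ^ 2 / 4)))
      fun v l => (hpt v l).trans ?_).trans (le_add_of_nonneg_left (Real.exp_pos _).le)
    rw [mul_comm]
    gcongr
    · have := (abs_le.1 (hD v l)).1
      nlinarith
    · have : L ^ 2 / 4 ≤ x ^ 2 := by nlinarith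
      have := mul_le_mul_of_nonneg_left this (mul_pos ha hn).le
      linarith

/-- The exponential barrier to the left of `1 / q`. -/
lemma stepE_exp_neg_le [NeZero n] [NeZero q] {d r b ε : ℝ}
    (hd : ∀ m ∈ Set.Icc (0 : ℝ) (1 / q), d * (1 / q - m) ≤ drift q β m) (hd0 : 0 < d)
    (hr : 0 < r) (hb : 0 < b) (hb1 : b ≤ 1) (hb2 : b ≤ d * r / 4) (k : Fin q) (σ : Config n q)
    (hε : |n * meanInc n q β σ k - drift q β (proportions σ k)| ≤ ε) (hεd : ε ≤ d * r / 4) :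
    stepE n q β (fun τ => Real.exp (-(b * n * (proportions τ k - 1 / q + r)))) σ ≤
      Real.exp (-(b * n * (proportions σ k - 1 / q + r))) +
        Real.exp 1 * Real.exp (-(b * n * r / 2)) := by
  have hn : (0 : ℝ) < n := by exact_mod_cast Nat.pos_of_ne_zero (NeZero.ne n)
  set m := proportions σ k with hm
  set z := m - 1 / q + r with hz
  have hD : ∀ v l, |b * n * (proportions (Function.update σ v l) k - m)| ≤ b := by
    intro v l
    rw [abs_mul, abs_of_nonneg (by positivity)]
    calc _ ≤ b * n * (1 / n) := by
          gcongr; exact abs_proportions_update_sub_le σ v l k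
      _ = _ := by field_simp
  have hpt : ∀ v l, Real.exp (-(b * n * (proportions (Function.update σ v l) k - 1 / q + r))) =
      Real.exp (-(b * n * z)) *
        Real.exp (-(b * n * (proportions (Function.update σ v l) k - m))) := by
    intro v l
    rw [← Real.exp_add, hz]; ring_nf
  have hE := Real.exp_pos (-(b * n * z))
  -- For `z ≤ r / 2` the drift back to 1/q, less the error, is at least `d * r / 4 ≥ b`. For larger
  -- `z` the barrier is exponentially small in `n`.
  rcases le_or_gt z (r / 2) with hzr | hzr
  · have hDr : d * r / 2 ≤ drift q β m := by
      refine le_trans ?_ (hd m ⟨proportions_nonneg σ k, by linarith⟩)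
      nlinarith
    have hb' : b ≤ n * meanInc n q β σ k := by linarith [(abs_le.1 hε).1]
    have h7 : stepE n q β (fun τ => Real.exp (-(b * n * (proportions τ k - 1 / q + r)))) σ ≤
        Real.exp (-(b * n * z)) * (1 + b ^ 2) +
        (Real.exp (-(b * n * z)) * (-(b * n))) * meanInc n q β σ k := by
      refine stepE_le_of_affine fun v l => (hpt v l).le.trans ?_
      have h8 := exp_le_one_add_add_sq
        (u := -(b * n * (proportions (Function.update σ v l) k - m))) (by
          rw [abs_neg]; exact (hD v l).trans hb1)
      have h9 : (-(b * n * (proportions (Function.update σ v l) k - m))) ^ 2 ≤ b ^ 2 := by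
        rw [← sq_abs, abs_neg]
        have := hD v l
        gcongr
      have := mul_le_mul_of_nonneg_left (h8.trans (add_le_add_right h9 _)) hE.le
      linarith
    refine h7.trans ?_
    have h10 : b ^ 2 - b * (n * meanInc n q β σ k) ≤ 0 := by nlinarith
    have h13 := mul_nonpos_of_nonneg_of_nonpos hE.le h10
    have h14 : 0 ≤ Real.exp 1 * Real.exp (-(b * n * r / 2)) := by positivity
    linarith
  · refine (stepE_le_of_le (A := Real.exp 1 * Real.exp (-(b * n * r / 2)))
      fun v l => (hpt v l).le.trans ?_).trans (le_add_of_nonneg_left hE.le)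
    rw [mul_comm]
    gcongr
    · linarith [(abs_le.1 (hD v l)).1]
    · have := mul_le_mul_of_nonneg_left hzr.le (mul_pos hb hn).le
      linarith

/-- A second-order expansion of (L/x - 1)² in `x` with explicit remainder. The condition `1 / N ≤ x
/ 2` keeps `x + d` above `x / 2`, so one jump cannot reach the pole. -/
lemma sq_ratio_increment_le {L x d N : ℝ} (hL : 0 < L) (hN : 0 < N) (hx : 0 < x)
    (hNx : 1 / N ≤ x / 2) (hd : |d| ≤ 1 / N) :
    (L / (x + d) - 1) ^ 2 ≤ ((L / x - 1) ^ 2 + 4 * |L / x - 1| * L / (N ^ 2 * x ^ 3) +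
      4 * L ^ 2 / (N ^ 2 * x ^ 4)) + (-(2 * (L / x - 1) * L / x ^ 2)) * d := by
  have hxd : x / 2 ≤ x + d := by linarith [(abs_le.1 hd).1]
  have hxd0 : 0 < x + d := by linarith
  have hd2 : d ^ 2 ≤ 1 / N ^ 2 := by
    rw [← sq_abs, ← one_div_pow]; gcongr
  set u := L / x - 1 with hu
  have e1 : L / (x + d) - 1 = u - L * d / (x * (x + d)) := by
    rw [hu]; field_simp; ring
  have e2 : (L / (x + d) - 1) ^ 2 = u ^ 2 + (-(2 * u * L / x ^ 2)) * d +
      2 * u * (L * d ^ 2 / (x ^ 2 * (x + d))) + L ^ 2 * d ^ 2 / (x ^ 2 * (x + d) ^ 2) := by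
    rw [e1]; field_simp; ring
  have b0 : 1 / (x + d) ≤ 2 / x := by
    rw [div_le_div_iff₀ hxd0 hx]; linarith
  have b1 : L * d ^ 2 / (x ^ 2 * (x + d)) ≤ 2 * L / (N ^ 2 * x ^ 3) := by
    calc L * d ^ 2 / (x ^ 2 * (x + d)) = L / x ^ 2 * d ^ 2 * (1 / (x + d)) := by field_simp
      _ ≤ L / x ^ 2 * (1 / N ^ 2) * (2 / x) := by gcongr
      _ = _ := by field_simp
  have b2 : L ^ 2 * d ^ 2 / (x ^ 2 * (x + d) ^ 2) ≤ 4 * L ^ 2 / (N ^ 2 * x ^ 4) := by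
    calc L ^ 2 * d ^ 2 / (x ^ 2 * (x + d) ^ 2) = L ^ 2 / x ^ 2 * d ^ 2 * (1 / (x + d)) ^ 2 := by
          field_simp
      _ ≤ L ^ 2 / x ^ 2 * (1 / N ^ 2) * (2 / x) ^ 2 := by gcongr
      _ = _ := by field_simp; norm_num
  have b3 : 2 * u * (L * d ^ 2 / (x ^ 2 * (x + d))) ≤ 4 * |u| * L / (N ^ 2 * x ^ 3) := by
    calc 2 * u * (L * d ^ 2 / (x ^ 2 * (x + d))) ≤ 2 * |u| * (2 * L / (N ^ 2 * x ^ 3)) := by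
          have h0 : 0 ≤ L * d ^ 2 / (x ^ 2 * (x + d)) := by positivity
          have := le_abs_self u
          calc _ ≤ 2 * |u| * (L * d ^ 2 / (x ^ 2 * (x + d))) := by gcongr
            _ ≤ _ := by gcongr
      _ = _ := by ring
  rw [e2]
  linarith

/-- For `x ≤ L / 2` the ratio `u` is at least 1 and all errors are absorbed by `lam * L / N * u ^
2`, in shares 1/6, 1/3 and 1/3. For larger `x` one has `|u| ≤ 1`, and the additive term takes the
errors. -/
lemma ratio_error_le {L x N ε lam γ : ℝ} (hL : 0 < L) (hN : 0 < N) (hx : 0 < x)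
    (hlam : 0 < lam) (hγx : γ ^ 2 ≤ 4 * N * x ^ 2) (hγ : 192 / (lam * L) ≤ γ ^ 2) (hε : 0 ≤ ε)
    (hεx : ε ≤ lam * L / 12 * x) :
    4 * |L / x - 1| * L / (N ^ 2 * x ^ 3) + 4 * L ^ 2 / (N ^ 2 * x ^ 4) +
      2 * |L / x - 1| * L / x ^ 2 * (ε / N) ≤
      lam * L / N * (L / x - 1) ^ 2 + (8 * ε / L + 96 / (L ^ 2 * N)) / N := by
  set u := L / x - 1 with hu
  have hlL : 0 < lam * L := by positivity
  rcases le_or_gt x (L / 2) with hxL | hxL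
  · have hLx : 2 ≤ L / x := by rw [le_div_iff₀ hx]; linarith
    have hu1 : 1 ≤ u := by rw [hu]; linarith
    have hu0 : 0 < u := by linarith
    have hLu : L ≤ 2 * u * x := by
      have : L = (u + 1) * x := by rw [hu]; field_simp; ring
      nlinarith
    rw [abs_of_pos hu0]
    -- The 192 in the lower bound for `γ ^ 2` is 4 · 48: the 4 comes from `x ≥ γ / (2√N)`, the 48
    -- yields the shares below.
    have hNx : 1 / (N * x ^ 2) ≤ lam * L / 48 := by
      rw [div_le_iff₀ (by positivity)]
      rw [div_le_iff₀ hlL] at hγ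
      nlinarith
    have b1 : 4 * u * L / (N ^ 2 * x ^ 3) ≤ lam * L / (6 * N) * u ^ 2 := by
      calc 4 * u * L / (N ^ 2 * x ^ 3) ≤ 4 * u * (2 * u * x) / (N ^ 2 * x ^ 3) := by gcongr
        _ = 8 * u ^ 2 / N * (1 / (N * x ^ 2)) := by field_simp; norm_num
        _ ≤ 8 * u ^ 2 / N * (lam * L / 48) := by gcongr
        _ = _ := by field_simp; norm_num
    have b2 : 4 * L ^ 2 / (N ^ 2 * x ^ 4) ≤ lam * L / (3 * N) * u ^ 2 := by
      calc 4 * L ^ 2 / (N ^ 2 * x ^ 4) ≤ 4 * (2 * u * x) ^ 2 / (N ^ 2 * x ^ 4) := by gcongr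
        _ = 16 * u ^ 2 / N * (1 / (N * x ^ 2)) := by field_simp; norm_num
        _ ≤ 16 * u ^ 2 / N * (lam * L / 48) := by gcongr
        _ = _ := by field_simp; norm_num
    have b3 : 2 * u * L / x ^ 2 * (ε / N) ≤ lam * L / (3 * N) * u ^ 2 := by
      calc 2 * u * L / x ^ 2 * (ε / N) ≤ 2 * u * (2 * u * x) / x ^ 2 * (lam * L / 12 * x / N) := by
            gcongr
        _ = _ := by field_simp; norm_num
    have b4 : 0 ≤ (8 * ε / L + 96 / (L ^ 2 * N)) / N := by positivity
    have b5 : lam * L / (6 * N) * u ^ 2 + lam * L / (3 * N) * u ^ 2 + lam * L / (3 * N) * u ^ 2 ≤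
        lam * L / N * u ^ 2 := by
      have : 0 ≤ lam * L / N * u ^ 2 := by positivity
      have e : lam * L / (6 * N) * u ^ 2 + lam * L / (3 * N) * u ^ 2 + lam * L / (3 * N) * u ^ 2 =
        5 / 6 * (lam * L / N * u ^ 2) := by field_simp; norm_num
      linarith
    linarith
  · have hu1 : |u| ≤ 1 := by
      rw [hu, abs_le]
      have h1 : L / x ≤ 2 := by rw [div_le_iff₀ hx]; linarith
      have h2 : 0 < L / x := by positivity
      constructor <;> linarith
    have hx2 : 1 / x ≤ 2 / L := by rw [div_le_div_iff₀ hx hL]; linarith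
    have b1 : 4 * |u| * L / (N ^ 2 * x ^ 3) ≤ 32 / (L ^ 2 * N ^ 2) := by
      calc 4 * |u| * L / (N ^ 2 * x ^ 3) = 4 * |u| * L / N ^ 2 * (1 / x) ^ 3 := by field_simp
        _ ≤ 4 * 1 * L / N ^ 2 * (2 / L) ^ 3 := by gcongr
        _ = _ := by field_simp; norm_num
    have b2 : 4 * L ^ 2 / (N ^ 2 * x ^ 4) ≤ 64 / (L ^ 2 * N ^ 2) := by
      calc 4 * L ^ 2 / (N ^ 2 * x ^ 4) = 4 * L ^ 2 / N ^ 2 * (1 / x) ^ 4 := by field_simp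
        _ ≤ 4 * L ^ 2 / N ^ 2 * (2 / L) ^ 4 := by gcongr
        _ = _ := by field_simp; norm_num
    have b3 : 2 * |u| * L / x ^ 2 * (ε / N) ≤ 8 * ε / (L * N) := by
      calc 2 * |u| * L / x ^ 2 * (ε / N) = 2 * |u| * L * (1 / x) ^ 2 * (ε / N) := by field_simp
        _ ≤ 2 * 1 * L * (2 / L) ^ 2 * (ε / N) := by gcongr
        _ = _ := by field_simp; ring
    have b4 : 0 ≤ lam * L / N * u ^ 2 := by positivity
    have e : (8 * ε / L + 96 / (L ^ 2 * N)) / N =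
      32 / (L ^ 2 * N ^ 2) + 64 / (L ^ 2 * N ^ 2) + 8 * ε / (L * N) := by
      field_simp; ring
    linarith

/-- The ratio of the distances to the attracting and the repelling point contracts. -/
lemma stepE_sq_ratio_le [NeZero n] [NeZero q] {s c p lam : ℝ} (ht : IsTarget q β s c p lam)
    {γ ε : ℝ} (hγ : 192 / (lam * (s * (p - c))) ≤ γ ^ 2) (k : Fin q) (σ : Config n q)
    (hε : |n * meanInc n q β σ k - drift q β (proportions σ k)| ≤ ε)
    (hx : 0 < s * (proportions σ k - c))
    (hnx : 1 / (n : ℝ) ≤ s * (proportions σ k - c) / 2)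
    (hγx : γ ^ 2 ≤ 4 * n * (s * (proportions σ k - c)) ^ 2)
    (hεx : ε ≤ lam * (s * (p - c)) / 12 * (s * (proportions σ k - c))) :
    stepE n q β (fun τ => (s * (p - c) / (s * (proportions τ k - c)) - 1) ^ 2) σ ≤
      (1 - lam * (s * (p - c)) / n) * (s * (p - c) / (s * (proportions σ k - c)) - 1) ^ 2 +
        (8 * ε / (s * (p - c)) + 96 / ((s * (p - c)) ^ 2 * n)) / n := by
  have hn : (0 : ℝ) < n := by exact_mod_cast Nat.pos_of_ne_zero (NeZero.ne n)
  have hss : s * s = 1 := by rcases ht.sign with h | h <;> rw [h] <;> norm_num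
  have habs : |s| = 1 := by rcases ht.sign with h | h <;> rw [h] <;> simp
  set m := proportions σ k with hm
  set x := s * (m - c) with hxdef
  set L := s * (p - c) with hL
  have hL0 : 0 < L := ht.dist_pos
  have hε0 : 0 ≤ ε := (abs_nonneg _).trans hε
  set u := L / x - 1 with hu
  have h1 : stepE n q β (fun τ => (L / (s * (proportions τ k - c)) - 1) ^ 2) σ ≤
      (u ^ 2 + 4 * |u| * L / ((n : ℝ) ^ 2 * x ^ 3) + 4 * L ^ 2 / ((n : ℝ) ^ 2 * x ^ 4)) +
        (-(2 * u * L / x ^ 2) * s) * meanInc n q β σ k := by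
    refine stepE_le_of_affine fun v l => ?_
    have h2 := sq_ratio_increment_le (d := s * (proportions (Function.update σ v l) k - m))
      hL0 hn hx hnx (by
        rw [abs_mul, habs, one_mul]; exact abs_proportions_update_sub_le σ v l k)
    have e : s * (proportions (Function.update σ v l) k - c) =
      x + s * (proportions (Function.update σ v l) k - m) := by rw [hxdef]; ring
    rw [e]
    refine h2.trans (le_of_eq ?_)
    ring
  have hm01 : m ∈ Set.Icc (0 : ℝ) 1 := ⟨proportions_nonneg σ k, proportions_le_one σ k⟩
  -- The logistic lower bound on the drift, in terms of `u`. It makes `u ^ 2` contract at rate `2 *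
  -- lam * L / n`, half of which is spent on the errors.
  have h3 : lam * x ^ 2 * u ^ 2 ≤ u * (s * drift q β m) := by
    have h4 := ht.drift_le m hm01 hx.le
    have hpm : p - m = s * (x * u) := by
      have : x * u = L - x := by rw [hu]; field_simp
      rw [this, hL, hxdef]; linear_combination (m - p) * hss
    rw [hpm, ← hxdef] at h4
    have e : (s * (x * u)) ^ 2 = (x * u) ^ 2 := by linear_combination (x * u) ^ 2 * hss
    rw [e] at h4
    refine le_of_mul_le_mul_left ?_ hx
    linarith
  have h5 : (-(2 * u * L / x ^ 2) * s) * meanInc n q β σ k ≤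
      -(2 * lam * L / n) * u ^ 2 + 2 * |u| * L / x ^ 2 * (ε / n) := by
    have e : (-(2 * u * L / x ^ 2) * s) * meanInc n q β σ k =
        -(2 * L / (x ^ 2 * n)) * (u * (s * drift q β m)) +
        2 * L / (x ^ 2 * n) * (-(u * (s * (n * meanInc n q β σ k - drift q β m)))) := by
      field_simp; ring
    rw [e]
    have h6 : -(u * (s * (n * meanInc n q β σ k - drift q β m))) ≤ |u| * ε := by
      refine (neg_le_abs _).trans ?_
      rw [abs_mul, abs_mul, habs, one_mul]
      gcongr
    have h7 : 2 * L / (x ^ 2 * n) * (lam * x ^ 2 * u ^ 2) ≤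
        2 * L / (x ^ 2 * n) * (u * (s * drift q β m)) := by gcongr
    have h8 : 2 * L / (x ^ 2 * n) * (-(u * (s * (n * meanInc n q β σ k - drift q β m)))) ≤
        2 * L / (x ^ 2 * n) * (|u| * ε) := by gcongr
    have e2 : 2 * L / (x ^ 2 * n) * (lam * x ^ 2 * u ^ 2) = 2 * lam * L / n * u ^ 2 := by
      field_simp
    have e3 : 2 * L / (x ^ 2 * n) * (|u| * ε) = 2 * |u| * L / x ^ 2 * (ε / n) := by
      field_simp
    linarith
  have h9 := ratio_error_le (γ := γ) hL0 hn hx ht.lam_pos hγx hγ hε0 hεx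
  rw [← hu] at h9
  have e4 : (1 - lam * L / n) * u ^ 2 = u ^ 2 - 2 * lam * L / n * u ^ 2 + lam * L / n * u ^ 2 := by
    ring
  rw [e4]
  linarith

/-- The squared distance to the target, in the direction of the axis and transversally. -/
def targetDist (k : Fin q) (p : ℝ) (σ : Config n q) : ℝ :=
  (proportions σ k - p) ^ 2 + trans k (proportions σ)

/-- The drift never pushes `m` away from `p` here. The error it suffers from the transverse
deviation is proportional to `r₀ * trans`, so for small `r₀` the transverse contraction pays for it.
Only terms of order 1/n² remain, and n log n steps add up to o(1). -/
lemma stepE_targetDist_le [NeZero n] [NeZero q] (hq : 1 < q) (hβ : 0 ≤ β) {s c p lam : ℝ}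
    (ht : IsTarget q β s c p lam)
    {r r₀ : ℝ} (hr : 0 < r) (hrq : 2 * β * r < q) (hr₀ : 0 < r₀) (hr₀r : r₀ ≤ r)
    (hr₀L : r₀ ≤ s * (p - c)) (hr₀1 : r₀ ≤ 1)
    (hr₀C : (β ^ 2 + 2 * β) * Real.exp (2 * β) * r₀ ≤
      1 - β * Real.exp (β * r) / (q - 2 * β * r))
    (k : Fin q) (σ : Config n q) (hσ : targetDist k p σ < r₀ ^ 2) :
    stepE n q β (targetDist k p) σ ≤ targetDist k p σ +
      (1 + 2 * ((β ^ 2 + 2 * β) * Real.exp (2 * β)) +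
        (4 * q + 4 * q * β * Real.exp (2 * β))) / n ^ 2 := by
  have hn : (0 : ℝ) < n := by exact_mod_cast Nat.pos_of_ne_zero (NeZero.ne n)
  have habs : |s| = 1 := by rcases ht.sign with h | h <;> rw [h] <;> simp
  have hT := trans_nonneg k (proportions σ)
  set m := proportions σ k with hm
  set T := trans k (proportions σ) with hTdef
  set C := (β ^ 2 + 2 * β) * Real.exp (2 * β) with hC
  have hC0 : 0 ≤ C := by positivity
  have hσ' : (m - p) ^ 2 + T < r₀ ^ 2 := hσ
  have hmp : |m - p| ≤ r₀ := by
    refine abs_le_of_sq_le_sq ?_ hr₀.le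
    linarith
  have hTr : T ≤ r ^ 2 := by
    have : r₀ ^ 2 ≤ r ^ 2 := by gcongr
    nlinarith [sq_nonneg (m - p)]
  have hmq : 1 / (q : ℝ) - r ≤ m := by linarith [(abs_le.1 hmp).1, ht.one_div_le]
  have hm01 : m ∈ Set.Icc (0 : ℝ) 1 := ⟨proportions_nonneg σ k, proportions_le_one σ k⟩
  have hx : 0 ≤ s * (m - c) := by
    have e : s * (m - c) = s * (p - c) + s * (m - p) := by ring
    have : |s * (m - p)| ≤ r₀ := by rw [abs_mul, habs, one_mul]; exact hmp
    linarith [(abs_le.1 this).1]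
  have h1 : (m - p) * drift q β m ≤ 0 := by
    have h2 := ht.drift_le m hm01 hx
    have : 0 ≤ lam * (s * (m - c)) * (p - m) ^ 2 := by
      have := ht.lam_pos
      positivity
    linarith
  have h3 : stepE n q β (fun τ => (proportions τ k - p) ^ 2) σ ≤
      ((m - p) ^ 2 + (1 / n) ^ 2) + (2 * (m - p)) * meanInc n q β σ k := by
    refine stepE_le_of_affine fun v l => ?_
    have h4 := abs_proportions_update_sub_le σ v l k
    have h5 : (proportions (Function.update σ v l) k - m) ^ 2 ≤ (1 / n) ^ 2 := by
      rw [← sq_abs]; gcongr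
    nlinarith
  have h6 := stepE_trans_le hq hβ k σ hr.le hrq hmq hTr
  have h7 : stepE n q β (targetDist k p) σ =
      stepE n q β (fun τ => (proportions τ k - p) ^ 2) σ +
      stepE n q β (fun τ => trans k (proportions τ)) σ := stepE_add _ _ _
  have h8 := abs_meanInc_sub_drift_le hq hβ σ k
  have h9 : (m - p) * (n * meanInc n q β σ k) ≤ r₀ * C * T + C / n := by
    have h10 : (m - p) * (n * meanInc n q β σ k - drift q β m) ≤ r₀ * (C * (T + 1 / n)) := by
      refine (le_abs_self _).trans ?_
      rw [abs_mul]
      gcongr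
    have h11 : r₀ * (C / n) ≤ 1 * (C / n) := by gcongr
    have e : r₀ * (C * (T + 1 / n)) = r₀ * C * T + r₀ * (C / n) := by ring
    nlinarith
  have h12 : (2 * (m - p)) * meanInc n q β σ k ≤ 2 / n * (r₀ * C * T + C / n) := by
    have : (2 * (m - p)) * meanInc n q β σ k = 2 / n * ((m - p) * (n * meanInc n q β σ k)) := by
      field_simp
    rw [this]; gcongr
  set θ := β * Real.exp (β * r) / (q - 2 * β * r)
  have h13 : 2 / n * (r₀ * C * T) ≤ 2 * (1 - θ) / n * T := by
    have : 2 / n * (r₀ * C * T) = 2 * (C * r₀) / n * T := by ring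
    rw [this]; gcongr
  rw [h7]
  have e : targetDist k p σ + (1 + 2 * C + (4 * q + 4 * q * β * Real.exp (2 * β))) / n ^ 2 =
    ((m - p) ^ 2 + (1 / n) ^ 2) + 2 / n * (C / n) +
      (T + (4 * q + 4 * q * β * Real.exp (2 * β)) / n ^ 2) := by
    simp only [targetDist]; rw [← hm, ← hTdef]; field_simp; ring
  rw [e]
  linarith

/-! ### Coupling near the target -/

/-- A bound for the probability of leaving the `r`-neighbourhood of the target within `t` steps. -/
def exitBound (k : Fin q) (p r C : ℝ) (t : ℕ) (σ : Config n q) : ℝ :=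
  min 1 ((targetDist k p σ + C * t / n ^ 2) / r ^ 2)

lemma targetDist_nonneg (k : Fin q) (p : ℝ) (σ : Config n q) : 0 ≤ targetDist k p σ :=
  add_nonneg (sq_nonneg _) (trans_nonneg _ _)

lemma exitBound_nonneg (k : Fin q) (p r : ℝ) {C : ℝ} (hC : 0 ≤ C) (t : ℕ) (σ : Config n q) :
    0 ≤ exitBound k p r C t σ := by
  have := targetDist_nonneg k p σ
  exact le_min zero_le_one (by positivity)

/-- The allowance `C * t / n ^ 2` pays for the growth of the squared distance inside the
neighbourhood. Outside it the bound is already 1. -/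
lemma stepE_exitBound_le [NeZero n] [NeZero q] {k : Fin q} {p r C : ℝ} (hC : 0 ≤ C) (hr : 0 < r)
    (h : ∀ σ : Config n q, targetDist k p σ < r ^ 2 →
      stepE n q β (targetDist k p) σ ≤ targetDist k p σ + C / n ^ 2) (t : ℕ) (σ : Config n q) :
    stepE n q β (exitBound k p r C t) σ ≤ exitBound k p r C (t + 1) σ := by
  have hone : stepE n q β (exitBound k p r C t) σ ≤ 1 :=
    stepE_le_of_le fun _ _ => min_le_left _ _
  refine le_min hone ?_
  by_cases hσ : targetDist k p σ < r ^ 2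
  · have h1 : stepE n q β (exitBound k p r C t) σ ≤
        stepE n q β (fun τ => C * t / n ^ 2 / r ^ 2 + 1 / r ^ 2 * targetDist k p τ) σ :=
      stepE_mono_at fun v l => (min_le_right _ _).trans (le_of_eq (by ring))
    rw [stepE_add (fun _ => _), stepE_const, stepE_const_mul] at h1
    refine h1.trans ?_
    have h2 : 1 / r ^ 2 * stepE n q β (targetDist k p) σ ≤
        1 / r ^ 2 * (targetDist k p σ + C / n ^ 2) := by
      have := h σ hσ
      gcongr
    push_cast
    calc _ ≤ C * t / n ^ 2 / r ^ 2 + 1 / r ^ 2 * (targetDist k p σ + C / n ^ 2) := by linarith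
      _ = _ := by ring
  · refine hone.trans ?_
    rw [one_le_div (by positivity)]
    have : 0 ≤ C * ((t + 1 : ℕ) : ℝ) / (n : ℝ) ^ 2 := by positivity
    linarith [not_lt.1 hσ]

lemma abs_othersProp_sub_lt (hq : 1 < q) {k : Fin q} {p r ε : ℝ} (hr : 0 < r)
    (hrε : 2 * r + 1 / n < ε) {σ : Config n q} (hσ : targetDist k p σ < r ^ 2) (v : Fin n)
    (i : Fin q) : |othersProp σ v i - dominated k p i| < ε := by
  have hq' : (2 : ℝ) ≤ q := by exact_mod_cast hq
  have hσ' : (proportions σ k - p) ^ 2 + trans k (proportions σ) < r ^ 2 := hσ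
  have h1 : |proportions σ k - p| ≤ r := by
    refine abs_le_of_sq_le_sq ?_ hr.le
    linarith [trans_nonneg k (proportions σ)]
  have h2 : |proportions σ i - dominated k (proportions σ k) i| ≤ r := by
    refine abs_le_of_sq_le_sq ?_ hr.le
    linarith [sq_le_trans k (proportions σ) i, sq_nonneg (proportions σ k - p)]
  have h3 : |dominated k (proportions σ k) i - dominated k p i| ≤ r := by
    refine le_trans ?_ h1
    by_cases hi : i = k
    · simp [dominated, hi]
    · simp only [dominated, if_neg hi, ← sub_div]
      rw [abs_div, abs_of_pos (by linarith : (0 : ℝ) < q - 1), div_le_iff₀ (by linarith),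
        show (1 - proportions σ k - (1 - p)) = -(proportions σ k - p) by ring, abs_neg]
      nlinarith [abs_nonneg (proportions σ k - p)]
  have h4 : |othersProp σ v i - proportions σ i| ≤ 1 / n := by
    rw [othersProp_eq, sub_sub_cancel_left, abs_neg, abs_div, Nat.abs_cast]
    gcongr
    split_ifs <;> simp
  have h5 := abs_sub_le (othersProp σ v i) (proportions σ i) (dominated k p i)
  have h6 := abs_sub_le (proportions σ i) (dominated k (proportions σ k) i) (dominated k p i)
  linarith

lemma sum_othersProp [NeZero n] (σ : Config n q) (v : Fin n) :
    ∑ l, othersProp σ v l = 1 - 1 / n := by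
  simp_rw [othersProp_eq]
  rw [Finset.sum_sub_distrib, sum_proportions, ← Finset.sum_div]
  simp

/-- Two chains couple as long as they stay near the target. -/
lemma exists_local_coupling (hq : 1 < q) (hβ : 0 ≤ β) (hβq : β < q) {s c p lam : ℝ}
    (ht : IsTarget q β s c p lam) :
    ∃ r > 0, ∃ κ < 1, ∃ C > 0, ∃ N₀ : ℕ, ∀ n ≥ N₀, n ≠ 0 → ∀ k : Fin q,
      (∀ t (σ : Config n q),
        stepE n q β (exitBound k p r C t) σ ≤ exitBound k p r C (t + 1) σ) ∧
      ∀ f : Config n q → ℝ, (∀ τ, f τ ∈ Set.Icc (0 : ℝ) 1) → ∀ t σ τ,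
        (stepE n q β)^[t] f σ - (stepE n q β)^[t] f τ ≤
          (1 - (1 - κ) / n) ^ t * n + exitBound k p r C t σ + exitBound k p r C t τ := by
  have hq0 : (0 : ℝ) < q := by exact_mod_cast (zero_lt_one.trans hq)
  have : NeZero q := ⟨by omega⟩
  obtain ⟨r₁, hr₁, hr₁q, hθ⟩ := exists_radius_trans hβ hβq
  obtain ⟨κ, hκ0, hκ1⟩ := exists_between ht.slope_lt
  have hκnn : 0 ≤ κ := by
    refine le_trans ?_ hκ0.le
    have h1 : 0 ≤ p := le_trans (by positivity) ht.one_div_le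
    have h2 : 0 ≤ 1 - p := by linarith [ht.le_one]
    have h3 : (0 : ℝ) ≤ q - 1 := by
      have : (1 : ℝ) < q := by exact_mod_cast hq
      linarith
    positivity
  obtain ⟨ε, hε, hcontr⟩ := exists_softmax_contraction hq hβ ht.one_div_le ht.le_one ht.fixed hκ0
  set C₀ := (β ^ 2 + 2 * β) * Real.exp (2 * β) with hC₀
  have hC₀nn : 0 ≤ C₀ := by positivity
  -- The neighbourhood must lie in the transverse contraction region, on the target's side of `c`,
  -- within the softmax contraction ball, and be small enough for the cross term in
  -- `stepE_targetDist_le`.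
  set r := min (min r₁ (s * (p - c))) (min (min 1 (ε / 4))
    ((1 - β * Real.exp (β * r₁) / (q - 2 * β * r₁)) / (C₀ + 1))) with hr
  have hr0 : 0 < r := by
    refine lt_min (lt_min hr₁ ht.dist_pos) (lt_min (lt_min one_pos (by positivity)) ?_)
    exact div_pos (by linarith) (by positivity)
  have hrr₁ : r ≤ r₁ := (min_le_left _ _).trans (min_le_left _ _)
  have hrL : r ≤ s * (p - c) := (min_le_left _ _).trans (min_le_right _ _)
  have hr1 : r ≤ 1 := (min_le_right _ _).trans ((min_le_left _ _).trans (min_le_left _ _))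
  have hrε : r ≤ ε / 4 := (min_le_right _ _).trans ((min_le_left _ _).trans (min_le_right _ _))
  have hrC : C₀ * r ≤ 1 - β * Real.exp (β * r₁) / (q - 2 * β * r₁) := by
    have h1 : r ≤ (1 - β * Real.exp (β * r₁) / (q - 2 * β * r₁)) / (C₀ + 1) :=
      (min_le_right _ _).trans (min_le_right _ _)
    rw [le_div_iff₀ (by positivity)] at h1
    nlinarith
  set C := 1 + 2 * C₀ + (4 * q + 4 * q * β * Real.exp (2 * β)) with hC
  have hC0 : 0 < C := by positivity
  obtain ⟨N₀, hN₀⟩ := exists_nat_gt (2 / ε)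
  refine ⟨r, hr0, κ, hκ1, C, hC0, N₀, fun n hn hn0 k => ?_⟩
  have : NeZero n := ⟨hn0⟩
  have hnpos : (0 : ℝ) < n := by exact_mod_cast Nat.pos_of_ne_zero hn0
  have hstep : ∀ t (σ : Config n q),
      stepE n q β (exitBound k p r C t) σ ≤ exitBound k p r C (t + 1) σ :=
    stepE_exitBound_le hC0.le hr0 fun σ hσ =>
      stepE_targetDist_le hq hβ ht hr₁ hr₁q hr0 hrr₁ hrL hr1 hrC k σ hσ
  refine ⟨hstep, fun f hf t σ τ => ?_⟩
  have hnε : 2 * r + 1 / (n : ℝ) < ε := by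
    have : (2 / ε) < n := hN₀.trans_le (by exact_mod_cast hn)
    rw [div_lt_iff₀ hε] at this
    have : 1 / (n : ℝ) < ε / 2 := by rw [div_lt_iff₀ hnpos]; linarith
    linarith
  have hmain := iterate_stepE_sub_le (β := β) (U := {σ : Config n q | targetDist k p σ < r ^ 2})
    (G := exitBound k p r C) hκnn ?_ (fun t σ => exitBound_nonneg k p r hC0.le t σ) ?_ hstep hf t σ τ
  · have hH : (hammingDist σ τ : ℝ) ≤ n := by
      have := hammingDist_le_card_fintype (x := σ) (y := τ)
      rw [Fintype.card_fin] at this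
      exact_mod_cast this
    have hρ : 0 ≤ 1 - (1 - κ) / (n : ℝ) := by
      have : (1 : ℝ) ≤ n := by exact_mod_cast Nat.pos_of_ne_zero hn0
      rw [sub_nonneg, div_le_one hnpos]; linarith
    have : (1 - (1 - κ) / (n : ℝ)) ^ t * hammingDist σ τ ≤ (1 - (1 - κ) / (n : ℝ)) ^ t * n := by
      gcongr
    linarith
  · intro σ hσ τ hτ v
    simp_rw [resampleProb_eq_softmax]
    have h1 := hcontr k (othersProp σ v) (othersProp τ v)
      (abs_othersProp_sub_lt hq hr0 hnε hσ v) (abs_othersProp_sub_lt hq hr0 hnε hτ v)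
      ((sum_othersProp σ v).trans (sum_othersProp τ v).symm)
    have h2 := mul_le_mul_of_nonneg_left (sum_abs_othersProp_sub_le σ τ v) hκnn
    calc _ ≤ (κ * (2 * (hammingDist σ τ : ℝ) / n)) / 2 := by linarith
      _ = _ := by ring
  · intro t σ hσ
    refine le_min le_rfl ?_
    rw [one_le_div (by positivity)]
    have h1 : r ^ 2 ≤ targetDist k p σ := not_lt.1 hσ
    have : 0 ≤ C * (t : ℝ) / (n : ℝ) ^ 2 := by positivity
    linarith

/-! ### Escape from the repelling point -/

/-- The supersolution controlling the way from the repelling point to the target. -/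
def escapeBound (n : ℕ) {q : ℕ} (k : Fin q) (s c p r a b γ η D W : ℝ) (K : ℕ → ℝ) (t : ℕ)
    (σ : Config n q) : ℝ :=
  (((Real.exp (a * γ ^ 2 / 4) *
      Real.exp (-(a * n * (max (s * (proportions σ k - c)) 0) ^ 2)) +
    Real.exp (-(b * n * (proportions σ k - 1 / q + r)))) +
    1 / η * trans k (proportions σ)) +
    D * W ^ t * (s * (p - c) / (s * (proportions σ k - c)) - 1) ^ 2) + K t

lemma iterate_stepE_le_escapeBound [NeZero n] [NeZero q] (hq : 1 < q) (hβ : 0 ≤ β)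
    {s c p lam : ℝ} (ht : IsTarget q β s c p lam)
    {d r a b γ η r₀ Bg ε B : ℝ} (hd0 : 0 < d)
    (hd : ∀ m ∈ Set.Icc (0 : ℝ) (1 / q), d * (1 / q - m) ≤ drift q β m)
    (hr : 0 < r) (hrq : 2 * β * r < q) (hθ : β * Real.exp (β * r) / (q - 2 * β * r) < 1)
    (ha : 0 < a) (ha1 : 2 * a ≤ 1) (ha2 : a ≤ lam * (s * (p - c)) / 8)
    (hb : 0 < b) (hb1 : b ≤ 1) (hb2 : b ≤ d * r / 4) (hγ0 : 0 < γ)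
    (hγ : 192 / (lam * (s * (p - c))) ≤ γ ^ 2) (hη : 0 < η) (hηr : η ≤ r ^ 2)
    (hr₀ : 0 < r₀) (hBg : 0 ≤ Bg)
    (hε : ε = (β ^ 2 + 2 * β) * Real.exp (2 * β) * (η + 1 / n))
    (hεγ : ε ≤ lam * (s * (p - c)) / 12 * (γ / (2 * √n))) (hεd : ε ≤ d * r / 4)
    (hnγ : 1 / (n : ℝ) ≤ γ / (2 * √n) / 2) (hln : lam * (s * (p - c)) ≤ n)
    (hB : B = (8 * ε / (s * (p - c)) + 96 / ((s * (p - c)) ^ 2 * n)) / (lam * (s * (p - c))))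
    (k : Fin q) {g : Config n q → ℝ} (hg : ∀ τ, g τ ∈ Set.Icc (0 : ℝ) 1)
    (hgd : ∀ τ, g τ ≤ (targetDist k p τ + Bg) / r₀ ^ 2) (t : ℕ) (σ : Config n q) :
    (stepE n q β)^[t] g σ ≤ escapeBound n k s c p r a b γ η (1 / r₀ ^ 2)
      (1 - lam * (s * (p - c)) / n) (fun t =>
        t * (Real.exp (a * γ ^ 2 / 4) * (Real.exp 1 *
          Real.exp (-(a * n * (s * (p - c)) ^ 2 / 4))) +
          Real.exp 1 * Real.exp (-(b * n * r / 2))) +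
        (4 * q + 4 * q * β * Real.exp (2 * β)) * t / n ^ 2 / η +
        ((1 - (1 - lam * (s * (p - c)) / n) ^ t) * B + η + Bg) / r₀ ^ 2) t σ := by
  have hn : (0 : ℝ) < n := by exact_mod_cast Nat.pos_of_ne_zero (NeZero.ne n)
  have hsn : 0 < √(n : ℝ) := Real.sqrt_pos.2 hn
  have habs : |s| = 1 := by rcases ht.sign with h | h <;> rw [h] <;> simp
  have hss : s * s = 1 := by rcases ht.sign with h | h <;> rw [h] <;> norm_num
  set L := s * (p - c) with hL
  have hL0 : 0 < L := ht.dist_pos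
  have hlL : 0 < lam * L := mul_pos ht.lam_pos hL0
  set W := 1 - lam * L / n with hW
  have hW0 : 0 ≤ W := by rw [hW, sub_nonneg, div_le_one hn]; exact hln
  have hW1 : W ≤ 1 := by rw [hW]; linarith [div_pos hlL hn]
  have hε0 : 0 ≤ ε := by rw [hε]; positivity
  have hB0 : 0 ≤ B := by rw [hB]; positivity
  set E := Real.exp (a * γ ^ 2 / 4) * (Real.exp 1 * Real.exp (-(a * n * L ^ 2 / 4))) +
    Real.exp 1 * Real.exp (-(b * n * r / 2)) with hE
  have hE0 : 0 ≤ E := by positivity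
  set Ct := 4 * q + 4 * q * β * Real.exp (2 * β) with hCt
  have hCt0 : 0 ≤ Ct := by positivity
  set K : ℕ → ℝ := fun t => t * E + Ct * t / n ^ 2 / η +
    ((1 - W ^ t) * B + η + Bg) / r₀ ^ 2 with hK
  have hK0 : ∀ t, 0 ≤ K t := fun t => by
    have : 0 ≤ 1 - W ^ t := sub_nonneg.2 (pow_le_one₀ hW0 hW1)
    positivity
  have hc0 : 0 ≤ c := le_trans (by positivity) ht.one_div_lt.le
  have hγn : 0 < γ / (2 * √n) := by positivity
  -- The region starts at distance `γ / (2√n)` from `c`, half the initial distance, so the Gaussian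
  -- barrier has room to gain.
  refine iterate_stepE_le_of_supersolution (R := {σ : Config n q |
    γ / (2 * √n) ≤ s * (proportions σ k - c) ∧ 1 / (q : ℝ) - r ≤ proportions σ k ∧
    trans k (proportions σ) ≤ η}) hg ?_ ?_ ?_ t σ
  · rintro τ ⟨h1, -, h3⟩
    refine (hgd τ).trans ?_
    have hx0 : 0 < s * (proportions τ k - c) := hγn.trans_le h1
    set x := s * (proportions τ k - c) with hx
    have hx1 : x ≤ 1 := by
      have : |x| ≤ 1 := by
        rw [hx, abs_mul, habs, one_mul, abs_le]
        constructor <;>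
          linarith [proportions_nonneg τ k, proportions_le_one τ k, ht.lt_one]
      exact (abs_le.1 this).2
    have hy : (proportions τ k - p) ^ 2 ≤ (L / x - 1) ^ 2 := by
      have e : (proportions τ k - p) ^ 2 = x ^ 2 * (L / x - 1) ^ 2 := by
        have e1 : x * (L / x - 1) = s * (p - proportions τ k) := by
          rw [mul_sub, mul_div_cancel₀ _ hx0.ne', hL, hx]; ring
        rw [← mul_pow, e1]
        linear_combination -(p - proportions τ k) ^ 2 * hss
      rw [e]
      refine mul_le_of_le_one_left (sq_nonneg _) ?_
      exact pow_le_one₀ hx0.le hx1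
    have hT := trans_nonneg k (proportions τ)
    have e2 : escapeBound n k s c p r a b γ η (1 / r₀ ^ 2) W K 0 τ =
        (Real.exp (a * γ ^ 2 / 4) * Real.exp (-(a * n * (max x 0) ^ 2)) +
          Real.exp (-(b * n * (proportions τ k - 1 / q + r))) +
          1 / η * trans k (proportions τ)) +
        ((L / x - 1) ^ 2 + η + Bg) / r₀ ^ 2 := by
      simp only [escapeBound, hK]
      rw [← hL, ← hx]
      simp only [pow_zero, Nat.cast_zero]
      ring
    rw [e2]
    refine le_add_of_nonneg_of_le (by positivity) ?_
    have : targetDist k p τ ≤ (L / x - 1) ^ 2 + η := add_le_add hy h3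
    gcongr
  · intro t τ hτ
    have hT := trans_nonneg k (proportions τ)
    have hlast : 0 ≤ 1 / r₀ ^ 2 * W ^ t * (L / (s * (proportions τ k - c)) - 1) ^ 2 := by
      positivity
    have hf1 : 0 ≤ Real.exp (a * γ ^ 2 / 4) *
      Real.exp (-(a * n * (max (s * (proportions τ k - c)) 0) ^ 2)) := by positivity
    have hf2 : 0 ≤ Real.exp (-(b * n * (proportions τ k - 1 / q + r))) := by positivity
    have hf3 : 0 ≤ 1 / η * trans k (proportions τ) := by positivity
    have hKt := hK0 t
    unfold escapeBound
    rw [← hL]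
    -- Each way of leaving the region makes one of the first three summands at least 1. The
    -- prefactor `exp (a * γ ^ 2 / 4)` normalizes the Gaussian barrier at distance `γ / (2√n)`.
    by_cases h1 : γ / (2 * √n) ≤ s * (proportions τ k - c)
    · by_cases h2 : 1 / (q : ℝ) - r ≤ proportions τ k
      · have h3 : η < trans k (proportions τ) := by
          by_contra h3
          exact hτ ⟨h1, h2, not_lt.1 h3⟩
        have : 1 ≤ 1 / η * trans k (proportions τ) := by
          rw [one_div, ← div_eq_inv_mul, one_le_div hη]; exact h3.le
        linarith
      · have : 1 ≤ Real.exp (-(b * n * (proportions τ k - 1 / q + r))) := by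
          apply Real.one_le_exp
          have h3 : proportions τ k - 1 / q + r ≤ 0 := by linarith [not_le.1 h2]
          have := mul_nonpos_of_nonneg_of_nonpos (mul_pos hb hn).le h3
          linarith
        linarith
    · have : 1 ≤ Real.exp (a * γ ^ 2 / 4) *
          Real.exp (-(a * n * (max (s * (proportions τ k - c)) 0) ^ 2)) := by
        rw [← Real.exp_add]
        apply Real.one_le_exp
        have h2 : max (s * (proportions τ k - c)) 0 ≤ γ / (2 * √n) :=
          max_le (not_le.1 h1).le hγn.le
        have h3 : (max (s * (proportions τ k - c)) 0) ^ 2 ≤ (γ / (2 * √n)) ^ 2 := by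
          gcongr
        have h4 : a * n * (γ / (2 * √n)) ^ 2 = a * γ ^ 2 / 4 := by
          rw [div_pow, mul_pow, Real.sq_sqrt hn.le]; field_simp; norm_num
        have := mul_le_mul_of_nonneg_left h3 (mul_pos ha hn).le
        linarith
      linarith
  · rintro t τ ⟨h1, h2, h3⟩
    set m := proportions τ k with hm
    set x := s * (m - c) with hx
    have hx0 : 0 < x := hγn.trans_le h1
    have hdr : |n * meanInc n q β τ k - drift q β m| ≤ ε := by
      refine (abs_meanInc_sub_drift_le hq hβ τ k).trans ?_
      rw [hε]; gcongr
    have hεx : ε ≤ lam * L / 12 * x := hεγ.trans (by gcongr)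
    have hnx : 1 / (n : ℝ) ≤ x / 2 := hnγ.trans (by gcongr)
    have hγx : γ ^ 2 ≤ 4 * n * x ^ 2 := by
      have : (γ / (2 * √n)) ^ 2 ≤ x ^ 2 := by gcongr
      rw [div_pow, mul_pow, Real.sq_sqrt hn.le, div_le_iff₀ (by positivity)] at this
      linarith
    have g1 := stepE_exp_neg_sq_le ht ha ha1 ha2 k τ hdr hx0.le (hεx.trans (by
      have : 0 < lam * L * x := by positivity
      linarith))
    have g1' : stepE n q β (fun ρ => Real.exp (-(a * n *
        (max (s * (proportions ρ k - c)) 0) ^ 2))) τ ≤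
        stepE n q β (fun ρ => Real.exp (-(a * n * (s * (proportions ρ k - c)) ^ 2))) τ := by
      refine stepE_mono_at fun v l => ?_
      rw [max_eq_left]
      have e : s * (proportions (Function.update τ v l) k - c) =
        x + s * (proportions (Function.update τ v l) k - m) := by rw [hx]; ring
      have h4 : |s * (proportions (Function.update τ v l) k - m)| ≤ 1 / n := by
        rw [abs_mul, habs, one_mul]; exact abs_proportions_update_sub_le τ v l k
      rw [e]
      linarith [(abs_le.1 h4).1]
    have g2 := stepE_exp_neg_le hd hd0 hr hb hb1 hb2 k τ hdr hεd
    have g3 := stepE_trans_le hq hβ k τ hr.le hrq h2 (h3.trans hηr)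
    have g4 := stepE_sq_ratio_le ht hγ k τ hdr hx0 hnx hγx hεx
    rw [← hL, ← hm, ← hx] at g4
    rw [← hm, ← hx, ← hL] at g1
    rw [← hm] at g2
    have hT := trans_nonneg k (proportions τ)
    have g3' : stepE n q β (fun ρ => trans k (proportions ρ)) τ ≤
        trans k (proportions τ) + Ct / n ^ 2 := by
      have : 0 ≤ 2 * (1 - β * Real.exp (β * r) / (q - 2 * β * r)) / n *
          trans k (proportions τ) := by
        have : 0 ≤ 1 - β * Real.exp (β * r) / (q - 2 * β * r) := by linarith
        positivity
      linarith
    -- `B` is the fixed point of the affine recursion for the squared ratio. This explains the term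
    -- `(1 - W ^ t) * B` in `K`.
    have g4' : stepE n q β (fun ρ => (L / (s * (proportions ρ k - c)) - 1) ^ 2) τ ≤
        W * (L / x - 1) ^ 2 + (1 - W) * B := by
      refine g4.trans (le_of_eq ?_)
      have := ht.lam_pos.ne'
      rw [hB, hW]; field_simp; ring
    have hcalc : stepE n q β (escapeBound n k s c p r a b γ η (1 / r₀ ^ 2) W K t) τ =
        (((Real.exp (a * γ ^ 2 / 4) * stepE n q β (fun ρ => Real.exp (-(a * n *
          (max (s * (proportions ρ k - c)) 0) ^ 2))) τ +
        stepE n q β (fun ρ => Real.exp (-(b * n * (proportions ρ k - 1 / q + r)))) τ) +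
        1 / η * stepE n q β (fun ρ => trans k (proportions ρ)) τ) +
        1 / r₀ ^ 2 * W ^ t *
          stepE n q β (fun ρ => (L / (s * (proportions ρ k - c)) - 1) ^ 2) τ) + K t := by
      unfold escapeBound
      rw [stepE_add _ (fun _ => K t), stepE_const, stepE_add, stepE_add, stepE_add,
        stepE_const_mul, stepE_const_mul, stepE_const_mul]
    rw [hcalc]
    have i1 : Real.exp (a * γ ^ 2 / 4) * stepE n q β (fun ρ => Real.exp (-(a * n *
          (max (s * (proportions ρ k - c)) 0) ^ 2))) τ ≤
        Real.exp (a * γ ^ 2 / 4) * (Real.exp (-(a * n * x ^ 2)) +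
          Real.exp 1 * Real.exp (-(a * n * L ^ 2 / 4))) := by
      gcongr; exact g1'.trans g1
    have i3 : 1 / η * stepE n q β (fun ρ => trans k (proportions ρ)) τ ≤
        1 / η * (trans k (proportions τ) + Ct / n ^ 2) := by gcongr
    have i4 : 1 / r₀ ^ 2 * W ^ t *
          stepE n q β (fun ρ => (L / (s * (proportions ρ k - c)) - 1) ^ 2) τ ≤
        1 / r₀ ^ 2 * W ^ t * (W * (L / x - 1) ^ 2 + (1 - W) * B) := by gcongr
    have e3 : escapeBound n k s c p r a b γ η (1 / r₀ ^ 2) W K (t + 1) τ =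
        (((Real.exp (a * γ ^ 2 / 4) * Real.exp (-(a * n * x ^ 2)) +
        Real.exp (-(b * n * (m - 1 / q + r)))) + 1 / η * trans k (proportions τ)) +
        1 / r₀ ^ 2 * W ^ (t + 1) * (L / x - 1) ^ 2) + K (t + 1) := by
      unfold escapeBound
      rw [← hm, ← hx, ← hL, max_eq_left hx0.le]
    have e4 : K (t + 1) = K t + (E + 1 / η * (Ct / n ^ 2) +
        1 / r₀ ^ 2 * W ^ t * ((1 - W) * B)) := by
      simp only [hK]
      push_cast
      field_simp
      ring
    rw [e3, e4, hE]
    have e5 : 1 / r₀ ^ 2 * W ^ t * (W * (L / x - 1) ^ 2 + (1 - W) * B) =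
      1 / r₀ ^ 2 * W ^ (t + 1) * (L / x - 1) ^ 2 + 1 / r₀ ^ 2 * W ^ t * ((1 - W) * B) := by
      rw [pow_succ]; ring
    rw [e5] at i4
    linarith

/-! ### Reduction of the total-variation bound -/

/-- An event for the proportions is a test function with values in [0, 1], and the second starting
law is averaged pointwise over its support. -/
lemma proportionsTV_le {σ₀ : Config n q} {ν : Config n q → ℝ} (hν0 : ∀ τ, 0 ≤ ν τ)
    (hν1 : ∑ τ, ν τ = 1) {T : ℕ} {B : ℝ} {Q : Config n q → Prop} (hQ : ∀ τ, ν τ ≠ 0 → Q τ)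
    (h : ∀ f : Config n q → ℝ, (∀ τ, f τ ∈ Set.Icc (0 : ℝ) 1) → ∀ τ, Q τ →
      |(stepE n q β)^[T] f σ₀ - (stepE n q β)^[T] f τ| ≤ B) :
    proportionsTV n q β (Pi.single σ₀ 1) ν T ≤ B := by
  refine ciSup_le fun A => ?_
  rw [prob_glauberLaw, prob_glauberLaw]
  set f := (stepE n q β)^[T] ((proportions (n := n) (q := q) ⁻¹' A).indicator 1)
  have h1 : ∑ σ, (Pi.single σ₀ (1 : ℝ) : Config n q → ℝ) σ * f σ = ∑ τ, ν τ * f σ₀ := by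
    rw [← Finset.sum_mul, hν1, one_mul, Finset.sum_eq_single σ₀]
    · simp
    · intro τ _ hτ; simp [hτ]
    · simp
  rw [h1, ← Finset.sum_sub_distrib]
  calc _ ≤ ∑ τ, |ν τ * f σ₀ - ν τ * f τ| := Finset.abs_sum_le_sum_abs _ _
    _ ≤ ∑ τ, ν τ * B := by
        refine Finset.sum_le_sum fun τ _ => ?_
        rw [← mul_sub, abs_mul, abs_of_nonneg (hν0 τ)]
        rcases eq_or_ne (ν τ) 0 with h0 | h0
        · rw [h0]; simp
        · refine mul_le_mul_of_nonneg_left (h _ (fun ρ => ?_) τ (hQ τ h0)) (hν0 τ)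
          classical
          rw [Set.indicator_apply]
          split_ifs <;> simp
    _ = B := by rw [← Finset.sum_mul, hν1, one_mul]

lemma pottsMeasure_pos [NeZero q] (β : ℝ) (σ : Config n q) : 0 < pottsMeasure n q β σ :=
  div_pos (Real.exp_pos _) (Finset.sum_pos (fun _ _ => Real.exp_pos _) Finset.univ_nonempty)

lemma condOn_nonneg {Ω : Type*} [Fintype Ω] {μ : Ω → ℝ} (hμ : ∀ ω, 0 < μ ω) (E : Set Ω) (ω : Ω) :
    0 ≤ condOn μ E ω :=
  div_nonneg (Set.indicator_nonneg (fun ω _ => (hμ ω).le) ω)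
    (Finset.sum_nonneg fun ω _ => Set.indicator_nonneg (fun ω _ => (hμ ω).le) ω)

lemma sum_condOn {Ω : Type*} [Fintype Ω] {μ : Ω → ℝ} (hμ : ∀ ω, 0 < μ ω) {E : Set Ω}
    (hE : E.Nonempty) : ∑ ω, condOn μ E ω = 1 := by
  obtain ⟨ω₀, hω₀⟩ := hE
  simp only [condOn]
  rw [← Finset.sum_div]
  refine div_self (ne_of_gt ?_)
  refine Finset.sum_pos' (fun ω _ => Set.indicator_nonneg (fun ω _ => (hμ ω).le) ω)
    ⟨ω₀, Finset.mem_univ _, ?_⟩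
  rw [Set.indicator_of_mem hω₀]
  exact hμ ω₀

lemma mem_of_condOn_ne_zero {Ω : Type*} [Fintype Ω] {μ : Ω → ℝ} {E : Set Ω} {ω : Ω}
    (h : condOn μ E ω ≠ 0) : ω ∈ E := by
  by_contra hω
  exact h (by simp [condOn, hω])

lemma trans_le_l1Dist_sq (k : Fin q) (s : Fin q → ℝ) :
    trans k s ≤ l1Dist s (dominated k (s k)) ^ 2 := by
  unfold trans l1Dist
  simp_rw [← sq_abs (s _ - _)]
  exact Finset.sum_sq_le_sq_sum_of_nonneg fun _ _ => abs_nonneg _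

lemma targetDist_le_of_l1Dist (hq : 1 < q) (k : Fin q) {p δ : ℝ} {σ : Config n q}
    (h : l1Dist (proportions σ) (dominated k p) ≤ δ) :
    targetDist k p σ ≤ (1 + 4 * q) * δ ^ 2 := by
  have hq' : (2 : ℝ) ≤ q := by exact_mod_cast hq
  have h1 : ∀ i, |proportions σ i - dominated k p i| ≤ δ := fun i =>
    (Finset.single_le_sum (f := fun i => |proportions σ i - dominated k p i|)
      (fun _ _ => abs_nonneg _) (Finset.mem_univ i)).trans h
  have hδ : 0 ≤ δ := (abs_nonneg _).trans (h1 k)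
  have hk : |proportions σ k - p| ≤ δ := by simpa [dominated] using h1 k
  have h2 : ∀ i, (proportions σ i - dominated k (proportions σ k) i) ^ 2 ≤ 4 * δ ^ 2 := by
    intro i
    have h3 : |dominated k p i - dominated k (proportions σ k) i| ≤ δ := by
      refine le_trans ?_ hk
      by_cases hi : i = k
      · simp [dominated, hi, abs_sub_comm]
      · simp only [dominated, if_neg hi, ← sub_div]
        rw [abs_div, abs_of_pos (by linarith : (0 : ℝ) < q - 1), div_le_iff₀ (by linarith),
          show (1 - p - (1 - proportions σ k)) = proportions σ k - p by ring]
        nlinarith [abs_nonneg (proportions σ k - p)]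
    have h4 := abs_sub_le (proportions σ i) (dominated k p i) (dominated k (proportions σ k) i)
    have h5 : |proportions σ i - dominated k (proportions σ k) i| ≤ 2 * δ := by linarith [h1 i]
    calc _ = |proportions σ i - dominated k (proportions σ k) i| ^ 2 := (sq_abs _).symm
      _ ≤ (2 * δ) ^ 2 := by gcongr
      _ = _ := by ring
  have h6 : trans k (proportions σ) ≤ 4 * q * δ ^ 2 := by
    calc _ ≤ ∑ _i : Fin q, 4 * δ ^ 2 := Finset.sum_le_sum fun i _ => h2 i
      _ = _ := by simp; ring
  have h7 : (proportions σ k - p) ^ 2 ≤ δ ^ 2 := by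
    rw [← sq_abs]; gcongr
  unfold targetDist
  linarith

/-- After A N log N steps a contraction at rate y/N has gained N^{-2}. This beats both the initial
squared ratio, of order N/γ², and the initial Hamming distance, at most N. -/
lemma one_sub_div_pow_le {y A N : ℝ} {T : ℕ} (hN : 0 < N) (hy : 0 ≤ y) (hyN : y ≤ N)
    (hyA : 2 ≤ y * A) (hlog : 0 ≤ Real.log N) (hT : A * (N * Real.log N) ≤ T) :
    (1 - y / N) ^ T ≤ 1 / N ^ 2 := by
  have h0 : 0 ≤ 1 - y / N := by rw [sub_nonneg, div_le_one hN]; exact hyN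
  have h1 : 1 - y / N ≤ Real.exp (-(y / N)) := Real.one_sub_le_exp_neg _
  calc (1 - y / N) ^ T ≤ Real.exp (-(y / N)) ^ T := by gcongr
    _ = Real.exp (-(y / N * T)) := by rw [← Real.exp_nat_mul]; ring_nf
    _ ≤ Real.exp (-(2 * Real.log N)) := by
        rw [Real.exp_le_exp, neg_le_neg_iff]
        calc 2 * Real.log N ≤ y * A * Real.log N := by gcongr
          _ = y / N * (A * (N * Real.log N)) := by field_simp
          _ ≤ _ := by gcongr
    _ = 1 / N ^ 2 := by
        rw [Real.exp_neg, two_mul, Real.exp_add, Real.exp_log hN]; field_simp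

/-! ### Asymptotics of the error terms -/

open Filter Topology

/-- The transverse tolerance will be n^{-3/4}, so the error terms are expressed through y = n^{1/4}.
-/
lemma tendsto_sqrt_sqrt_natCast : Tendsto (fun n : ℕ => √√(n : ℝ)) atTop atTop :=
  Real.tendsto_sqrt_atTop.comp (Real.tendsto_sqrt_atTop.comp tendsto_natCast_atTop_atTop)

lemma sqrt_sqrt_pow_four (n : ℕ) : √√(n : ℝ) ^ 4 = n := by
  have h : √√(n : ℝ) ^ 4 = (√√(n : ℝ) ^ 2) ^ 2 := by ring
  rw [h, Real.sq_sqrt (Real.sqrt_nonneg _), Real.sq_sqrt (Nat.cast_nonneg _)]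

lemma tendsto_inv_pow_sqrt_sqrt {j : ℕ} (hj : j ≠ 0) :
    Tendsto (fun n : ℕ => 1 / √√(n : ℝ) ^ j) atTop (𝓝 0) := by
  simp_rw [one_div]
  exact (tendsto_inv_atTop_zero.comp ((tendsto_pow_atTop hj).comp tendsto_sqrt_sqrt_natCast))

lemma tendsto_log_pow_div_sqrt_sqrt (j : ℕ) :
    Tendsto (fun n : ℕ => Real.log √√(n : ℝ) ^ j / √√(n : ℝ)) atTop (𝓝 0) := by
  have := (Real.tendsto_pow_log_div_mul_add_atTop 1 0 j one_ne_zero).comp tendsto_sqrt_sqrt_natCast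
  simpa [Function.comp_def] using this

lemma tendsto_sq_mul_exp_neg {x : ℝ} (hx : 0 < x) :
    Tendsto (fun n : ℕ => (n : ℝ) ^ 2 * Real.exp (-(x * n))) atTop (𝓝 0) := by
  have h1 : Tendsto (fun n : ℕ => x * (n : ℝ)) atTop atTop :=
    tendsto_natCast_atTop_atTop.const_mul_atTop hx
  have h2 := ((Real.tendsto_pow_mul_exp_neg_atTop_nhds_zero 2).comp h1).const_mul (1 / x ^ 2)
  rw [mul_zero] at h2
  refine h2.congr fun n => ?_
  simp only [Function.comp_apply]
  field_simp

lemma tendsto_exp_neg_mul {x : ℝ} (hx : 0 < x) :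
    Tendsto (fun n : ℕ => Real.exp (-(x * n))) atTop (𝓝 0) :=
  Real.tendsto_exp_neg_atTop_nhds_zero.comp (tendsto_natCast_atTop_atTop.const_mul_atTop hx)

lemma log_natCast_eq (n : ℕ) : Real.log n = 4 * Real.log √√(n : ℝ) := by
  conv_lhs => rw [← sqrt_sqrt_pow_four n]
  rw [Real.log_pow]; norm_num

/-- The time scale `A n log n + 1`. -/
def timeScale (A : ℝ) (n : ℕ) : ℝ := A * (n * Real.log n) + 1

lemma tendsto_timeScale_div_mul (A : ℝ) :
    Tendsto (fun n : ℕ => timeScale A n / (n : ℝ) ^ 2 * √√(n : ℝ) ^ 3) atTop (𝓝 0) := by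
  have h := ((tendsto_log_pow_div_sqrt_sqrt 1).const_mul (4 * A)).add
    (tendsto_inv_pow_sqrt_sqrt (j := 5) (by norm_num))
  rw [mul_zero, add_zero] at h
  refine h.congr' ?_
  filter_upwards [tendsto_sqrt_sqrt_natCast.eventually_gt_atTop 0] with n hn
  have h1 := sqrt_sqrt_pow_four n
  rw [timeScale, log_natCast_eq]
  generalize √√(n : ℝ) = y at *
  rw [← h1]
  field_simp

lemma tendsto_timeScale_div (A : ℝ) :
    Tendsto (fun n : ℕ => timeScale A n / (n : ℝ) ^ 2) atTop (𝓝 0) := by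
  have h := (tendsto_timeScale_div_mul A).mul (tendsto_inv_pow_sqrt_sqrt (j := 3) (by norm_num))
  rw [mul_zero] at h
  refine h.congr' ?_
  filter_upwards [tendsto_sqrt_sqrt_natCast.eventually_gt_atTop 0] with n hn
  field_simp

lemma tendsto_timeScale_mul_exp (A : ℝ) {x : ℝ} (hx : 0 < x) :
    Tendsto (fun n : ℕ => timeScale A n * Real.exp (-(x * n))) atTop (𝓝 0) := by
  have h := (tendsto_timeScale_div A).mul (tendsto_sq_mul_exp_neg hx)
  rw [mul_zero] at h
  refine h.congr' ?_
  filter_upwards [eventually_gt_atTop 0] with n hn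
  have : (0 : ℝ) < n := by exact_mod_cast hn
  field_simp

lemma tendsto_log_div_sqrt_sq_mul (K : ℝ) :
    Tendsto (fun n : ℕ => (K * (Real.log n / √(n : ℝ))) ^ 2 * √√(n : ℝ) ^ 3) atTop (𝓝 0) := by
  have h := (tendsto_log_pow_div_sqrt_sqrt 2).const_mul (16 * K ^ 2)
  rw [mul_zero] at h
  refine h.congr' ?_
  filter_upwards [tendsto_sqrt_sqrt_natCast.eventually_gt_atTop 0] with n hn
  have h2 : √(n : ℝ) = √√(n : ℝ) ^ 2 := (Real.sq_sqrt (Real.sqrt_nonneg _)).symm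
  rw [log_natCast_eq]
  generalize √√(n : ℝ) = y at *
  rw [h2]
  field_simp
  ring

lemma tendsto_one_div_natCast : Tendsto (fun n : ℕ => 1 / (n : ℝ)) atTop (𝓝 0) :=
  tendsto_one_div_atTop_nhds_zero_nat

/-! ### Mixing in the basin of a target -/

set_option maxHeartbeats 800000 in
/-- The chain started at `σ₀` on the side of the target has nearly the law, after `T` steps, of
a chain started close to the target. -/
theorem exists_mixing_time (hq : 2 < q) (hβ : 0 < β) (hβq : β < q) {s c p lam d : ℝ}
    (ht : IsTarget q β s c p lam) (hd0 : 0 < d)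
    (hd : ∀ m ∈ Set.Icc (0 : ℝ) (1 / q), d * (1 / q - m) ≤ drift q β m) :
    ∃ c₁ > (0 : ℝ), ∃ C > (0 : ℝ), ∃ γ₀ > (0 : ℝ), ∀ γ : ℝ, γ₀ ≤ γ → ∀ K : ℝ, ∀ δ : ℕ → ℝ,
      Tendsto δ atTop (𝓝 0) → ∀ᶠ n : ℕ in atTop, ∀ (k : Fin q) (σ₀ : Config n q),
        l1Dist (proportions σ₀) (dominated k (proportions σ₀ k)) ≤ K * (Real.log n / √(n : ℝ)) →
        1 / (q : ℝ) ≤ proportions σ₀ k → γ / √(n : ℝ) ≤ s * (proportions σ₀ k - c) →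
        ∃ T : ℕ, (T : ℝ) ≤ C * (n * Real.log n) ∧
          ∀ ν : Config n q → ℝ, (∀ τ, 0 ≤ ν τ) → ∑ τ, ν τ = 1 →
            (∀ τ, ν τ ≠ 0 → l1Dist (proportions τ) (dominated k p) ≤ δ n) →
            proportionsTV n q β (Pi.single σ₀ 1) ν T ≤ Real.exp (-(c₁ * γ ^ 2)) := by
  have hq1 : 1 < q := by omega
  have : NeZero q := ⟨by omega⟩
  obtain ⟨r₀, hr₀, κ, hκ, C₂, hC₂, N₀, hloc⟩ := exists_local_coupling hq1 hβ.le hβq ht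
  obtain ⟨r, hr, hrq, hθ⟩ := exists_radius_trans hβ.le hβq
  set L := s * (p - c) with hL
  have hL0 : 0 < L := ht.dist_pos
  have hlam := ht.lam_pos
  have hlL : 0 < lam * L := mul_pos hlam hL0
  set a := min (1 / 2) (lam * L / 8) with ha
  have ha0 : 0 < a := lt_min (by norm_num) (by positivity)
  have ha1 : 2 * a ≤ 1 := by linarith [min_le_left (1 / 2 : ℝ) (lam * L / 8)]
  have ha2 : a ≤ lam * L / 8 := min_le_right _ _
  set b := min 1 (d * r / 4) with hb
  have hb0 : 0 < b := lt_min one_pos (by positivity)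
  have hb1 : b ≤ 1 := min_le_left _ _
  have hb2 : b ≤ d * r / 4 := min_le_right _ _
  set C₀ := (β ^ 2 + 2 * β) * Real.exp (2 * β) with hC₀
  have hC₀0 : 0 ≤ C₀ := by positivity
  set Ct := 4 * (q : ℝ) + 4 * q * β * Real.exp (2 * β) with hCt
  have hCt0 : 0 ≤ Ct := by positivity
  -- Large enough for both contraction rates, `lam * L` in the burn-in and `1 - κ` in the coupling.
  set A := 2 / (lam * L) + 2 / (1 - κ) with hA
  have hκ' : 0 < 1 - κ := by linarith
  have hA0 : 0 < A := by positivity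
  have hA1 : 2 ≤ lam * L * A := by
    have : lam * L * A = 2 + lam * L * (2 / (1 - κ)) := by rw [hA]; field_simp
    rw [this]
    have : 0 ≤ lam * L * (2 / (1 - κ)) := by positivity
    linarith
  have hA2 : 2 ≤ (1 - κ) * A := by
    have : (1 - κ) * A = 2 + (1 - κ) * (2 / (lam * L)) := by rw [hA]; field_simp; ring
    rw [this]
    have : 0 ≤ (1 - κ) * (2 / (lam * L)) := by positivity
    linarith
  -- The escape estimate gives the exponent `3 / 4 * a`; lowering it to `a / 2` makes room for the
  -- vanishing errors.
  refine ⟨a / 2, by positivity, 2 * A + 2, by positivity, √(192 / (lam * L)),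
    Real.sqrt_pos.2 (by positivity), fun γ hγ K δ hδ => ?_⟩
  have hγ0 : 0 < γ := (Real.sqrt_pos.2 (by positivity)).trans_le hγ
  have hγ2 : 192 / (lam * L) ≤ γ ^ 2 := (Real.sqrt_le_left hγ0.le).1 hγ
  -- The choice n^{-3/4} lies between two scales: it exceeds the initial squared deviation, of order
  -- (log n)²/n, and its growth, of order (log n)/n, while the drift error it causes stays below
  -- n^{-1/2}.
  set η : ℕ → ℝ := fun n => 1 / √√(n : ℝ) ^ 3 with hη
  set ε : ℕ → ℝ := fun n => C₀ * (η n + 1 / n) with hε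
  set B : ℕ → ℝ := fun n => (8 * ε n / L + 96 / (L ^ 2 * n)) / (lam * L) with hB
  set E : ℕ → ℝ := fun n => Real.exp (a * γ ^ 2 / 4) * (Real.exp 1 *
    Real.exp (-(a * n * L ^ 2 / 4))) + Real.exp 1 * Real.exp (-(b * n * r / 2)) with hE
  have tη : Tendsto η atTop (𝓝 0) := tendsto_inv_pow_sqrt_sqrt (by norm_num)
  have tε : Tendsto ε atTop (𝓝 0) := by
    have h := (tη.add tendsto_one_div_natCast).const_mul C₀
    rwa [add_zero, mul_zero] at h
  have tB : Tendsto B atTop (𝓝 0) := by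
    have h := (((tε.const_mul (8 / L)).add (tendsto_one_div_natCast.const_mul
      (96 / L ^ 2)))).div_const (lam * L)
    simp only [mul_zero, add_zero, zero_div] at h
    refine h.congr fun n => ?_
    simp only [hB]
    congr 1
    rw [mul_one_div, div_div]
    ring
  have tts : Tendsto (fun n => timeScale A n / (n : ℝ) ^ 2) atTop (𝓝 0) := tendsto_timeScale_div A
  have tE : Tendsto (fun n => timeScale A n * E n) atTop (𝓝 0) := by
    have h := ((tendsto_timeScale_mul_exp A (x := a * L ^ 2 / 4) (by positivity)).const_mul
      (Real.exp (a * γ ^ 2 / 4) * Real.exp 1)).add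
      ((tendsto_timeScale_mul_exp A (x := b * r / 2) (by positivity)).const_mul (Real.exp 1))
    simp only [mul_zero, add_zero] at h
    refine h.congr fun n => ?_
    simp only [hE]
    rw [show a * L ^ 2 / 4 * (n : ℝ) = a * n * L ^ 2 / 4 by ring,
      show b * r / 2 * (n : ℝ) = b * n * r / 2 by ring]
    ring
  set err : ℕ → ℝ := fun n => Real.exp (-(b * r * n)) + timeScale A n * E n +
    (K * (Real.log n / √(n : ℝ))) ^ 2 * √√(n : ℝ) ^ 3 +
    Ct * (timeScale A n / (n : ℝ) ^ 2 * √√(n : ℝ) ^ 3) +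
    (2 * L ^ 2 / γ ^ 2 * (1 / n) + 2 * (1 / n) * (1 / n)) / r₀ ^ 2 +
    (B n + η n + C₂ * (timeScale A n / (n : ℝ) ^ 2)) / r₀ ^ 2 + 1 / n +
    ((1 + 4 * q) * δ n ^ 2 + 2 * C₂ * (timeScale A n / (n : ℝ) ^ 2)) / r₀ ^ 2 with herr
  have terr : Tendsto err atTop (𝓝 0) := by
    have h1n := tendsto_one_div_natCast
    have h := (((((((tendsto_exp_neg_mul (x := b * r) (by positivity)).add tE).add
      (tendsto_log_div_sqrt_sq_mul K)).add ((tendsto_timeScale_div_mul A).const_mul Ct)).add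
      (((h1n.const_mul (2 * L ^ 2 / γ ^ 2)).add ((h1n.const_mul 2).mul h1n)).div_const
        (r₀ ^ 2))).add
      (((tB.add tη).add (tts.const_mul C₂)).div_const (r₀ ^ 2))).add h1n).add
      ((((hδ.pow 2).const_mul (1 + 4 * (q : ℝ))).add (tts.const_mul (2 * C₂))).div_const (r₀ ^ 2))
    norm_num only [mul_zero, add_zero, zero_div] at h
    exact h
  -- For fixed γ this gap is positive, so it eventually exceeds the total error. The threshold for
  -- `n` thus depends on γ, the constants do not.
  have hgap : 0 < Real.exp (-(a / 2 * γ ^ 2)) - Real.exp (-(3 / 4 * a * γ ^ 2)) := by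
    rw [sub_pos, Real.exp_lt_exp]
    have : 0 < a * γ ^ 2 := by positivity
    linarith
  have ev1 : ∀ᶠ n : ℕ in atTop, C₀ * (1 / √√(n : ℝ) ^ 1 + 1 / √√(n : ℝ) ^ 2) ≤
      lam * L / 12 * (γ / 2) := by
    have h := ((tendsto_inv_pow_sqrt_sqrt (j := 1) (by norm_num)).add
      (tendsto_inv_pow_sqrt_sqrt (j := 2) (by norm_num))).const_mul C₀
    simp only [add_zero, mul_zero] at h
    exact h.eventually_le_const (by positivity)
  have tsqrt : Tendsto (fun n : ℕ => √(n : ℝ)) atTop atTop :=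
    Real.tendsto_sqrt_atTop.comp tendsto_natCast_atTop_atTop
  filter_upwards [ev1, tε.eventually_le_const (by positivity : 0 < d * r / 4),
    tη.eventually_le_const (by positivity : 0 < r ^ 2), terr.eventually_le_const hgap,
    tsqrt.eventually_ge_atTop (4 / γ), tendsto_natCast_atTop_atTop.eventually_ge_atTop (lam * L),
    tendsto_natCast_atTop_atTop.eventually_ge_atTop (1 - κ),
    eventually_ge_atTop N₀, eventually_ge_atTop 3] with n e1 e2 e3 e4 e5 e6 e7 e8 e9 k σ₀ h1 h2 h3
  have hn0 : n ≠ 0 := by omega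
  have : NeZero n := ⟨hn0⟩
  have hn : (0 : ℝ) < n := by exact_mod_cast Nat.pos_of_ne_zero hn0
  have hn3 : (3 : ℝ) ≤ n := by exact_mod_cast e9
  have hlog : 1 ≤ Real.log n := by
    rw [Real.le_log_iff_exp_le hn]
    linarith only [Real.exp_one_lt_d9, hn3]
  have hnlog : 1 ≤ n * Real.log n := by
    have := mul_le_mul (by linarith only [hn3] : (1 : ℝ) ≤ n) hlog zero_le_one hn.le
    linarith only [this]
  have hsn : 0 < √(n : ℝ) := Real.sqrt_pos.2 hn
  have hy : 0 < √√(n : ℝ) := Real.sqrt_pos.2 hsn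
  set T := ⌈A * (n * Real.log n)⌉₊ with hT
  have hTlo : A * (n * Real.log n) ≤ T := Nat.le_ceil _
  have hThi : (T : ℝ) ≤ timeScale A n := (Nat.ceil_lt_add_one (by positivity)).le
  -- The first `T` steps bring the chain to the target, the second `T` steps couple it. The ceiling
  -- in `T` costs at most 1 ≤ n log n each time.
  refine ⟨T + T, ?_, fun ν hν0 hν1 hν => ?_⟩
  · push_cast
    rw [timeScale] at hThi
    linarith only [hThi, hnlog]
  have hη0 : 0 < η n := by simp only [hη]; positivity
  -- The drift error is o(n^{-1/2}), so it is dominated by the drift already at distance `γ / (2√n)`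
  -- from `c`.
  have hεγ : ε n ≤ lam * L / 12 * (γ / (2 * √n)) := by
    have hy2 : √(n : ℝ) = √√(n : ℝ) ^ 2 := (Real.sq_sqrt (Real.sqrt_nonneg _)).symm
    have h4 := sqrt_sqrt_pow_four n
    have e : ε n = C₀ * (1 / √√(n : ℝ) ^ 1 + 1 / √√(n : ℝ) ^ 2) / √(n : ℝ) := by
      simp only [hε, hη]
      have h5 : ∀ y N S : ℝ, 0 < y → S = y ^ 2 → y ^ 4 = N → C₀ * (1 / y ^ 3 + 1 / N) =
        C₀ * (1 / y ^ 1 + 1 / y ^ 2) / S := by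
        intro y N S hy hS hN
        rw [hS, ← hN]; field_simp
      exact h5 _ _ _ hy hy2 h4
    rw [e]
    calc _ ≤ lam * L / 12 * (γ / 2) / √n := by gcongr
      _ = _ := by field_simp
  have hnγ : 1 / (n : ℝ) ≤ γ / (2 * √n) / 2 := by
    rw [div_le_iff₀ hγ0] at e5
    have h4 : √(n : ℝ) * √(n : ℝ) = n := Real.mul_self_sqrt hn.le
    have : 1 / (n : ℝ) = 4 / (√n * √n * 4) := by rw [h4]; field_simp
    rw [this, div_div, div_le_div_iff₀ (by positivity) (by positivity)]
    have := mul_le_mul_of_nonneg_left e5 hsn.le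
    linarith only [this]
  obtain ⟨hstep, hcoup⟩ := hloc n e8 hn0 k
  set G := exitBound (n := n) k p r₀ C₂ with hG
  have hGmem : ∀ t τ, G t τ ∈ Set.Icc (0 : ℝ) 1 := fun t τ =>
    ⟨exitBound_nonneg k p r₀ hC₂.le t τ, min_le_left _ _⟩
  have hTn : C₂ * (T : ℝ) / n ^ 2 ≤ C₂ * (timeScale A n / (n : ℝ) ^ 2) := by
    rw [mul_div_assoc]; gcongr
  have hesc : (stepE n q β)^[T] (G T) σ₀ ≤ Real.exp (-(3 / 4 * a * γ ^ 2)) +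
      (Real.exp (-(b * r * n)) + timeScale A n * E n +
      (K * (Real.log n / √(n : ℝ))) ^ 2 * √√(n : ℝ) ^ 3 +
      Ct * (timeScale A n / (n : ℝ) ^ 2 * √√(n : ℝ) ^ 3) +
      (2 * L ^ 2 / γ ^ 2 * (1 / n) + 2 * (1 / n) * (1 / n)) / r₀ ^ 2 +
      (B n + η n + C₂ * (timeScale A n / (n : ℝ) ^ 2)) / r₀ ^ 2) := by
    have hmain := iterate_stepE_le_escapeBound hq1 hβ.le ht hd0 hd hr hrq hθ ha0 ha1 ha2 hb0 hb1
      hb2 hγ0 hγ2 hη0 e3 hr₀ (Bg := C₂ * (T : ℝ) / n ^ 2) (by positivity) (ε := ε n) rfl hεγ e2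
      hnγ e6 (B := B n) rfl k (hGmem T) (fun τ => min_le_right _ _) T σ₀
    refine hmain.trans ?_
    unfold escapeBound
    rw [← hL]
    set x := s * (proportions σ₀ k - c) with hx
    have hx0 : 0 < x := lt_of_lt_of_le (by positivity) h3
    have hx2 : γ ^ 2 / n ≤ x ^ 2 := by
      have : (γ / √(n : ℝ)) ^ 2 ≤ x ^ 2 := by gcongr
      rwa [div_pow, Real.sq_sqrt hn.le] at this
    -- The start at distance at least γ/√n contributes e^{-aγ²} and the normalization e^{aγ²/4},
    -- whence the exponent 3/4.
    have i1 : Real.exp (a * γ ^ 2 / 4) * Real.exp (-(a * n * (max x 0) ^ 2)) ≤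
        Real.exp (-(3 / 4 * a * γ ^ 2)) := by
      rw [max_eq_left hx0.le, ← Real.exp_add, Real.exp_le_exp]
      have : a * n * (γ ^ 2 / n) ≤ a * n * x ^ 2 := by gcongr
      have e : a * n * (γ ^ 2 / n) = a * γ ^ 2 := by field_simp
      linarith only [this, e]
    have i2 : Real.exp (-(b * n * (proportions σ₀ k - 1 / q + r))) ≤ Real.exp (-(b * r * n)) := by
      rw [Real.exp_le_exp]
      have : 0 ≤ b * n * (proportions σ₀ k - 1 / q) := 
        mul_nonneg (by positivity) (sub_nonneg.2 h2)
      linarith only [this]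
    have i3 : 1 / η n * trans k (proportions σ₀) ≤
        (K * (Real.log n / √(n : ℝ))) ^ 2 * √√(n : ℝ) ^ 3 := by
      have e : 1 / η n = √√(n : ℝ) ^ 3 := by simp only [hη, one_div_one_div]
      rw [e, mul_comm]
      gcongr
      refine (trans_le_l1Dist_sq k _).trans ?_
      have : 0 ≤ l1Dist (proportions σ₀) (dominated k (proportions σ₀ k)) :=
        Finset.sum_nonneg fun _ _ => abs_nonneg _
      gcongr
    have hW := one_sub_div_pow_le hn hlL.le e6 hA1 (zero_le_one.trans hlog) hTlo
    have hW0 : 0 ≤ 1 - lam * L / (n : ℝ) := by rw [sub_nonneg, div_le_one hn]; exact e6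
    have i4 : 1 / r₀ ^ 2 * (1 - lam * L / n) ^ T * (L / x - 1) ^ 2 ≤
        (2 * L ^ 2 / γ ^ 2 * (1 / n) + 2 * (1 / n) * (1 / n)) / r₀ ^ 2 := by
      have hu : (L / x - 1) ^ 2 ≤ 2 * (L ^ 2 * n / γ ^ 2) + 2 := by
        have h5 : (L / x) ^ 2 ≤ L ^ 2 * n / γ ^ 2 := by
          rw [div_pow, div_le_div_iff₀ (by positivity) (by positivity)]
          rw [div_le_iff₀ hn] at hx2
          have := mul_le_mul_of_nonneg_left hx2 (sq_nonneg L)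
          linarith only [this]
        have h6 : (L / x - 1) ^ 2 = 2 * (L / x) ^ 2 + 2 - (L / x + 1) ^ 2 := by ring
        linarith only [h5, h6, sq_nonneg (L / x + 1)]
      calc _ ≤ 1 / r₀ ^ 2 * (1 / (n : ℝ) ^ 2) * (2 * (L ^ 2 * n / γ ^ 2) + 2) := by gcongr
        _ = _ := by field_simp
    have i5 : (T : ℝ) * E n ≤ timeScale A n * E n := by
      have : 0 ≤ E n := by simp only [hE]; positivity
      gcongr
    have i6 : Ct * (T : ℝ) / n ^ 2 / η n ≤
        Ct * (timeScale A n / (n : ℝ) ^ 2 * √√(n : ℝ) ^ 3) := by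
      have e : Ct * (T : ℝ) / n ^ 2 / η n = Ct * ((T : ℝ) / n ^ 2 * √√(n : ℝ) ^ 3) := by
        simp only [hη]; field_simp
      rw [e]; gcongr
    have hB0 : 0 ≤ B n := by simp only [hB, hε]; positivity
    have i7 : ((1 - (1 - lam * L / n) ^ T) * B n + η n + C₂ * (T : ℝ) / n ^ 2) / r₀ ^ 2 ≤
        (B n + η n + C₂ * (timeScale A n / (n : ℝ) ^ 2)) / r₀ ^ 2 := by
      have : (1 - (1 - lam * L / n) ^ T) * B n ≤ B n := by
        have : 0 ≤ (1 - lam * L / n) ^ T * B n := by positivity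
        linarith only [this]
      gcongr
    have hEn : E n = Real.exp (a * γ ^ 2 / 4) * (Real.exp 1 *
      Real.exp (-(a * n * L ^ 2 / 4))) + Real.exp 1 * Real.exp (-(b * n * r / 2)) := rfl
    rw [hEn] at i5 ⊢
    linarith only [i1, i2, i3, i4, i5, i6, i7]
  -- The chain started in the phase needs no stationarity: its squared distance to the target is
  -- O(δ²) and grows by o(1) over both halves.
  have hstay : ∀ τ, l1Dist (proportions τ) (dominated k p) ≤ δ n →
      (stepE n q β)^[T] (G T) τ ≤
        ((1 + 4 * q) * δ n ^ 2 + 2 * C₂ * (timeScale A n / (n : ℝ) ^ 2)) / r₀ ^ 2 := by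
    intro τ hτ
    refine (iterate_stepE_le_shift hstep T T τ).trans ((min_le_right _ _).trans ?_)
    have h5 := targetDist_le_of_l1Dist hq1 k hτ
    have e : C₂ * ((T + T : ℕ) : ℝ) / n ^ 2 = 2 * (C₂ * (T : ℝ) / n ^ 2) := by push_cast; ring
    rw [e]
    refine div_le_div_of_nonneg_right ?_ (by positivity)
    linarith only [hTn, h5]
  have hcontr : (1 - (1 - κ) / n) ^ T * (n : ℝ) ≤ 1 / n := by
    have := one_sub_div_pow_le hn hκ'.le e7 hA2 (zero_le_one.trans hlog) hTlo
    calc _ ≤ 1 / (n : ℝ) ^ 2 * n := by gcongr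
      _ = _ := by field_simp
  -- The coupling bound for the last `T` steps is averaged over a burn-in of `T` steps for both
  -- chains, in both orders so as to obtain an absolute value.
  refine proportionsTV_le hν0 hν1 hν fun f hf τ hτ => ?_
  rw [Function.iterate_add_apply]
  have hc := fun σ τ => hcoup f hf T σ τ
  have b1 := iterate_stepE_sub_le_of_burnIn (β := β) hc T σ₀ τ
  have b2 := iterate_stepE_sub_le_of_burnIn (β := β) hc T τ σ₀
  have h5 := hstay τ hτ
  have e4' : err n ≤ _ := e4
  simp only [herr] at e4'
  rw [abs_le]
  constructor <;> linarith only [b1, b2, h5, e4', hesc, hcontr]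

end

end MeanFieldPotts

theorem mainTheorem6 (q : ℕ) (hq : 2 < q) (β : ℝ)
    (hβ : β ∈ Set.Ioo (MeanFieldPotts.betaU q) (MeanFieldPotts.betaS q)) :
    ∃ c > (0 : ℝ), ∃ C > (0 : ℝ), ∃ γ₀ > (0 : ℝ),
      ∀ γ : ℝ, γ₀ ≤ γ → ∀ K : ℝ, ∀ δ : ℕ → ℝ, Filter.Tendsto δ Filter.atTop (nhds 0) →
      ∀ᶠ n : ℕ in Filter.atTop, ∀ (k : Fin q) (σ₀ : MeanFieldPotts.Config n q),
        MeanFieldPotts.l1Dist (MeanFieldPotts.proportions σ₀)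
            (MeanFieldPotts.dominated k (MeanFieldPotts.proportions σ₀ k))
          ≤ K * (Real.log n / √(n : ℝ)) →
        (1 / (q : ℝ) < MeanFieldPotts.proportions σ₀ k →
          MeanFieldPotts.proportions σ₀ k ≤ MeanFieldPotts.mStar q β - γ / √(n : ℝ) →
          (MeanFieldPotts.disPhase n q (δ n)).Nonempty →
          ∃ T : ℕ, (T : ℝ) ≤ C * (n * Real.log n) ∧
            MeanFieldPotts.proportionsTV n q β (Pi.single σ₀ 1)
              (MeanFieldPotts.piDis n q β (δ n)) T ≤ Real.exp (-(c * γ ^ 2))) ∧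
        (MeanFieldPotts.mStar q β + γ / √(n : ℝ) ≤ MeanFieldPotts.proportions σ₀ k →
          (MeanFieldPotts.ordPhase n q β k (δ n)).Nonempty →
          ∃ T : ℕ, (T : ℝ) ≤ C * (n * Real.log n) ∧
            MeanFieldPotts.proportionsTV n q β (Pi.single σ₀ 1)
              (MeanFieldPotts.piOrd n q β k (δ n)) T ≤ Real.exp (-(c * γ ^ 2))) := by
  open MeanFieldPotts in
  have hq' : (2 : ℝ) < q := by exact_mod_cast hq
  have hq0 : (q : ℝ) ≠ 0 := by linarith
  have hq1 : (q : ℝ) - 1 ≠ 0 := by linarith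
  have : NeZero q := ⟨by omega⟩
  have hβ0 : 0 < β := (betaU_nonneg hq).trans_lt hβ.1
  have hβq : β < q := hβ.2
  obtain ⟨h1, h2, h3, h4, h5, ⟨lam₁, hlam₁, hd₁⟩, ⟨lam₂, hlam₂, hd₂⟩⟩ := drift_structure hq hβ
  have h1q : 1 / (q : ℝ) ≤ 1 := by rw [div_le_one (by linarith)]; linarith
  have hslope : β * q * (1 / q) * (1 - 1 / (q : ℝ)) / (q - 1) < 1 := by
    have : β * q * (1 / q) * (1 - 1 / (q : ℝ)) / (q - 1) = β / q := by field_simp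
    rw [this, div_lt_one (by linarith)]
    exact hβq
  have ht₁ : IsTarget q β (-1) (mStar q β) (1 / q) lam₁ :=
    ⟨Or.inr rfl, hlam₁, by linarith, h1, h2.trans h3, le_rfl, h1q, drift_one_div hq β, hslope, hd₁⟩
  have ht₂ : IsTarget q β 1 (mStar q β) (mR q β) lam₂ :=
    ⟨Or.inl rfl, hlam₂, by linarith, h1, h2.trans h3, (h1.trans h2).le, h3.le, h4, h5, hd₂⟩
  -- To the left of 1/q the drift pushes back towards 1/q. This linear bound feeds the left barrier
  -- for both targets.
  have hd : ∀ m ∈ Set.Icc (0 : ℝ) (1 / q),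
      lam₁ * (mStar q β - 1 / q) * (1 / q - m) ≤ drift q β m := by
    intro m hm
    rcases eq_or_lt_of_le hm.2 with h | h
    · rw [h, drift_one_div hq]; simp
    · have h6 := hd₁ m ⟨hm.1, hm.2.trans h1q⟩ (by linarith)
      have h7 : lam₁ * (mStar q β - m) * (1 / q - m) ≤ drift q β m := by
        refine le_of_mul_le_mul_right ?_ (sub_pos.2 h)
        linarith
      have h8 : lam₁ * (mStar q β - 1 / q) * (1 / q - m) ≤
          lam₁ * (mStar q β - m) * (1 / q - m) := by
        have := sub_pos.2 h
        gcongr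
      linarith
  have hd0 : 0 < lam₁ * (mStar q β - 1 / q) := mul_pos hlam₁ (by linarith)
  obtain ⟨c₁, hc₁, C₁, hC₁, γ₁, hγ₁, H₁⟩ := exists_mixing_time hq hβ0 hβq ht₁ hd0 hd
  obtain ⟨c₂, hc₂, C₂, hC₂, γ₂, hγ₂, H₂⟩ := exists_mixing_time hq hβ0 hβq ht₂ hd0 hd
  refine ⟨min c₁ c₂, lt_min hc₁ hc₂, max C₁ C₂, lt_max_of_lt_left hC₁, max γ₁ γ₂,
    lt_max_of_lt_left hγ₁, fun γ hγ K δ hδ => ?_⟩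
  filter_upwards [H₁ γ ((le_max_left _ _).trans hγ) K δ hδ,
    H₂ γ ((le_max_right _ _).trans hγ) K δ hδ] with n hn₁ hn₂ k σ₀ hσ
  have hnlog : 0 ≤ (n : ℝ) * Real.log n :=
    mul_nonneg (Nat.cast_nonneg _) (Real.log_natCast_nonneg n)
  have hγn : 0 ≤ γ / √(n : ℝ) :=
    div_nonneg (hγ₁.le.trans ((le_max_left _ _).trans hγ)) (Real.sqrt_nonneg _)
  constructor
  · intro hlo hhi hne
    obtain ⟨T, hT, hTV⟩ := hn₁ k σ₀ hσ hlo.le (by linarith)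
    refine ⟨T, hT.trans (mul_le_mul_of_nonneg_right (le_max_left _ _) hnlog), ?_⟩
    refine (hTV _ (condOn_nonneg (pottsMeasure_pos β) _) (sum_condOn (pottsMeasure_pos β) hne)
      fun τ hτ => ?_).trans ?_
    · have hdom : dominated k (1 / (q : ℝ)) = fun _ => 1 / (q : ℝ) := by
        funext i
        unfold dominated
        split_ifs
        · rfl
        · field_simp
      rw [hdom]
      have hmem : τ ∈ disPhase n q (δ n) := mem_of_condOn_ne_zero hτ
      exact hmem
    · gcongr
      exact min_le_left _ _
  · intro hlo hne
    obtain ⟨T, hT, hTV⟩ := hn₂ k σ₀ hσ (by linarith) (by linarith)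
    refine ⟨T, hT.trans (mul_le_mul_of_nonneg_right (le_max_right _ _) hnlog), ?_⟩
    refine (hTV _ (condOn_nonneg (pottsMeasure_pos β) _) (sum_condOn (pottsMeasure_pos β) hne)
      fun τ hτ => ?_).trans ?_
    · have hmem : τ ∈ ordPhase n q β k (δ n) := mem_of_condOn_ne_zero hτ
      exact hmem
    · gcongr
      exact min_le_right _ _
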